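/- Let $k$ be a field of characteristic zero and let $\mathfrak a$ be a commutative local Artinian $k$-algebra with maximal ideal $\mathfrak m$. Let $\mathcal L$ be a cosimplicial DGLA over $k$, i.e. a functor $[n]\mapsto\mathcal L^n$ from the simplex category to differential graded Lie algebras, and let $\mathcal L^{n,p}$ be the component of degree $p$ of $\mathcal L^n$; assume $\mathcal L^{n,p}=0$ for $p<-1$. For $x$ in cosimplicial degree $r$ let $x_{i_0\ldots i_r}$ be its image in cosimplicial degree $n$ under $[r]\to[n]$, $j\mapsto i_j$. For a Maurer–Cartan element $\mu$ (that is, $\mu\in\mathcal L^{n,1}\otimes\mathfrak m$, $d\mu+\frac12[\mu,\mu]=0$), a gauge transformation $\lambda\to\mu$ is an element $G=\exp X$ of the unipotent group $\exp(\mathcal L^{n,0}\otimes\mathfrak m)$ with $d+\mu=\exp(\operatorname{ad}X)(d+\lambda)$. A two-morphism $H\to G$ between gauge transformations with target $\mu$ is an element $c=\exp t$, $t\in\mathcal L^{n,-1}\otimes\mathfrak m$, with $G=\exp(dt+[\mu,t])\,H$. Two-morphisms are multiplied (composed) in the group $\exp((\mathcal L^{n,-1}\otimes\mathfrak m)_\mu)$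 of the Lie algebra with bracket $[a,b]_\mu=[a,db+[\mu,b]]$; $G(c)$ denotes the adjoint action. Define: * A *descent datum* $\mathcal A=(\lambda,G,c)$ of the Deligne two-groupoid of $\mathcal L\otimes\mathfrak m$: a Maurer–Cartan element $\lambda\in\mathcal L^{0,1}\otimes\mathfrak m$, a gauge transformation $G:\lambda_1\to\lambda_0$ in $\exp(\mathcal L^{1,0}\otimes\mathfrak m)$, and a two-morphism $c:G_{01}G_{12}\to G_{02}$, $c\in\exp((\mathcal L^{2,-1}\otimes\mathfrak m)_{\lambda_0})$, such that $c_{023}\,c_{012}=c_{013}\,G_{01}(c_{123})$. * An *isomorphism* $(H,b):(\lambda',G',c')\to(\lambda'',G'',c'')$: a gauge transformation $H:\lambda'\to\lambda''$ and a two-morphism $b:H_0G'_{01}\to G''_{01}H_1$ such that $G''_{01}(b_{12})\,b_{01}=(c'')^{-1}\,b_{02}\,H_0(c')$. * A *two-isomorphism* $a:(H',b')\to(H'',b'')$ between isomorphisms $(\lambda',G',c')\to(\lambda'',G'',c'')$: a two-morphism $a:H'\to H''$ such that $b''_{01}\,a_0=G''_{01}(a_1)\,b'_{01}$. Let $\mathcal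 L_1,\mathcal L_2$ be cosimplicial DGLAs with $\mathcal L_i^{n,p}=0$ for $p<-1$, and let $f:\mathcal L_1\to\mathcal L_2$ be a morphism of cosimplicial DGLAs. Being isomorphic is an equivalence relation on descent data, being two-isomorphic is an equivalence relation on isomorphisms between two fixed descent data, and: a) $f$ induces a map from the set of isomorphism classes of descent data of the Deligne two-groupoid of $\mathcal L_1\otimes\mathfrak m$ to that of $\mathcal L_2\otimes\mathfrak m$. Assume moreover that $f$ induces a quasi-isomorphism of the total complexes of the double complexes $\mathcal L_1^{n,p}\to\mathcal L_2^{n,p}$ (with differential $d+\partial$, $\partial=\sum_i(-1)^id_i$, and the usual sign $(-1)^n$ on $d$). Then: b) The map in a) is a bijection. c) For all descent data $\mathcal A,\mathcal A'$ of $\mathcal L_1\otimes\mathfrak m$, $f$ induces a bijection $\operatorname{Iso}(\mathcal A,\mathcal A')/2\text{-}\operatorname{Iso}\to\operatorname{Iso}(f(\mathcal A),f(\mathcal A'))/2\text{-}\operatorname{Iso}$. d) For all isomorphisms $\phi,\psi:\mathcal A\to\mathcal A'$, $f$ induces a bijection $2\text{-}\operatorname{Iso}(\phi,\psi)\to2\text{-}\operatorname{Iso}(f(\phi),f(\psi))$.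 (Statements b), c), d) together are what is meant by saying that $f$ induces an equivalence of two-groupoids of descent data.) -/

import Mathlib

open CategoryTheory
open scoped TensorProduct

universe u v w

/-! ## Differential graded Lie algebras -/

/-- A differential graded Lie algebra over a field `k` (used in characteristic zero), graded by `ℤ`.
The differential and the bracket are indexed by a proof of the relation between the degrees. -/
structure DGLA (k : Type u) [Field k] where
  /-- the component of degree `p` -/
  V : ℤ → Type v
  [addCommGroup : ∀ p, AddCommGroup (V p)]
  [module : ∀ p, Module k (V p)]
  /-- the differential, of degree one -/
  d : ∀ p q : ℤ, p + 1 = q → V p →ₗ[k] V q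
  /-- the bracket, of degree zero -/
  bracket : ∀ p q r : ℤ, p + q = r → V p →ₗ[k] V q →ₗ[k] V r
  d_d : ∀ (p q r : ℤ) (h : p + 1 = q) (h' : q + 1 = r) (x : V p), d q r h' (d p q h x) = 0
  skew : ∀ (p q r : ℤ) (h : p + q = r) (h' : q + p = r) (x : V p) (y : V q),
    bracket p q r h x y = -((p * q).negOnePow • bracket q p r h' y x)
  leibniz : ∀ (p q r p' q' r' : ℤ) (h : p + q = r) (hp : p + 1 = p') (hq : q + 1 = q')
    (hr : r + 1 = r') (h₁ : p' + q = r') (h₂ : p + q' = r') (x : V p) (y : V q),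
    d r r' hr (bracket p q r h x y) =
      bracket p' q r' h₁ (d p p' hp x) y + p.negOnePow • bracket p q' r' h₂ x (d q q' hq y)
  jacobi : ∀ (p q r pq qr pr s : ℤ) (h₁ : p + q = pq) (h₂ : q + r = qr) (h₃ : p + r = pr)
    (h₄ : p + qr = s) (h₅ : pq + r = s) (h₆ : q + pr = s) (x : V p) (y : V q) (z : V r),
    bracket p qr s h₄ x (bracket q r qr h₂ y z) =
      bracket pq r s h₅ (bracket p q pq h₁ x y) z +
        (p * q).negOnePow • bracket q pr s h₆ y (bracket p r pr h₃ x z)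

namespace DGLA

attribute [instance] DGLA.addCommGroup DGLA.module

variable {k : Type u} [Field k]

/-- A morphism of differential graded Lie algebras. -/
@[ext]
structure Hom (g g' : DGLA.{u, v} k) where
  f : ∀ p, g.V p →ₗ[k] g'.V p
  map_d : ∀ (p q : ℤ) (h : p + 1 = q) (x : g.V p), f q (g.d p q h x) = g'.d p q h (f p x)
  map_bracket : ∀ (p q r : ℤ) (h : p + q = r) (x : g.V p) (y : g.V q),
    f r (g.bracket p q r h x y) = g'.bracket p q r h (f p x) (f q y)

instance : Category (DGLA.{u, v} k) where
  Hom := Hom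
  id g := ⟨fun _ => LinearMap.id, fun _ _ _ _ => rfl, fun _ _ _ _ _ _ => rfl⟩
  comp a b := ⟨fun p => (b.f p).comp (a.f p),
    fun p q h x => by simp [a.map_d, b.map_d],
    fun p q r h x y => by simp [a.map_bracket, b.map_bracket]⟩

/-- The component of degree `p`, as a functor to vector spaces. -/
def degreeFunctor (k : Type u) [Field k] (p : ℤ) : DGLA.{u, v} k ⥤ ModuleCat.{v} k where
  obj g := ModuleCat.of k (g.V p)
  map a := ModuleCat.ofHom (Hom.f a p)

/-! ### Tensor product with a commutative non-unital algebra -/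

section Tensor

instance {A : Type w} [CommRing A] [Algebra k A] (I : Ideal A) : IsScalarTower k I I :=
  ⟨fun c a b => Subtype.ext (smul_mul_assoc c (a : A) (b : A))⟩

instance {A : Type w} [CommRing A] [Algebra k A] (I : Ideal A) : SMulCommClass k I I :=
  ⟨fun c a b => Subtype.ext (mul_smul_comm c (a : A) (b : A)).symm⟩

variable (N : Type w) [NonUnitalCommRing N] [Module k N] [IsScalarTower k N N]
  [SMulCommClass k N N]

/-- The bracket of `g ⊗ N`, `[x ⊗ a, y ⊗ b] = [x, y] ⊗ (a b)`. -/
noncomputable def tensorBracket (g : DGLA.{u, v} k) (p q r : ℤ) (h : p + q = r) :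
    g.V p ⊗[k] N →ₗ[k] g.V q ⊗[k] N →ₗ[k] g.V r ⊗[k] N :=
  TensorProduct.map₂ (g.bracket p q r h) (LinearMap.mul k N)

@[simp]
lemma tensorBracket_tmul (g : DGLA.{u, v} k) (p q r : ℤ) (h : p + q = r) (x : g.V p) (a : N)
    (y : g.V q) (b : N) :
    tensorBracket N g p q r h (x ⊗ₜ[k] a) (y ⊗ₜ[k] b) = g.bracket p q r h x y ⊗ₜ[k] (a * b) :=
  rfl

/-- The differential graded Lie algebra `g ⊗ N`, with `d (x ⊗ a) = d x ⊗ a` and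
`[x ⊗ a, y ⊗ b] = [x, y] ⊗ (a b)`. -/
noncomputable def tensor (g : DGLA.{u, v} k) : DGLA.{u, max v w} k where
  V p := g.V p ⊗[k] N
  d p q h := (g.d p q h).rTensor N
  bracket p q r h := tensorBracket N g p q r h
  d_d p q r h h' x := by
    induction x using TensorProduct.induction_on with
    | zero => simp
    | tmul x a => simp [g.d_d]
    | add x y hx hy => rw [map_add, map_add, hx, hy, add_zero]
  skew p q r h h' x y := by
    induction x using TensorProduct.induction_on with
    | zero => simp
    | add x x' hx hx' =>
      rw [map_add, LinearMap.add_apply, map_add, hx, hx', smul_add, neg_add]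
    | tmul x a =>
      induction y using TensorProduct.induction_on with
      | zero => simp
      | add y y' hy hy' =>
        rw [map_add, map_add, LinearMap.add_apply, hy, hy', smul_add, neg_add]
      | tmul y b =>
        simp only [tensorBracket_tmul]
        rw [g.skew p q r h h', mul_comm a b, TensorProduct.neg_tmul]
        rfl
  leibniz p q r p' q' r' h hp hq hr h₁ h₂ x y := by
    induction x using TensorProduct.induction_on with
    | zero => simp
    | add x x' hx hx' =>
      simp only [map_add, LinearMap.add_apply, hx, hx', smul_add]
      abel
    | tmul x a =>
      induction y using TensorProduct.induction_on with
      | zero => simp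
      | add y y' hy hy' =>
        simp only [map_add, hy, hy', smul_add]
        abel
      | tmul y b =>
        simp only [tensorBracket_tmul, LinearMap.rTensor_tmul]
        rw [g.leibniz p q r p' q' r' h hp hq hr h₁ h₂, TensorProduct.add_tmul]
        rfl
  jacobi p q r pq qr pr s h₁ h₂ h₃ h₄ h₅ h₆ x y z := by
    induction x using TensorProduct.induction_on with
    | zero => simp
    | add x x' hx hx' =>
      simp only [map_add, LinearMap.add_apply, hx, hx', smul_add]
      abel
    | tmul x a =>
      induction y using TensorProduct.induction_on with
      | zero => simp
      | add y y' hy hy' =>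
        simp only [map_add, LinearMap.add_apply, hy, hy', smul_add]
        abel
      | tmul y b =>
        induction z using TensorProduct.induction_on with
        | zero => simp
        | add z z' hz hz' =>
          simp only [map_add, hz, hz', smul_add]
          abel
        | tmul z c =>
          simp only [tensorBracket_tmul]
          rw [g.jacobi p q r pq qr pr s h₁ h₂ h₃ h₄ h₅ h₆, TensorProduct.add_tmul,
            mul_assoc a b c, mul_left_comm b a c]
          rfl

lemma rTensor_d {g g' : DGLA.{u, v} k} (a : Hom g g') (p q : ℤ) (h : p + 1 = q)
    (x : g.V p ⊗[k] N) :
    (a.f q).rTensor N ((g.d p q h).rTensor N x) =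
      (g'.d p q h).rTensor N ((a.f p).rTensor N x) := by
  induction x using TensorProduct.induction_on with
  | zero => simp
  | tmul x b => simp [a.map_d]
  | add x y hx hy => simp only [map_add, hx, hy]

lemma rTensor_bracket {g g' : DGLA.{u, v} k} (a : Hom g g') (p q r : ℤ) (h : p + q = r)
    (x : g.V p ⊗[k] N) (y : g.V q ⊗[k] N) :
    (a.f r).rTensor N (tensorBracket N g p q r h x y) =
      tensorBracket N g' p q r h ((a.f p).rTensor N x) ((a.f q).rTensor N y) := by
  induction x using TensorProduct.induction_on with
  | zero => simp
  | add x x' hx hx' => simp only [map_add, LinearMap.add_apply, hx, hx']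
  | tmul x b =>
    induction y using TensorProduct.induction_on with
    | zero => simp
    | add y y' hy hy' => simp only [map_add, hy, hy']
    | tmul y c => simp [a.map_bracket]

/-- The functor `g ↦ g ⊗ N`. -/
noncomputable def tensorFunctor : DGLA.{u, v} k ⥤ DGLA.{u, max v w} k where
  obj g := g.tensor N
  map {g g'} a :=
    { f := fun p => (Hom.f a p).rTensor N
      map_d := rTensor_d N a
      map_bracket := rTensor_bracket N a }
  map_id g := by
    apply Hom.ext
    funext p
    exact LinearMap.rTensor_id _ _
  map_comp a b := by
    apply Hom.ext
    funext p
    exact LinearMap.rTensor_comp _ _ _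

end Tensor

end DGLA

/-! ## The Campbell--Dynkin--Hausdorff series -/

section BCH

/-- Indices of the summands in Dynkin's formula: nonempty lists `(r₁, s₁), …, (rₙ, sₙ)` with
`rᵢ + sᵢ > 0` for all `i`. -/
abbrev DynkinWord : Type := {l : List (ℕ × ℕ) // l ≠ [] ∧ (0, 0) ∉ l}

/-- `(-1)ⁿ⁻¹ / (n · ∑ (rᵢ + sᵢ) · ∏ rᵢ! sᵢ!)` -/
def DynkinWord.coeff (k : Type u) [Field k] (l : DynkinWord) : k :=
  (-1) ^ (l.1.length + 1) /
    ((l.1.length : k) * (((l.1.map fun p => p.1 + p.2).sum : ℕ) : k) *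
      (((l.1.map fun p => p.1.factorial * p.2.factorial).prod : ℕ) : k))

variable {M : Type v}

/-- The word `x^{r₁} y^{s₁} ⋯ x^{rₙ} y^{sₙ}` as a list of letters. -/
def DynkinWord.letters (x y : M) (l : DynkinWord) : List M :=
  l.1.flatMap fun p => List.replicate p.1 x ++ List.replicate p.2 y

/-- The iterated bracket `[v₁, [v₂, [⋯, [vₘ₋₁, vₘ]]]]`. -/
def nestedBracket [Zero M] (br : M → M → M) : List M → M
  | [] => 0
  | [x] => x
  | x :: y :: l => br x (nestedBracket br (y :: l))

/-- The Campbell--Dynkin--Hausdorff series `log (exp x exp y)` of the bracket `br`, by Dynkin's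
formula. For a nilpotent bracket only finitely many summands are nonzero. -/
noncomputable def bch (k : Type u) [Field k] [AddCommGroup M] [Module k M] (br : M → M → M)
    (x y : M) : M :=
  ∑ᶠ l : DynkinWord, l.coeff k • nestedBracket br (l.letters x y)

end BCH

/-! ## The Deligne two-groupoid of a (nilpotent) DGLA

An element `exp X` of the unipotent group of a nilpotent Lie algebra is represented by `X`; the
product is the Campbell--Dynkin--Hausdorff series. -/

namespace DGLA

variable {k : Type u} [Field k]

section Deligne

variable (g : DGLA.{u, v} k)

/-- The Maurer--Cartan equation `d λ + ½ [λ, λ] = 0`. -/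
def IsMaurerCartan (lam : g.V 1) : Prop :=
  g.d 1 2 rfl lam + (2 : k)⁻¹ • g.bracket 1 1 2 rfl lam lam = 0

/-- `ad X` for `X` of degree zero, acting on the component of degree `p`. -/
def ad {p : ℤ} (X : g.V 0) : g.V p →ₗ[k] g.V p := g.bracket 0 p p (zero_add p) X

/-- The adjoint action of the group element `exp X`:
`exp (ad X) v = ∑ₙ (ad X)ⁿ v / n!`. -/
noncomputable def expAd {p : ℤ} (X : g.V 0) (v : g.V p) : g.V p :=
  ∑ᶠ n : ℕ, (n.factorial : k)⁻¹ • ((g.ad X) ^ n) v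

/-- The element `μ` with `d + μ = exp (ad X) (d + λ)`, where `[X, d] = - d X`; explicitly,
`μ = exp (ad X) λ - ∑ₙ (ad X)ⁿ (d X) / (n + 1)!`. -/
noncomputable def gaugeAct (X : g.V 0) (lam : g.V 1) : g.V 1 :=
  g.expAd X lam - ∑ᶠ n : ℕ, ((n + 1).factorial : k)⁻¹ • ((g.ad X) ^ n) (g.d 0 1 rfl X)

/-- `exp X` is a gauge transformation from `λ` to `μ`. -/
def IsGauge (X : g.V 0) (lam mu : g.V 1) : Prop := g.gaugeAct X lam = mu

/-- The product of gauge transformations: `exp (g.mul X Y) = exp X · exp Y`. -/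
noncomputable def mul (X Y : g.V 0) : g.V 0 := bch k (fun a b => g.bracket 0 0 0 rfl a b) X Y

/-- The twisted differential `t ↦ d t + [μ, t]` from degree `-1` to degree `0`. -/
def twistedD (mu : g.V 1) (t : g.V (-1)) : g.V 0 :=
  g.d (-1) 0 rfl t + g.bracket 1 (-1) 0 rfl mu t

/-- The bracket `[a, b]_μ = [a, d b + [μ, b]]` in degree `-1`. -/
def twistedBracket (mu : g.V 1) (a b : g.V (-1)) : g.V (-1) :=
  g.bracket (-1) 0 (-1) rfl a (g.twistedD mu b)

/-- The product in the group of the Lie algebra of degree `-1` with the bracket `[a, b]_μ`; it is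
the vertical composition of two-morphisms between gauge transformations with target `μ`. -/
noncomputable def mulAt (mu : g.V 1) (a b : g.V (-1)) : g.V (-1) :=
  bch k (g.twistedBracket mu) a b

/-- `exp t` is a two-morphism from `exp Y` to `exp X`, gauge transformations with target `μ`:
`exp X = exp (d t + [μ, t]) · exp Y`. -/
def IsTwoMorphism (mu : g.V 1) (t : g.V (-1)) (Y X : g.V 0) : Prop :=
  X = g.mul (g.twistedD mu t) Y

end Deligne

/-! ### Nilpotence, and compatibility of the exponential series with morphisms -/

/-- Nilpotence of a differential graded Lie algebra: it has a finite multiplicative filtration,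
equal to the whole algebra in index one. -/
class IsNilp (g : DGLA.{u, v} k) : Prop where
  exists_filtration : ∃ (F : ℕ → ∀ p, Submodule k (g.V p)) (N : ℕ),
    (∀ p, F 1 p = ⊤) ∧ (∀ p, F N p = ⊥) ∧ (∀ i j p, i ≤ j → F j p ≤ F i p) ∧
    (∀ j p q h x, x ∈ F j p → g.d p q h x ∈ F j q) ∧
    (∀ i j p q r h x y, x ∈ F i p → y ∈ F j q → g.bracket p q r h x y ∈ F (i + j) r)

end DGLA

section BCHFinite

variable {k : Type u} [Field k] {M : Type v} {M' : Type w}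

lemma nestedBracket_map [Zero M] [Zero M'] (br : M → M → M) (br' : M' → M' → M') (h : M → M')
    (h0 : h 0 = 0) (hbr : ∀ a b, h (br a b) = br' (h a) (h b)) :
    ∀ l : List M, h (nestedBracket br l) = nestedBracket br' (l.map h)
  | [] => h0
  | [x] => rfl
  | x :: y :: l => by
    have := nestedBracket_map br br' h h0 hbr (y :: l)
    simp only [List.map_cons] at this ⊢
    simp only [nestedBracket, hbr, this]

lemma DynkinWord.letters_map (h : M → M') (x y : M) (l : DynkinWord) :
    (l.letters x y).map h = l.letters (h x) (h y) := by
  simp [DynkinWord.letters, List.map_flatMap]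

lemma DynkinWord.length_letters (x y : M) (l : DynkinWord) :
    (l.letters x y).length = (l.1.map fun p => p.1 + p.2).sum := by
  simp [DynkinWord.letters, List.length_flatMap]

variable [AddCommGroup M] [Module k M]

lemma nestedBracket_mem (br : M → M → M) (F : ℕ → Submodule k M) (h1 : F 1 = ⊤)
    (hbr : ∀ i j x y, x ∈ F i → y ∈ F j → br x y ∈ F (i + j)) :
    ∀ l : List M, l ≠ [] → nestedBracket br l ∈ F l.length
  | [], h => absurd rfl h
  | [x], _ => by simp [h1]
  | x :: y :: l, _ => by
    have h := nestedBracket_mem br F h1 hbr (y :: l) (by simp)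
    have := hbr 1 _ x _ (by simp [h1]) h
    simpa [nestedBracket, add_comm, add_left_comm] using this

lemma finite_dynkinWord (N : ℕ) :
    {l : DynkinWord | (l.1.map fun p => p.1 + p.2).sum < N}.Finite := by
  have hfin : Set.Finite ((List.map fun q : Fin N × Fin N => ((q.1 : ℕ), (q.2 : ℕ))) ''
      {l : List (Fin N × Fin N) | l.length ≤ N}) :=
    (List.finite_length_le (Fin N × Fin N) N).image _
  refine Set.Finite.of_finite_image (f := Subtype.val) (hfin.subset ?_)
    Subtype.val_injective.injOn
  rintro _ ⟨⟨l, hl, h0⟩, hs, rfl⟩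
  simp only [Set.mem_ofPred_eq] at hs
  have hle : ∀ p ∈ l, p.1 + p.2 < N := fun p hp =>
    lt_of_le_of_lt (List.single_le_sum (by simp) _ (List.mem_map_of_mem (f := fun p : ℕ × ℕ =>
      p.1 + p.2) hp)) hs
  have hlen : l.length ≤ N := by
    have h := List.length_le_sum_of_one_le (l.map fun p => p.1 + p.2) (by
      intro i hi
      obtain ⟨⟨a, b⟩, hp, rfl⟩ := List.mem_map.1 hi
      rcases Nat.eq_zero_or_pos (a + b) with h | h
      · have ha : a = 0 := by omega
        have hb : b = 0 := by omega
        subst ha hb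
        exact absurd hp h0
      · exact h)
    rw [List.length_map] at h
    omega
  refine ⟨l.pmap (fun p hp => (⟨p.1, by omega⟩, ⟨p.2, by omega⟩)) hle, by simpa using hlen, ?_⟩
  rw [List.map_pmap]
  simp

lemma bch_hasFiniteSupport (br : M → M → M) (F : ℕ → Submodule k M) (N : ℕ) (h1 : F 1 = ⊤)
    (hN : F N = ⊥) (hF : ∀ i j, i ≤ j → F j ≤ F i)
    (hbr : ∀ i j x y, x ∈ F i → y ∈ F j → br x y ∈ F (i + j)) (x y : M) :
    (Function.support
      fun l : DynkinWord => l.coeff k • nestedBracket br (l.letters x y)).Finite := by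
  refine (finite_dynkinWord N).subset fun l hl => ?_
  by_contra hlt
  simp only [Set.mem_ofPred_eq, not_lt] at hlt
  apply hl
  by_cases hnil : l.letters x y = []
  · simp [hnil, nestedBracket]
  have h := nestedBracket_mem br F h1 hbr _ hnil
  rw [DynkinWord.length_letters] at h
  have h' := hF _ _ hlt h
  rw [hN, Submodule.mem_bot] at h'
  simp [h']

lemma map_bch [AddCommGroup M'] [Module k M'] (br : M → M → M) (br' : M' → M' → M')
    (h : M →ₗ[k] M') (hbr : ∀ a b, h (br a b) = br' (h a) (h b)) (x y : M)
    (hfin : (Function.support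
      fun l : DynkinWord => l.coeff k • nestedBracket br (l.letters x y)).Finite) :
    h (bch k br x y) = bch k br' (h x) (h y) := by
  unfold bch
  rw [← LinearMap.toAddMonoidHom_coe, AddMonoidHom.map_finsum _ hfin]
  refine finsum_congr fun l => ?_
  rw [LinearMap.toAddMonoidHom_coe, map_smul,
    nestedBracket_map br br' h (map_zero h) hbr, DynkinWord.letters_map]

end BCHFinite

namespace DGLA

variable {k : Type u} [Field k] {g g' : DGLA.{u, v} k}

lemma map_ad_pow (a : g ⟶ g') {p : ℤ} (X : g.V 0) (x : g.V p) (n : ℕ) :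
    a.f p ((g.ad X ^ n) x) = (g'.ad (a.f 0 X) ^ n) (a.f p x) := by
  induction n with
  | zero => simp
  | succ n ih =>
    rw [pow_succ', pow_succ', Module.End.mul_apply, Module.End.mul_apply, ← ih]
    exact a.map_bracket 0 p p (zero_add p) X _

lemma finite_support_ad_pow [hg : g.IsNilp] {p : ℤ} (X : g.V 0) (x : g.V p) (c : ℕ → k) :
    (Function.support fun n : ℕ => c n • (g.ad X ^ n) x).Finite := by
  obtain ⟨F, N, h1, hN, hF, -, hbr⟩ := hg.exists_filtration
  have key : ∀ n, (g.ad X ^ n) x ∈ F (1 + n) p := by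
    intro n
    induction n with
    | zero => simp [h1]
    | succ n ih =>
      rw [pow_succ', Module.End.mul_apply]
      have := hbr 1 _ 0 p p (zero_add p) X _ (by simp [h1]) ih
      rwa [add_comm n 1]
  refine (Set.finite_lt_nat N).subset fun n hn => ?_
  by_contra hlt
  apply hn
  simp only [Set.mem_ofPred_eq, not_lt] at hlt
  have h := hF N (1 + n) p (by omega) (key n)
  rw [hN, Submodule.mem_bot] at h
  simp [h]

lemma map_expAd [g.IsNilp] (a : g ⟶ g') {p : ℤ} (X : g.V 0) (x : g.V p) :
    a.f p (g.expAd X x) = g'.expAd (a.f 0 X) (a.f p x) := by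
  unfold expAd
  rw [← LinearMap.toAddMonoidHom_coe, AddMonoidHom.map_finsum _ (finite_support_ad_pow X x _)]
  refine finsum_congr fun n => ?_
  rw [LinearMap.toAddMonoidHom_coe, map_smul, map_ad_pow]

lemma map_gaugeAct [g.IsNilp] (a : g ⟶ g') (X : g.V 0) (lam : g.V 1) :
    a.f 1 (g.gaugeAct X lam) = g'.gaugeAct (a.f 0 X) (a.f 1 lam) := by
  unfold gaugeAct
  rw [map_sub, map_expAd, ← a.map_d]
  congr 1
  rw [← LinearMap.toAddMonoidHom_coe, AddMonoidHom.map_finsum _ (finite_support_ad_pow X _ _)]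
  refine finsum_congr fun n => ?_
  rw [LinearMap.toAddMonoidHom_coe, map_smul, map_ad_pow]

lemma map_mul [hg : g.IsNilp] (a : g ⟶ g') (X Y : g.V 0) :
    a.f 0 (g.mul X Y) = g'.mul (a.f 0 X) (a.f 0 Y) := by
  obtain ⟨F, N, h1, hN, hF, -, hbr⟩ := hg.exists_filtration
  refine map_bch _ _ _ (a.map_bracket 0 0 0 rfl) X Y ?_
  exact bch_hasFiniteSupport _ (fun j => F j 0) N (h1 0) (hN 0) (fun i j => hF i j 0)
    (fun i j x y => hbr i j 0 0 0 rfl x y) X Y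

lemma map_twistedD (a : g ⟶ g') (mu : g.V 1) (t : g.V (-1)) :
    a.f 0 (g.twistedD mu t) = g'.twistedD (a.f 1 mu) (a.f (-1) t) := by
  unfold twistedD
  rw [map_add, a.map_d, a.map_bracket]

lemma map_mulAt [hg : g.IsNilp] (a : g ⟶ g') (mu : g.V 1) (s t : g.V (-1)) :
    a.f (-1) (g.mulAt mu s t) = g'.mulAt (a.f 1 mu) (a.f (-1) s) (a.f (-1) t) := by
  obtain ⟨F, N, h1, hN, hF, hd, hbr⟩ := hg.exists_filtration
  refine map_bch _ _ _ (fun x y => ?_) s t ?_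
  · unfold twistedBracket
    rw [a.map_bracket, map_twistedD]
  · refine bch_hasFiniteSupport _ (fun j => F j (-1)) N (h1 _) (hN _) (fun i j => hF i j _)
      (fun i j x y hx hy => ?_) s t
    refine hbr i j _ _ _ _ _ _ hx (Submodule.add_mem _ (hd _ _ _ _ _ hy) ?_)
    exact hF _ _ _ (by omega) (hbr 1 j 1 (-1) 0 rfl mu y (by simp [h1]) hy)

lemma IsMaurerCartan.map (a : g ⟶ g') {lam : g.V 1} (h : g.IsMaurerCartan lam) :
    g'.IsMaurerCartan (a.f 1 lam) := by
  have := congrArg (a.f 2) h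
  rwa [map_add, map_smul, a.map_d, a.map_bracket, map_zero] at this

/-- The filtration of `g ⊗ I` by powers of the ideal `I`. -/
noncomputable def powFiltration {A : Type w} [CommRing A] [Algebra k A] (I : Ideal A)
    (g : DGLA.{u, v} k) (j : ℕ) (p : ℤ) : Submodule k (g.V p ⊗[k] I) :=
  Submodule.span k {z | ∃ (x : g.V p) (a : I), (a : A) ∈ I ^ j ∧ x ⊗ₜ[k] a = z}

section PowFiltration

variable {A : Type w} [CommRing A] [Algebra k A] (I : Ideal A) (g : DGLA.{u, v} k)

lemma powFiltration_one (p : ℤ) : powFiltration I g 1 p = ⊤ := by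
  rw [eq_top_iff, ← TensorProduct.span_tmul_eq_top]
  apply Submodule.span_mono
  rintro _ ⟨x, a, rfl⟩
  exact ⟨x, a, by simp, rfl⟩

lemma powFiltration_eq_bot {N : ℕ} (hN : I ^ N = 0) (p : ℤ) : powFiltration I g N p = ⊥ := by
  unfold powFiltration
  rw [Submodule.span_eq_bot]
  rintro _ ⟨x, a, ha, rfl⟩
  rw [hN] at ha
  have : a = 0 := Subtype.ext ha
  rw [this, TensorProduct.tmul_zero]

lemma powFiltration_anti (i j : ℕ) (p : ℤ) (hij : i ≤ j) :
    powFiltration I g j p ≤ powFiltration I g i p := by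
  apply Submodule.span_mono
  rintro _ ⟨x, a, ha, rfl⟩
  exact ⟨x, a, Ideal.pow_le_pow_right hij ha, rfl⟩

lemma powFiltration_d (j : ℕ) (p q : ℤ) (h : p + 1 = q) (x : g.V p ⊗[k] I)
    (hx : x ∈ powFiltration I g j p) :
    (g.d p q h).rTensor I x ∈ powFiltration I g j q := by
  have hle : powFiltration I g j p ≤
      (powFiltration I g j q).comap ((g.d p q h).rTensor I) := by
    refine Submodule.span_le.2 ?_
    rintro _ ⟨x, a, ha, rfl⟩
    exact Submodule.subset_span ⟨g.d p q h x, a, ha, rfl⟩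
  exact hle hx

lemma powFiltration_bracket (i j : ℕ) (p q r : ℤ) (h : p + q = r) (x : g.V p ⊗[k] I)
    (y : g.V q ⊗[k] I) (hx : x ∈ powFiltration I g i p) (hy : y ∈ powFiltration I g j q) :
    tensorBracket I g p q r h x y ∈ powFiltration I g (i + j) r := by
  have hle : Submodule.map₂ (tensorBracket I g p q r h) (powFiltration I g i p)
      (powFiltration I g j q) ≤ powFiltration I g (i + j) r := by
    unfold powFiltration
    rw [Submodule.map₂_span_span, Submodule.span_le]
    rintro _ ⟨_, ⟨x, a, ha, rfl⟩, _, ⟨y, b, hb, rfl⟩, rfl⟩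
    refine Submodule.subset_span ⟨g.bracket p q r h x y, a * b, ?_, rfl⟩
    rw [pow_add]
    exact Ideal.mul_mem_mul ha hb
  exact Submodule.map₂_le.1 hle x hx y hy

/-- `g ⊗ I` is nilpotent if `I` is a nilpotent ideal of a commutative algebra. -/
lemma isNilp_tensor (hI : IsNilpotent I) : (g.tensor I).IsNilp := by
  obtain ⟨N, hN⟩ := hI
  exact ⟨powFiltration I g, N, powFiltration_one I g, powFiltration_eq_bot I g hN,
    powFiltration_anti I g, powFiltration_d I g, powFiltration_bracket I g⟩

end PowFiltration

end DGLA

/-! ## Cosimplicial DGLAs -/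

/-- Cosimplicial differential graded Lie algebras: functors from the simplex category. -/
abbrev CosimplicialDGLA (k : Type u) [Field k] := SimplexCategory ⥤ DGLA.{u, v} k

namespace CosimplicialDGLA

variable {k : Type u} [Field k]

/-- The component `g^{n,p}` of cosimplicial degree `n` and internal degree `p`. -/
abbrev Comp (g : CosimplicialDGLA.{u, v} k) (n : ℕ) (p : ℤ) : Type v := (g.obj (.mk n)).V p

/-- A morphism, on the component of bidegree `(n, p)`. -/
def app {g g' : CosimplicialDGLA.{u, v} k} (f : g ⟶ g') (n : ℕ) (p : ℤ) :
    g.Comp n p →ₗ[k] g'.Comp n p :=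
  DGLA.Hom.f (NatTrans.app f (.mk n)) p

section Faces

variable (g : CosimplicialDGLA.{u, v} k) {p : ℤ} (n : ℕ)

/-- `x_i`, the image of `x` in cosimplicial degree `n` under `0 ↦ i`. -/
def at₁ (i : Fin (n + 1)) (x : g.Comp 0 p) : g.Comp n p :=
  DGLA.Hom.f (g.map (SimplexCategory.const (.mk 0) (.mk n) i)) p x

/-- `x_{ij}`, the image of `x` in cosimplicial degree `n` under `0 ↦ i`, `1 ↦ j`. -/
def at₂ (i j : Fin (n + 1)) (x : g.Comp 1 p) (h : i ≤ j := by decide) : g.Comp n p :=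
  DGLA.Hom.f (g.map (SimplexCategory.mkOfLe i j h)) p x

/-- `x_{ijl}`, the image of `x` in cosimplicial degree `n` under `0 ↦ i`, `1 ↦ j`, `2 ↦ l`. -/
def at₃ (i j l : Fin (n + 1)) (x : g.Comp 2 p) (h : i ≤ j := by decide)
    (h' : j ≤ l := by decide) : g.Comp n p :=
  DGLA.Hom.f (g.map (SimplexCategory.mkOfLeComp i j l h h')) p x

end Faces

section FacesMap

variable {g g' : CosimplicialDGLA.{u, v} k} (f : g ⟶ g') {p : ℤ} (n : ℕ)

lemma app_map {m : ℕ} (φ : SimplexCategory.mk m ⟶ SimplexCategory.mk n) (x : g.Comp m p) :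
    app f n p (DGLA.Hom.f (g.map φ) p x) = DGLA.Hom.f (g'.map φ) p (app f m p x) :=
  congrArg (fun a : g.obj (.mk m) ⟶ g'.obj (.mk n) => DGLA.Hom.f a p x) (f.naturality φ)

lemma app_at₁ (i : Fin (n + 1)) (x : g.Comp 0 p) :
    app f n p (g.at₁ n i x) = g'.at₁ n i (app f 0 p x) := app_map f n _ x

lemma app_at₂ (i j : Fin (n + 1)) (h : i ≤ j) (x : g.Comp 1 p) :
    app f n p (g.at₂ n i j x h) = g'.at₂ n i j (app f 1 p x) h := app_map f n _ x

lemma app_at₃ (i j l : Fin (n + 1)) (h : i ≤ j) (h' : j ≤ l) (x : g.Comp 2 p) :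
    app f n p (g.at₃ n i j l x h h') = g'.at₃ n i j l (app f 2 p x) h h' := app_map f n _ x

end FacesMap

/-! ### The total complex -/

section Total

variable (g : CosimplicialDGLA.{u, v} k)

/-- The standard differential `∂ = ∑ᵢ (-1)ⁱ dᵢ : g^{n,p} → g^{n+1,p}`. -/
def coboundary (n : ℕ) (p : ℤ) : g.Comp n p →ₗ[k] g.Comp (n + 1) p :=
  ∑ i : Fin (n + 2), ((-1 : ℤ) ^ (i : ℕ)) • DGLA.Hom.f (g.map (SimplexCategory.δ i)) p

/-- Families of elements of all the `g^{n,p}`. -/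
abbrev Family : Type v := ∀ (n : ℕ) (p : ℤ), g.Comp n p

/-- The total differential `d + ∂`, with the sign `(-1)ⁿ` in front of `d` on `g^{n,p}`. -/
def totalD : g.Family →ₗ[k] g.Family where
  toFun x n p := ((n : ℤ).negOnePow • (g.obj (.mk n)).d (p - 1) p (by omega) (x n (p - 1))) +
    match n with
    | 0 => 0
    | m + 1 => g.coboundary m p (x m p)
  map_add' x y := by
    funext n p
    rcases n with _ | n
    · simp
    · simp only [Pi.add_apply, map_add, smul_add]
      abel
  map_smul' c x := by
    funext n p
    rcases n with _ | n
    · simp [smul_comm c]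
    · simp [smul_comm c]

/-- The component of degree `m` of the total complex: families supported on `n + p = m`. (If
`g^{n,p} = 0` for `p < -1` there are only finitely many such `(n, p)` with `g^{n,p} ≠ 0`.) -/
def totalX (m : ℤ) : Submodule k g.Family where
  carrier := {x | ∀ (n : ℕ) (p : ℤ), (n : ℤ) + p ≠ m → x n p = 0}
  add_mem' {x y} hx hy n p h := by
    rw [Pi.add_apply, Pi.add_apply]
    rw [hx n p h, hy n p h, add_zero]
  zero_mem' _ _ _ := rfl
  smul_mem' c x hx n p h := by
    rw [Pi.smul_apply, Pi.smul_apply, hx n p h, smul_zero]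

lemma coboundary_coboundary (n : ℕ) (p : ℤ) (x : g.Comp n p) :
    g.coboundary (n + 1) p (g.coboundary n p x) = 0 := by
  have h := AlgebraicTopology.AlternatingCofaceMapComplex.d_squared
    (g ⋙ DGLA.degreeFunctor k p) n
  have key : ∀ m, (AlgebraicTopology.AlternatingCofaceMapComplex.objD
      (g ⋙ DGLA.degreeFunctor k p) m) =
        ModuleCat.ofHom (g.coboundary m p) := by
    intro m
    apply ModuleCat.hom_ext
    unfold AlgebraicTopology.AlternatingCofaceMapComplex.objD coboundary
    rw [ModuleCat.hom_sum]
    rfl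
  rw [key, key] at h
  exact congrArg (fun a => a.hom x) h

lemma coboundary_d (n : ℕ) (p q : ℤ) (h : p + 1 = q) (x : g.Comp n p) :
    g.coboundary n q ((g.obj (.mk n)).d p q h x) =
      (g.obj (.mk (n + 1))).d p q h (g.coboundary n p x) := by
  simp only [coboundary, LinearMap.sum_apply, map_sum, LinearMap.smul_apply, map_zsmul]
  refine Finset.sum_congr rfl fun i _ => ?_
  congr 1
  exact DGLA.Hom.map_d _ p q h x

lemma totalD_totalD (x : g.Family) : g.totalD (g.totalD x) = 0 := by
  funext n p
  rcases n with _ | _ | n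
  · simp [totalD, Units.smul_def, DGLA.d_d]
  · simp [totalD, Units.smul_def, DGLA.d_d, coboundary_d]
  · simp only [totalD, LinearMap.coe_mk, AddHom.coe_mk, map_add, Units.smul_def, map_zsmul,
      DGLA.d_d, coboundary_d, coboundary_coboundary, Pi.zero_apply, smul_zero, zero_add, add_zero]
    rw [← add_smul]
    simp [Int.negOnePow_succ]

lemma totalD_mem {m m' : ℤ} (h : m + 1 = m') (x : g.Family) (hx : x ∈ g.totalX m) :
    g.totalD x ∈ g.totalX m' := by
  intro n p hnp
  rcases n with _ | n
  · simp only [totalD, LinearMap.coe_mk, AddHom.coe_mk]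
    rw [hx 0 (p - 1) (by omega)]
    simp
  · simp only [totalD, LinearMap.coe_mk, AddHom.coe_mk]
    rw [hx (n + 1) (p - 1) (by omega), hx n p (by push_cast at hnp; omega)]
    simp

/-- The total complex of the double complex `g^{n,p}`, with the differential `d + ∂`. -/
def total : CochainComplex (ModuleCat.{v} k) ℤ where
  X m := ModuleCat.of k (g.totalX m)
  d m m' := if h : m + 1 = m' then
    ModuleCat.ofHom (g.totalD.restrict (g.totalD_mem h)) else 0
  shape m m' h := dif_neg h
  d_comp_d' m m' m'' h h' := by
    change m + 1 = m' at h
    change m' + 1 = m'' at h'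
    rw [dif_pos h, dif_pos h']
    apply ModuleCat.hom_ext
    ext x : 1
    exact Subtype.ext (g.totalD_totalD x.1)

/-- The map on families induced by a morphism of cosimplicial DGLAs. -/
def familyMap {g g' : CosimplicialDGLA.{u, v} k} (f : g ⟶ g') : g.Family →ₗ[k] g'.Family where
  toFun x n p := app f n p (x n p)
  map_add' x y := by
    funext n p
    simp
  map_smul' c x := by
    funext n p
    simp

lemma familyMap_totalD {g g' : CosimplicialDGLA.{u, v} k} (f : g ⟶ g') (x : g.Family) :
    familyMap f (g.totalD x) = g'.totalD (familyMap f x) := by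
  funext n p
  have hd : ∀ n (y : g.Comp n (p - 1)),
      app f n p ((g.obj (.mk n)).d (p - 1) p (by omega) y) =
        (g'.obj (.mk n)).d (p - 1) p (by omega) (app f n (p - 1) y) :=
    fun n y => DGLA.Hom.map_d _ _ _ _ _
  have hc : ∀ n (y : g.Comp n p), app f (n + 1) p (g.coboundary n p y) =
      g'.coboundary n p (app f n p y) := by
    intro n y
    simp only [coboundary, LinearMap.sum_apply, map_sum, LinearMap.smul_apply, map_zsmul]
    exact Finset.sum_congr rfl fun i _ => congrArg _ (app_map f _ _ y)
  rcases n with _ | n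
  · simp [familyMap, totalD, Units.smul_def, hd]
  · simp [familyMap, totalD, Units.smul_def, hd, hc]

lemma familyMap_mem {g g' : CosimplicialDGLA.{u, v} k} (f : g ⟶ g') (m : ℤ) (x : g.Family)
    (hx : x ∈ g.totalX m) : familyMap f x ∈ g'.totalX m := fun n p h => by
  simp [familyMap, hx n p h]

/-- The morphism of total complexes induced by a morphism of cosimplicial DGLAs. -/
def totalMap {g g' : CosimplicialDGLA.{u, v} k} (f : g ⟶ g') : g.total ⟶ g'.total where
  f m := ModuleCat.ofHom ((familyMap f).restrict (familyMap_mem f m))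
  comm' m m' h := by
    change m + 1 = m' at h
    simp only [total, dif_pos h]
    apply ModuleCat.hom_ext
    ext x : 1
    exact Subtype.ext (familyMap_totalD f x.1).symm

end Total

/-! ### Descent data for the Deligne two-groupoid -/

/-- Descent data for the Deligne two-groupoid of a (nilpotent) cosimplicial DGLA. Gauge
transformations `exp G` and two-morphisms `exp c` are represented by `G` and `c`. -/
structure DescentDatum (g : CosimplicialDGLA.{u, v} k) where
  lam : g.Comp 0 1
  G : g.Comp 1 0
  c : g.Comp 2 (-1)
  /-- `λ` is a Maurer--Cartan element -/
  maurerCartan : (g.obj (.mk 0)).IsMaurerCartan lam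
  /-- `G` is a gauge transformation `λ₁ → λ₀` -/
  gauge : (g.obj (.mk 1)).IsGauge G (g.at₁ 1 1 lam) (g.at₁ 1 0 lam)
  /-- `c` is a two-morphism `G₀₁ G₁₂ → G₀₂` -/
  twoMorphism : (g.obj (.mk 2)).IsTwoMorphism (g.at₁ 2 0 lam) c
    ((g.obj (.mk 2)).mul (g.at₂ 2 0 1 G) (g.at₂ 2 1 2 G)) (g.at₂ 2 0 2 G)
  /-- `c₀₂₃ c₀₁₂ = c₀₁₃ G₀₁(c₁₂₃)`, the two two-morphisms `G₀₁ G₁₂ G₂₃ → G₀₃` being equal -/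
  cocycle : (g.obj (.mk 3)).mulAt (g.at₁ 3 0 lam) (g.at₃ 3 0 2 3 c) (g.at₃ 3 0 1 2 c) =
    (g.obj (.mk 3)).mulAt (g.at₁ 3 0 lam) (g.at₃ 3 0 1 3 c)
      ((g.obj (.mk 3)).expAd (g.at₂ 3 0 1 G) (g.at₃ 3 1 2 3 c))

namespace DescentDatum

/-- Isomorphisms `(H, b)` from the descent datum `A = (λ', G', c')` to `A' = (λ'', G'', c'')`. -/
structure Iso {g : CosimplicialDGLA.{u, v} k} (A A' : DescentDatum g) where
  H : g.Comp 0 0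
  b : g.Comp 1 (-1)
  /-- `H` is a gauge transformation `λ' → λ''` -/
  gauge : (g.obj (.mk 0)).IsGauge H A.lam A'.lam
  /-- `b` is a two-morphism `H₀ G'₀₁ → G''₀₁ H₁` -/
  twoMorphism : (g.obj (.mk 1)).IsTwoMorphism (g.at₁ 1 0 A'.lam) b
    ((g.obj (.mk 1)).mul (g.at₁ 1 0 H) A.G) ((g.obj (.mk 1)).mul A'.G (g.at₁ 1 1 H))
  /-- `G''₀₁(b₁₂) b₀₁ = c''⁻¹ b₀₂ H₀(c')`, the two two-morphisms
  `H₀ G'₀₁ G'₁₂ → G''₀₁ G''₁₂ H₂` being equal -/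
  compat : (g.obj (.mk 2)).mulAt (g.at₁ 2 0 A'.lam)
      ((g.obj (.mk 2)).expAd (g.at₂ 2 0 1 A'.G) (g.at₂ 2 1 2 b)) (g.at₂ 2 0 1 b) =
    (g.obj (.mk 2)).mulAt (g.at₁ 2 0 A'.lam)
      ((g.obj (.mk 2)).mulAt (g.at₁ 2 0 A'.lam) (-A'.c) (g.at₂ 2 0 2 b))
      ((g.obj (.mk 2)).expAd (g.at₁ 2 0 H) A.c)

/-- Two-isomorphisms from the isomorphism `φ = (H', b')` to `ψ = (H'', b'')`. -/
@[ext]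
structure TwoIso {g : CosimplicialDGLA.{u, v} k} {A A' : DescentDatum g} (φ ψ : Iso A A') where
  a : g.Comp 0 (-1)
  /-- `a` is a two-morphism `H' → H''` -/
  twoMorphism : (g.obj (.mk 0)).IsTwoMorphism A'.lam a φ.H ψ.H
  /-- `b''₀₁ a₀ = G''₀₁(a₁) b'₀₁` as two-morphisms `H'₀ G'₀₁ → G''₀₁ H''₁` -/
  compat : (g.obj (.mk 1)).mulAt (g.at₁ 1 0 A'.lam) ψ.b (g.at₁ 1 0 a) =
    (g.obj (.mk 1)).mulAt (g.at₁ 1 0 A'.lam)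
      ((g.obj (.mk 1)).expAd A'.G (g.at₁ 1 1 a)) φ.b

/-- Two descent data are isomorphic. -/
def Isomorphic {g : CosimplicialDGLA.{u, v} k} (A A' : DescentDatum g) : Prop :=
  Nonempty (Iso A A')

/-- Two isomorphisms of descent data are two-isomorphic. -/
def TwoIsomorphic {g : CosimplicialDGLA.{u, v} k} {A A' : DescentDatum g} (φ ψ : Iso A A') :
    Prop :=
  Nonempty (TwoIso φ ψ)

/-- The set of isomorphism classes of descent data. -/
def IsoClasses (g : CosimplicialDGLA.{u, v} k) : Type v :=
  Quot (Isomorphic (g := g))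

/-- The quotient `Iso(A, A') / 2-Iso`. -/
def IsoModTwoIso {g : CosimplicialDGLA.{u, v} k} (A A' : DescentDatum g) : Type v :=
  Quot (TwoIsomorphic (A := A) (A' := A'))

section Map

variable {g g' : CosimplicialDGLA.{u, v} k} [hg : ∀ n : ℕ, (g.obj (.mk n)).IsNilp]

lemma app_expAd (f : g ⟶ g') (n : ℕ) {p : ℤ} (X : g.Comp n 0) (x : g.Comp n p) :
    app f n p ((g.obj (.mk n)).expAd X x) =
      (g'.obj (.mk n)).expAd (app f n 0 X) (app f n p x) :=
  DGLA.map_expAd (NatTrans.app f (.mk n)) X x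

lemma app_mul (f : g ⟶ g') (n : ℕ) (X Y : g.Comp n 0) :
    app f n 0 ((g.obj (.mk n)).mul X Y) = (g'.obj (.mk n)).mul (app f n 0 X) (app f n 0 Y) :=
  DGLA.map_mul (NatTrans.app f (.mk n)) X Y

lemma app_mulAt (f : g ⟶ g') (n : ℕ) (mu : g.Comp n 1) (s t : g.Comp n (-1)) :
    app f n (-1) ((g.obj (.mk n)).mulAt mu s t) =
      (g'.obj (.mk n)).mulAt (app f n 1 mu) (app f n (-1) s) (app f n (-1) t) :=
  DGLA.map_mulAt (NatTrans.app f (.mk n)) mu s t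

lemma app_isGauge (f : g ⟶ g') (n : ℕ) {X : g.Comp n 0} {lam mu : g.Comp n 1}
    (h : (g.obj (.mk n)).IsGauge X lam mu) :
    (g'.obj (.mk n)).IsGauge (app f n 0 X) (app f n 1 lam) (app f n 1 mu) :=
  (DGLA.map_gaugeAct (NatTrans.app f (.mk n)) X lam).symm.trans (congrArg (app f n 1) h)

lemma app_isTwoMorphism (f : g ⟶ g') (n : ℕ) {mu : g.Comp n 1} {t : g.Comp n (-1)}
    {Y X : g.Comp n 0} (h : (g.obj (.mk n)).IsTwoMorphism mu t Y X) :
    (g'.obj (.mk n)).IsTwoMorphism (app f n 1 mu) (app f n (-1) t) (app f n 0 Y) (app f n 0 X) := by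
  refine (congrArg (app f n 0) h).trans ?_
  rw [app_mul]
  exact congrArg (fun z => (g'.obj (.mk n)).mul z _) (DGLA.map_twistedD (NatTrans.app f (.mk n)) mu t)

/-- The image of a descent datum under a morphism of cosimplicial DGLAs. -/
def map (f : g ⟶ g') (A : DescentDatum g) : DescentDatum g' where
  lam := app f 0 1 A.lam
  G := app f 1 0 A.G
  c := app f 2 (-1) A.c
  maurerCartan := A.maurerCartan.map (NatTrans.app f (.mk 0))
  gauge := by
    have h := app_isGauge f 1 A.gauge
    simp only [app_at₁] at h
    exact h
  twoMorphism := by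
    have h := app_isTwoMorphism f 2 A.twoMorphism
    simp only [app_at₁, app_at₂, app_mul] at h
    exact h
  cocycle := by
    have h := congrArg (app f 3 (-1)) A.cocycle
    simp only [app_at₁, app_at₂, app_at₃, app_mulAt, app_expAd] at h
    exact h

/-- The image of an isomorphism of descent data. -/
def Iso.map (f : g ⟶ g') {A A' : DescentDatum g} (φ : Iso A A') :
    Iso (A.map f) (A'.map f) where
  H := app f 0 0 φ.H
  b := app f 1 (-1) φ.b
  gauge := app_isGauge f 0 φ.gauge
  twoMorphism := by
    have h := app_isTwoMorphism f 1 φ.twoMorphism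
    simp only [app_at₁, app_at₂, app_mul] at h
    exact h
  compat := by
    have h := congrArg (app f 2 (-1)) φ.compat
    simp only [app_at₁, app_at₂, app_at₃, app_mulAt, app_expAd, map_neg] at h
    exact h

/-- The image of a two-isomorphism. -/
def TwoIso.map (f : g ⟶ g') {A A' : DescentDatum g} {φ ψ : Iso A A'} (a : TwoIso φ ψ) :
    TwoIso (φ.map f) (ψ.map f) where
  a := app f 0 (-1) a.a
  twoMorphism := app_isTwoMorphism f 0 a.twoMorphism
  compat := by
    have h := congrArg (app f 1 (-1)) a.compat
    simp only [app_at₁, app_at₂, app_at₃, app_mulAt, app_expAd] at h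
    exact h

/-- The induced map on isomorphism classes of descent data. -/
def IsoClasses.map (f : g ⟶ g') : IsoClasses g → IsoClasses g' :=
  Quot.map (DescentDatum.map f) fun _ _ ⟨φ⟩ => ⟨φ.map f⟩

/-- The induced map on isomorphisms modulo two-isomorphisms. -/
def IsoModTwoIso.map (f : g ⟶ g') (A A' : DescentDatum g) :
    IsoModTwoIso A A' → IsoModTwoIso (A.map f) (A'.map f) :=
  Quot.map (Iso.map f) fun _ _ ⟨a⟩ => ⟨a.map f⟩

end Map

end DescentDatum

/-! ### Tensor product with the maximal ideal of a local Artinian algebra -/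

section Artinian

variable (𝔞 : Type w) [CommRing 𝔞] [Algebra k 𝔞] [IsLocalRing 𝔞]

/-- The cosimplicial DGLA `L ⊗ 𝔪`, with `𝔪` the maximal ideal of `𝔞`. -/
noncomputable def tensorMax (L : CosimplicialDGLA.{u, v} k) :
    CosimplicialDGLA.{u, max v w} k :=
  L ⋙ DGLA.tensorFunctor (IsLocalRing.maximalIdeal 𝔞)

/-- The morphism `f ⊗ 𝔪 : L₁ ⊗ 𝔪 → L₂ ⊗ 𝔪`. -/
noncomputable def tensorMaxMap {L₁ L₂ : CosimplicialDGLA.{u, v} k} (f : L₁ ⟶ L₂) :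
    tensorMax 𝔞 L₁ ⟶ tensorMax 𝔞 L₂ :=
  Functor.whiskerRight f (DGLA.tensorFunctor (IsLocalRing.maximalIdeal 𝔞))

instance isNilp_tensorMax [IsArtinianRing 𝔞] (L : CosimplicialDGLA.{u, v} k) (n : ℕ) :
    ((tensorMax 𝔞 L).obj (.mk n)).IsNilp :=
  DGLA.isNilp_tensor (IsLocalRing.maximalIdeal 𝔞) (L.obj (.mk n)) (by
    rw [← IsLocalRing.jacobson_eq_maximalIdeal (⊥ : Ideal 𝔞) bot_ne_top]
    exact IsArtinianRing.isNilpotent_jacobson_bot)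

end Artinian

end CosimplicialDGLA

/-!
The statement says that the two-groupoid of descent data of `L ⊗ 𝔪` depends on `L` only up to
quasi-isomorphism of total complexes. It is proved by obstruction theory, by induction on the order
of nilpotency of `𝔪`.

*The algebra of one DGLA.* The products on `g⁰` and on `g⁻¹` are defined by Dynkin's form of the
Campbell--Dynkin--Hausdorff series, so that even associativity has to be proved. In an associative
algebra containing an element `θ` whose commutator with `x` and `y` is `x` and `y`, the commutator of
`θ` with `Z = log (exp x exp y)` is computed from `exp (ad Z) = exp (ad x) exp (ad y)`, and it is
Dynkin's series with every term multiplied by its number of letters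
(`nilExp_bch_of_euler`); such a `θ` is provided by polynomials and the Euler derivation. An identity
in the group of a nilpotent Lie algebra is checked in the affine representation of the Lie algebra of
polynomials that has the Euler derivation as cocycle, because this representation is faithful on
polynomials without constant term (`IsNilpotentLie.eq_of_polyEuler`). It follows that `g⁰` acts on
everything by `expAd` and `gaugeAct`, and that `d_λ : g⁻¹ → g⁰` is a crossed module. All this needs
only that the curvature of `λ` be central.

*Defects.* For data `(λ, G, c)` that need not satisfy the conditions of a descent datum, the defects of
the four conditions form a family of degree two of the total complex (`PreDatum.defect`). If it is
central, it is a cocycle (`PreDatum.totalD_defect`; the last component is the pentagon of a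
four-simplex), and a central modification of the data changes it by a coboundary
(`PreDatum.defect_add`). In the same way the defect of `(H, b)` is a cochain of degree one whose
differential is the difference of the defects of its ends, and the defect of `a` is a cochain of
degree zero whose differential is the difference of the defects of two isomorphisms.

*Central extensions.* Let `f` be a morphism of central extensions of cosimplicial DGLAs that induces
an equivalence on the quotients. Lift the data that exist in the quotients; the defects of the lifts
form a cocycle in the cone of `f` on the kernels. If this cone is acyclic, a primitive of the cocycle
corrects the lifts, so that `f` induces an equivalence
(`IsDescentEquivalence.of_isCentralExtension`).

*Induction.* If `I ^ (n + 2) = 0`, then `L ⊗ I` is a central extension of `L ⊗ (I / I ^ (n + 1))` with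
kernel `L ⊗ I ^ (n + 1)`. On the kernels the cone of `f` is acyclic, being the tensor product of the
cone of `f` with a vector space (`IsAcyclic.tensor`). This gives
`IsDescentEquivalence.tensor_of_pow_eq_bot`.
-/

set_option linter.unusedSectionVars false

/-! ### Power series evaluated at nilpotent elements -/

namespace PowerSeries

section NilEval

variable {k : Type u} [Field k] {A : Type v} [Ring A] [Algebra k A]

/-- The value of a power series at an element `a` of an algebra. It is meaningful for nilpotent `a`,
when only finitely many summands are nonzero. -/
noncomputable def nilEval (a : A) (p : k⟦X⟧) : A := ∑ᶠ n, coeff n p • a ^ n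

lemma nilEval_eq_sum {a : A} {N : ℕ} (h : a ^ N = 0) (p : k⟦X⟧) :
    nilEval a p = ∑ n ∈ Finset.range N, coeff n p • a ^ n := by
  refine finsum_eq_sum_of_support_subset _ fun n hn => ?_
  simp only [Finset.coe_range, Set.mem_Iio]
  by_contra hlt
  exact hn (by simp [pow_eq_zero_of_le (not_lt.1 hlt) h])

lemma nilEval_coe {a : A} (ha : IsNilpotent a) (P : Polynomial k) :
    nilEval a (P : k⟦X⟧) = Polynomial.aeval a P := by
  obtain ⟨N, hN⟩ := ha
  have hM : a ^ (max N (P.natDegree + 1)) = 0 := pow_eq_zero_of_le (le_max_left _ _) hN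
  rw [nilEval_eq_sum hM, Polynomial.aeval_eq_sum_range' (lt_of_lt_of_le (Nat.lt_succ_self _)
    (le_max_right N _))]
  simp

lemma nilEval_add {a : A} (ha : IsNilpotent a) (p q : k⟦X⟧) :
    nilEval a (p + q) = nilEval a p + nilEval a q := by
  obtain ⟨N, hN⟩ := ha
  simp [nilEval_eq_sum hN, add_smul, Finset.sum_add_distrib]

lemma nilEval_congr {a : A} {N : ℕ} (h : a ^ N = 0) {p q : k⟦X⟧} (hpq : X ^ N ∣ p - q) :
    nilEval a p = nilEval a q := by
  rw [nilEval_eq_sum h, nilEval_eq_sum h]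
  refine Finset.sum_congr rfl fun n hn => ?_
  have := X_pow_dvd_iff.1 hpq n (Finset.mem_range.1 hn)
  rw [map_sub, sub_eq_zero] at this
  rw [this]

lemma X_pow_dvd_sub_trunc (N : ℕ) (p : k⟦X⟧) : X ^ N ∣ p - (trunc N p : k⟦X⟧) := by
  rw [X_pow_dvd_iff]
  intro m hm
  simp [coeff_trunc, hm]

lemma nilEval_mul {a : A} (ha : IsNilpotent a) (p q : k⟦X⟧) :
    nilEval a (p * q) = nilEval a p * nilEval a q := by
  obtain ⟨N, hN⟩ := id ha
  have hp := X_pow_dvd_sub_trunc N p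
  have hq := X_pow_dvd_sub_trunc N q
  rw [nilEval_congr hN hp, nilEval_congr hN hq,
    nilEval_congr (q := ((trunc N p * trunc N q : Polynomial k) : k⟦X⟧)) hN, nilEval_coe ha,
    nilEval_coe ha, nilEval_coe ha, map_mul]
  have : p * q - ((trunc N p * trunc N q : Polynomial k) : k⟦X⟧) =
      (p - (trunc N p : k⟦X⟧)) * q + (trunc N p : k⟦X⟧) * (q - (trunc N q : k⟦X⟧)) := by
    rw [Polynomial.coe_mul]
    ring
  rw [this]
  exact dvd_add (hp.mul_right _) (hq.mul_left _)

/-- Evaluation at a nilpotent element, as a homomorphism of algebras. -/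
noncomputable def nilEvalHom {a : A} (ha : IsNilpotent a) : k⟦X⟧ →ₐ[k] A :=
  AlgHom.ofLinearMap
    { toFun := nilEval a
      map_add' := nilEval_add ha
      map_smul' := fun c p => by
        obtain ⟨N, hN⟩ := ha
        simp [nilEval_eq_sum hN, Finset.smul_sum, mul_smul] }
    (by
      have := nilEval_coe (k := k) ha 1
      simpa using this)
    (nilEval_mul ha)

lemma nilEvalHom_apply {a : A} (ha : IsNilpotent a) (p : k⟦X⟧) :
    nilEvalHom ha p = nilEval a p := rfl

lemma nilEvalHom_X {a : A} (ha : IsNilpotent a) : nilEvalHom (k := k) ha X = a := by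
  have := nilEval_coe (k := k) ha Polynomial.X
  simpa [nilEvalHom_apply] using this

lemma nilEval_one {a : A} (ha : IsNilpotent a) : nilEval a (1 : k⟦X⟧) = 1 :=
  map_one (nilEvalHom ha)

lemma nilEval_pow_eq_zero {a : A} {N : ℕ} (h : a ^ N = 0) {q : k⟦X⟧}
    (hq : constantCoeff q = 0) : nilEval a q ^ N = 0 := by
  have ha : IsNilpotent a := ⟨N, h⟩
  have h0 : nilEval a (q ^ N) = nilEval a (0 : k⟦X⟧) :=
    nilEval_congr h (by simpa using pow_dvd_pow_of_dvd (X_dvd_iff.2 hq) N)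
  rw [← nilEvalHom_apply ha, ← nilEvalHom_apply ha, map_pow, map_zero] at h0
  exact h0

lemma nilEval_subst {a : A} (ha : IsNilpotent a) (p : k⟦X⟧) {q : k⟦X⟧}
    (hq : constantCoeff q = 0) : nilEval a (p.subst q) = nilEval (nilEval a q) p := by
  obtain ⟨N, hN⟩ := id ha
  have hs : HasSubst q := HasSubst.of_constantCoeff_zero' hq
  have hb := nilEval_pow_eq_zero hN hq
  obtain ⟨s, hs'⟩ := X_pow_dvd_sub_trunc N p
  rw [nilEval_congr hb (X_pow_dvd_sub_trunc N p), nilEval_coe ⟨N, hb⟩,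
    nilEval_congr (q := ((trunc N p : Polynomial k) : k⟦X⟧).subst q) hN, subst_coe hs,
    ← nilEvalHom_apply ha, ← nilEvalHom_apply ha, Polynomial.aeval_algHom_apply]
  rw [← subst_sub hs, hs', subst_mul hs, subst_pow hs, subst_X hs]
  exact (pow_dvd_pow_of_dvd (X_dvd_iff.2 hq) N).mul_right _

lemma map_nilEval {B : Type w} [Ring B] [Algebra k B] (φ : A →ₐ[k] B) {a : A}
    (ha : IsNilpotent a) (p : k⟦X⟧) : φ (nilEval a p) = nilEval (φ a) p := by
  obtain ⟨N, hN⟩ := ha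
  have hN' : φ a ^ N = 0 := by rw [← map_pow, hN, map_zero]
  simp [nilEval_eq_sum hN, nilEval_eq_sum hN']

lemma nilEval_mem (S : NonUnitalSubalgebra k A) {a : A} (ha : a ∈ S) {q : k⟦X⟧}
    (hq : constantCoeff q = 0) : nilEval a q ∈ S := by
  refine finsum_induction (· ∈ S) S.zero_mem (fun _ _ => S.add_mem) fun n => ?_
  rcases n with _ | n
  · simp [hq]
  · have h : a ^ (n + 1) ∈ S := by
      induction n with
      | zero => simpa
      | succ n ih => rw [pow_succ]; exact S.mul_mem ih ha
    exact SMulMemClass.smul_mem _ h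

end NilEval

section ExpLog

variable (k : Type u) [Field k] [CharZero k]

/-- The power series `(exp X - 1) / X`. -/
noncomputable def expQuot : k⟦X⟧ := mk fun n => ((n + 1).factorial : k)⁻¹

/-- The power series `log (1 + X) / X`. -/
noncomputable def logQuot : k⟦X⟧ := mk fun n => (-1) ^ n / ((n : k) + 1)

lemma coeff_exp_eq (n : ℕ) : coeff n (exp k) = (n.factorial : k)⁻¹ := by
  simp

lemma X_mul_expQuot : X * expQuot k = exp k - 1 := by
  ext n
  rcases n with _ | n
  · simp
  · simp [coeff_succ_X_mul, expQuot, coeff_one]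

lemma X_mul_logQuot : X * logQuot k = log k := by
  ext n
  rcases n with _ | n
  · simp
  · simp [coeff_succ_X_mul, logQuot, pow_succ]

lemma one_add_X_mul_deriv_log : (1 + X) * d⁄dX k (log k) = 1 := by
  rw [deriv_log]
  ext n
  rcases n with _ | n
  · simp [add_mul]
  · simp [add_mul, coeff_succ_X_mul, coeff_one, pow_succ]

lemma log_subst_exp_sub_one : (log k).subst (exp k - 1) = X := by
  have hs : HasSubst (exp k - 1) := HasSubst.exp_sub_one
  refine derivative.ext ?_ ?_
  · rw [derivative_subst hs, map_sub, derivative_exp, derivative_one, sub_zero, derivative_X]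
    have h : ((1 + X) * d⁄dX k (log k)).subst (exp k - 1) = (1 : k⟦X⟧).subst (exp k - 1) := by
      rw [one_add_X_mul_deriv_log]
    have h1 : (1 : k⟦X⟧).subst (exp k - 1) = (1 : k⟦X⟧) := by
      rw [← coe_substAlgHom hs, map_one]
    rw [subst_mul hs, subst_add hs, subst_X hs, h1] at h
    rw [mul_comm]
    simpa using h
  · have h : MvPowerSeries.constantCoeff (exp k - 1 : k⟦X⟧) = 0 := by
      rw [map_sub, map_one, ← constantCoeff_eq, constantCoeff_exp, sub_self]
    rw [constantCoeff_X]
    exact constantCoeff_subst_eq_zero h _ constantCoeff_log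

lemma expQuot_mul_logQuot : expQuot k * (logQuot k).subst (exp k - 1) = 1 := by
  have hs : HasSubst (exp k - 1) := HasSubst.exp_sub_one
  have h := log_subst_exp_sub_one k
  rw [← X_mul_logQuot, subst_mul hs, subst_X hs, ← X_mul_expQuot, mul_assoc] at h
  rw [← X_mul_expQuot]
  exact mul_left_cancel₀ X_ne_zero (h.trans (mul_one X).symm)

lemma exp_subst_log : (exp k).subst (log k) = 1 + X := by
  have hs : HasSubst (log k) := HasSubst.log
  have h0 : constantCoeff (log k) = 0 := constantCoeff_log
  -- the series `q = exp (log (1 + X))` satisfies `(1 + X) q' = q`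
  have hd : d⁄dX k ((exp k).subst (log k) * d⁄dX k (log k)) = 0 := by
    have h1 : d⁄dX k (d⁄dX k (log k)) = - (d⁄dX k (log k)) * d⁄dX k (log k) := by
      have h := congrArg (d⁄dX k) (one_add_X_mul_deriv_log k)
      rw [Derivation.leibniz, map_add, derivative_one, derivative_X] at h
      simp only [smul_eq_mul, zero_add, mul_one] at h
      have h2 := one_add_X_mul_deriv_log k
      linear_combination (d⁄dX k (log k)) * h - (d⁄dX k) ((d⁄dX k) (log k)) * h2
    rw [Derivation.leibniz, derivative_subst hs, derivative_exp, h1]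
    simp only [smul_eq_mul]
    ring
  have hc : (exp k).subst (log k) * d⁄dX k (log k) = 1 := by
    refine derivative.ext (by rw [hd, derivative_one]) ?_
    rw [map_mul, map_one, deriv_log]
    have : constantCoeff ((exp k).subst (log k)) = 1 := by
      have h2 : constantCoeff ((exp k - 1).subst (log k)) = 0 :=
        constantCoeff_subst_eq_zero h0 _ (by simp)
      have h1 : (1 : k⟦X⟧).subst (log k) = (1 : k⟦X⟧) := by
        rw [← coe_substAlgHom hs, map_one]
      rwa [subst_sub hs, h1, map_sub, map_one, sub_eq_zero] at h2
    rw [this, ← coeff_zero_eq_constantCoeff_apply, coeff_mk]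
    simp
  have h2 := one_add_X_mul_deriv_log k
  linear_combination (1 + X) * hc - (exp k).subst (log k) * h2

end ExpLog

end PowerSeries

/-! ### Exponentials of nilpotent elements -/

section NilExp

open PowerSeries

variable (k : Type u) [Field k] [CharZero k] {A : Type v} [Ring A] [Algebra k A]

/-- The exponential of a nilpotent element of an algebra over a field of characteristic zero. -/
noncomputable def nilExp (a : A) : A := ∑ᶠ n : ℕ, (n.factorial : k)⁻¹ • a ^ n

lemma nilExp_eq_nilEval (a : A) : nilExp k a = nilEval a (exp k) :=
  finsum_congr fun n => by rw [coeff_exp_eq]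

lemma nilExp_eq_sum {a : A} {N : ℕ} (h : a ^ N = 0) :
    nilExp k a = ∑ n ∈ Finset.range N, (n.factorial : k)⁻¹ • a ^ n := by
  rw [nilExp_eq_nilEval, nilEval_eq_sum h]
  exact Finset.sum_congr rfl fun n _ => by rw [coeff_exp_eq]

lemma nilExp_zero : nilExp k (0 : A) = 1 := by
  rw [nilExp_eq_sum k (pow_one (0 : A))]
  simp

lemma map_nilExp {B : Type w} [Ring B] [Algebra k B] (φ : A →ₐ[k] B) {a : A}
    (ha : IsNilpotent a) : φ (nilExp k a) = nilExp k (φ a) := by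
  rw [nilExp_eq_nilEval, nilExp_eq_nilEval, map_nilEval φ ha]

lemma nilExp_eq_exp [Module ℚ A] (a : A) (ha : IsNilpotent a) :
    nilExp k a = IsNilpotent.exp a := by
  obtain ⟨N, hN⟩ := ha
  rw [nilExp_eq_sum k hN, IsNilpotent.exp_eq_sum hN]
  refine Finset.sum_congr rfl fun n _ => ?_
  exact inv_natCast_smul_eq k ℚ _ _

lemma nilExp_add_of_commute {a b : A} (h : Commute a b) (ha : IsNilpotent a)
    (hb : IsNilpotent b) : nilExp k (a + b) = nilExp k a * nilExp k b := by
  let _ : Algebra ℚ A := Algebra.compHom A (algebraMap ℚ k)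
  rw [nilExp_eq_exp k _ (h.isNilpotent_add ha hb), nilExp_eq_exp k _ ha, nilExp_eq_exp k _ hb]
  exact IsNilpotent.exp_add_of_commute h ha hb

lemma nilExp_mul_nilExp_neg {a : A} (ha : IsNilpotent a) : nilExp k a * nilExp k (-a) = 1 := by
  rw [← nilExp_add_of_commute k (Commute.neg_right rfl) ha ha.neg, add_neg_cancel, nilExp_zero]

lemma nilExp_neg_mul_nilExp {a : A} (ha : IsNilpotent a) : nilExp k (-a) * nilExp k a = 1 := by
  rw [← nilExp_add_of_commute k (Commute.neg_left rfl) ha.neg ha, neg_add_cancel, nilExp_zero]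

/-- The logarithm of the unipotent element `1 + a`. -/
noncomputable def nilLog (a : A) : A := nilEval a (log k)

lemma nilExp_nilLog {a : A} (ha : IsNilpotent a) : nilExp k (nilLog k a) = 1 + a := by
  rw [nilExp_eq_nilEval, nilLog, ← nilEval_subst ha _ constantCoeff_log, exp_subst_log,
    nilEval_add ha, nilEval_one ha, ← nilEvalHom_apply ha, nilEvalHom_X]

lemma nilExp_sub_one {a : A} (ha : IsNilpotent a) : nilExp k a - 1 = nilEval a (exp k - 1) := by
  rw [nilExp_eq_nilEval, ← nilEvalHom_apply ha, ← nilEvalHom_apply ha, map_sub, map_one]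

lemma nilLog_nilExp {a : A} (ha : IsNilpotent a) : nilLog k (nilExp k a - 1) = a := by
  rw [nilExp_sub_one k ha, nilLog, ← nilEval_subst ha _ (by simp), log_subst_exp_sub_one,
    ← nilEvalHom_apply ha, nilEvalHom_X]

lemma nilExp_injective {a b : A} (ha : IsNilpotent a) (hb : IsNilpotent b)
    (h : nilExp k a = nilExp k b) : a = b := by
  rw [← nilLog_nilExp k ha, h, nilLog_nilExp k hb]

lemma isNilpotent_nilExp_sub_one {a : A} (ha : IsNilpotent a) :
    IsNilpotent (nilExp k a - 1) := by
  obtain ⟨N, hN⟩ := id ha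
  rw [nilExp_sub_one k ha]
  exact ⟨N, nilEval_pow_eq_zero hN (by simp)⟩

end NilExp

/-! ### The adjoint action in an associative algebra -/

section NilAd

variable (k : Type u) [Field k] [CharZero k] {A : Type v} [Ring A] [Algebra k A]

/-- The operator `b ↦ a b - b a`. -/
def commutatorOp (a : A) : Module.End k A := LinearMap.mulLeft k a - LinearMap.mulRight k a

lemma commutatorOp_apply (a b : A) : commutatorOp k a b = a * b - b * a := rfl

lemma isNilpotent_commutatorOp {a : A} (ha : IsNilpotent a) : IsNilpotent (commutatorOp k a) :=
  (LinearMap.commute_mulLeft_right a a).isNilpotent_sub ((LinearMap.isNilpotent_mulLeft_iff k a).2 ha)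
    ((LinearMap.isNilpotent_mulRight_iff k a).2 ha)

lemma nilExp_mulLeft {a : A} (ha : IsNilpotent a) (b : A) :
    nilExp k (LinearMap.mulLeft k a) b = nilExp k a * b := by
  obtain ⟨N, hN⟩ := ha
  have h : LinearMap.mulLeft k a ^ N = 0 := by
    rw [LinearMap.pow_mulLeft, hN, LinearMap.mulLeft_zero_eq_zero]
  simp [nilExp_eq_sum k hN, nilExp_eq_sum k h, LinearMap.sum_apply, Finset.sum_mul]

lemma nilExp_mulRight {a : A} (ha : IsNilpotent a) (b : A) :
    nilExp k (LinearMap.mulRight k a) b = b * nilExp k a := by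
  obtain ⟨N, hN⟩ := ha
  have h : LinearMap.mulRight k a ^ N = 0 := by
    rw [LinearMap.pow_mulRight, hN, LinearMap.mulRight_zero_eq_zero]
  simp [nilExp_eq_sum k hN, nilExp_eq_sum k h, LinearMap.sum_apply, Finset.mul_sum]

lemma nilExp_commutatorOp {a : A} (ha : IsNilpotent a) (b : A) :
    nilExp k (commutatorOp k a) b = nilExp k a * b * nilExp k (-a) := by
  have hR : -LinearMap.mulRight k a = LinearMap.mulRight k (-a) := by
    ext b
    simp
  rw [commutatorOp, sub_eq_add_neg, hR, nilExp_add_of_commute k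
    (LinearMap.commute_mulLeft_right a (-a)) ((LinearMap.isNilpotent_mulLeft_iff k a).2 ha)
    ((LinearMap.isNilpotent_mulRight_iff k (-a)).2 ha.neg), Module.End.mul_apply, nilExp_mulRight k ha.neg,
    nilExp_mulLeft k ha, mul_assoc]

lemma nilExp_apply_of_apply_apply_eq_zero {M : Type w} [AddCommGroup M] [Module k M]
    {a : Module.End k M} (ha : IsNilpotent a) {m : M} (h : a (a m) = 0) :
    nilExp k a m = m + a m := by
  obtain ⟨N, hN⟩ := ha
  have hN' : a ^ (N + 2) = 0 := pow_eq_zero_of_le (by omega) hN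
  rw [nilExp_eq_sum k hN', LinearMap.sum_apply, Finset.sum_range_succ', Finset.sum_range_succ',
    Finset.sum_eq_zero]
  · simp [add_comm]
  · intro n _
    rw [LinearMap.smul_apply, pow_succ, pow_succ, Module.End.mul_apply, Module.End.mul_apply,
      h, map_zero, smul_zero]

end NilAd

/-! ### Resummation of Dynkin's series -/

section Dynkin

/-- The lists of length `n` with entries in a finite set. -/
def Finset.listsOfLength {α : Type u} [DecidableEq α] (P : Finset α) : ℕ → Finset (List α)
  | 0 => {[]}
  | n + 1 => (P ×ˢ Finset.listsOfLength P n).image fun q => q.1 :: q.2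

lemma Finset.mem_listsOfLength {α : Type u} [DecidableEq α] (P : Finset α) (n : ℕ) (l : List α) :
    l ∈ P.listsOfLength n ↔ l.length = n ∧ ∀ a ∈ l, a ∈ P := by
  induction n generalizing l with
  | zero =>
    simp only [listsOfLength, mem_singleton, List.length_eq_zero_iff]
    exact ⟨fun h => ⟨h, by simp [h]⟩, fun h => h.1⟩
  | succ n ih =>
    simp only [listsOfLength, mem_image, mem_product, Prod.exists]
    constructor
    · rintro ⟨a, l', ⟨ha, hl'⟩, rfl⟩
      rw [ih] at hl'
      simp only [List.length_cons, hl'.1, List.mem_cons, true_and]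
      rintro b (rfl | hb)
      exacts [ha, hl'.2 _ hb]
    · rintro ⟨h, h'⟩
      rcases l with _ | ⟨a, l'⟩
      · simp at h
      · exact ⟨a, l', ⟨h' a (by simp), (ih l').2 ⟨by simpa using h, fun b hb => h' b (by simp [hb])⟩⟩,
          rfl⟩

lemma Finset.sum_listsOfLength_succ {α : Type u} [DecidableEq α] {M : Type v} [AddCommMonoid M]
    (P : Finset α) (n : ℕ) (F : List α → M) :
    ∑ l ∈ P.listsOfLength (n + 1), F l = ∑ a ∈ P, ∑ l ∈ P.listsOfLength n, F (a :: l) := by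
  rw [listsOfLength, Finset.sum_image, Finset.sum_product]
  rintro ⟨a, l⟩ _ ⟨b, l'⟩ _ h
  simpa using h

variable {k : Type u} [Field k] [CharZero k] {M : Type v} [AddCommGroup M] [Module k M]

lemma nestedBracket_cons {br : M → M → M} (a : M) {l : List M} (hl : l ≠ []) :
    nestedBracket br (a :: l) = br a (nestedBracket br l) := by
  obtain ⟨b, l', rfl⟩ := List.exists_cons_of_ne_nil hl
  rfl

lemma nestedBracket_replicate_append (br : M →ₗ[k] M →ₗ[k] M) (a : M) (r : ℕ) {l : List M}
    (hl : l ≠ []) :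
    nestedBracket (fun a b => br a b) (List.replicate r a ++ l) =
      ((br a : Module.End k M) ^ r) (nestedBracket (fun a b => br a b) l) := by
  induction r with
  | zero => simp
  | succ r ih =>
    rw [List.replicate_succ, List.cons_append, nestedBracket_cons _ (by simp [hl]), ih, pow_succ',
      Module.End.mul_apply]

lemma nestedBracket_replicate_eq_zero (br : M →ₗ[k] M →ₗ[k] M) {a : M} (ha : br a a = 0) (r : ℕ)
    (hr : r ≠ 1) : nestedBracket (fun a b => br a b) (List.replicate r a) = 0 := by
  rcases r with _ | _ | r
  · rfl
  · exact absurd rfl hr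
  · have h := nestedBracket_replicate_append br a (r + 1) (l := [a]) (by simp)
    rw [← List.replicate_succ'] at h
    rw [h, pow_succ, Module.End.mul_apply]
    simp [nestedBracket, ha]

/-- The letters `x^r y^s` of one block of a Dynkin word. -/
def blockLetters (x y : M) (p : ℕ × ℕ) : List M := List.replicate p.1 x ++ List.replicate p.2 y

lemma blockLetters_ne_nil (x y : M) {p : ℕ × ℕ} (hp : p ≠ (0, 0)) : blockLetters x y p ≠ [] := by
  intro h
  simp only [blockLetters, List.append_eq_nil_iff, List.replicate_eq_nil_iff] at h
  exact hp (Prod.ext h.1 h.2)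

lemma nestedBracket_blockLetters_append (br : M →ₗ[k] M →ₗ[k] M) (x y : M) (p : ℕ × ℕ)
    {l : List M} (hl : l ≠ []) :
    nestedBracket (fun a b => br a b) (blockLetters x y p ++ l) =
      ((br x : Module.End k M) ^ p.1 * (br y : Module.End k M) ^ p.2)
        (nestedBracket (fun a b => br a b) l) := by
  rw [blockLetters, List.append_assoc, nestedBracket_replicate_append br x _ (by simp [hl]),
    nestedBracket_replicate_append br y _ hl, Module.End.mul_apply]

/-- The summand of Dynkin's series attached to a list of blocks, without the factor depending on
the number of blocks and of letters. -/
noncomputable def dynkinTerm (br : M →ₗ[k] M →ₗ[k] M) (x y : M) (l : List (ℕ × ℕ)) : M :=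
  (((l.map fun p => p.1.factorial * p.2.factorial).prod : ℕ) : k)⁻¹ •
    nestedBracket (fun a b => br a b) (l.flatMap (blockLetters x y))

variable (br : M →ₗ[k] M →ₗ[k] M) {x y : M}

lemma dynkinTerm_cons (p : ℕ × ℕ) {l : List (ℕ × ℕ)} (hl : l ≠ []) (h0 : (0, 0) ∉ l) :
    dynkinTerm br x y (p :: l) = ((p.1.factorial * p.2.factorial : ℕ) : k)⁻¹ •
      ((br x : Module.End k M) ^ p.1 * (br y : Module.End k M) ^ p.2) (dynkinTerm br x y l) := by
  have hl' : l.flatMap (blockLetters x y) ≠ [] := by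
    obtain ⟨q, l', rfl⟩ := List.exists_cons_of_ne_nil hl
    have hq : q ≠ (0, 0) := fun h => h0 (by simp [h])
    simp [blockLetters_ne_nil x y hq]
  simp only [dynkinTerm, List.map_cons, List.prod_cons, List.flatMap_cons]
  rw [nestedBracket_blockLetters_append br x y p hl', map_smul, smul_smul, Nat.cast_mul, mul_inv]

/-- The nontrivial pairs `(r, s)` with `r, s < N`. -/
def blocks (N : ℕ) : Finset (ℕ × ℕ) := (Finset.range N ×ˢ Finset.range N).erase (0, 0)

lemma sum_blocks_op {N : ℕ} (hN : 0 < N) (hx : (br x : Module.End k M) ^ N = 0)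
    (hy : (br y : Module.End k M) ^ N = 0) :
    ∑ p ∈ blocks N, ((p.1.factorial * p.2.factorial : ℕ) : k)⁻¹ •
      ((br x : Module.End k M) ^ p.1 * (br y : Module.End k M) ^ p.2) =
      nilExp k (br x : Module.End k M) * nilExp k (br y : Module.End k M) - 1 := by
  have h0 : ((0, 0) : ℕ × ℕ) ∈ Finset.range N ×ˢ Finset.range N := by simp [hN]
  rw [blocks, Finset.sum_erase_eq_sub h0, nilExp_eq_sum k hx, nilExp_eq_sum k hy,
    Finset.sum_mul_sum, ← Finset.sum_product']
  congr 1
  · refine Finset.sum_congr rfl fun p _ => ?_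
    rw [smul_mul_smul_comm, Nat.cast_mul, mul_inv]
  · simp

lemma sum_blocks_dynkinTerm {N : ℕ} (hN : 2 ≤ N) (hx : (br x : Module.End k M) ^ N = 0)
    (hxx : br x x = 0) (hyy : br y y = 0) :
    ∑ p ∈ blocks N, dynkinTerm br x y [p] = x + nilExp k (br x : Module.End k M) y := by
  have h0 : ((0, 0) : ℕ × ℕ) ∈ Finset.range N ×ˢ Finset.range N := by
    simp only [Finset.mem_product, Finset.mem_range]
    omega
  have hterm : ∀ r s : ℕ, dynkinTerm br x y [(r, s)] = if s = 0 then (if r = 1 then x else 0) else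
      if s = 1 then (r.factorial : k)⁻¹ • ((br x : Module.End k M) ^ r) y else 0 := by
    intro r s
    simp only [dynkinTerm, List.map_cons, List.map_nil, List.prod_cons, List.prod_nil, mul_one,
      List.flatMap_cons, List.flatMap_nil, List.append_nil, blockLetters]
    rcases s with _ | _ | s
    · simp only [List.replicate_zero, List.append_nil, if_true]
      split_ifs with hr
      · subst hr
        simp [nestedBracket]
      · rw [nestedBracket_replicate_eq_zero br hxx r hr, smul_zero]
    · rw [nestedBracket_replicate_append br x r (by simp)]
      simp [nestedBracket]
    · rw [nestedBracket_replicate_append br x r (by simp),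
        nestedBracket_replicate_eq_zero br hyy _ (by omega), map_zero, smul_zero]
      simp
  have h00 : dynkinTerm br x y [(0, 0)] = 0 := by rw [hterm]; simp
  rw [blocks, Finset.sum_erase_eq_sub h0, h00, sub_zero, Finset.sum_product]
  obtain ⟨N, rfl⟩ : ∃ m, N = m + 2 := ⟨N - 2, by omega⟩
  have hs : ∀ r, ∑ s ∈ Finset.range (N + 2), dynkinTerm br x y [(r, s)] =
      (if r = 1 then x else 0) + (r.factorial : k)⁻¹ • ((br x : Module.End k M) ^ r) y := by
    intro r
    rw [Finset.sum_range_succ', Finset.sum_range_succ', Finset.sum_eq_zero]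
    · simp [hterm, add_comm]
    · intro s _
      rw [hterm]
      simp
  rw [Finset.sum_congr rfl fun r _ => hs r, Finset.sum_add_distrib, nilExp_eq_sum k hx,
    LinearMap.sum_apply]
  congr 1
  rw [Finset.sum_ite_eq' (Finset.range (N + 2)) 1 (fun _ => x)]
  simp

lemma sum_listsOfLength_dynkinTerm {N : ℕ} (hN : 2 ≤ N) (hx : (br x : Module.End k M) ^ N = 0)
    (hy : (br y : Module.End k M) ^ N = 0) (hxx : br x x = 0) (hyy : br y y = 0) (n : ℕ) :
    ∑ l ∈ (blocks N).listsOfLength (n + 1), dynkinTerm br x y l =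
      ((nilExp k (br x : Module.End k M) * nilExp k (br y : Module.End k M) - 1) ^ n)
        (x + nilExp k (br x : Module.End k M) y) := by
  induction n with
  | zero =>
    rw [Finset.sum_listsOfLength_succ, pow_zero, Module.End.one_apply,
      ← sum_blocks_dynkinTerm br hN hx hxx hyy]
    simp [Finset.listsOfLength]
  | succ n ih =>
    rw [Finset.sum_listsOfLength_succ, pow_succ', Module.End.mul_apply, ← ih,
      ← sum_blocks_op br (by omega) hx hy, LinearMap.sum_apply]
    refine Finset.sum_congr rfl fun p _ => ?_
    rw [map_sum]
    refine Finset.sum_congr rfl fun l hl => ?_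
    rw [Finset.mem_listsOfLength] at hl
    refine dynkinTerm_cons br p (fun h => by simp [h] at hl) fun h => ?_
    simpa [blocks] using hl.2 _ h

/-- The sum of Dynkin's series with every summand multiplied by its number of letters. -/
lemma finsum_dynkin {N : ℕ} (hN : 2 ≤ N) (hx : (br x : Module.End k M) ^ N = 0)
    (hy : (br y : Module.End k M) ^ N = 0) (hxx : br x x = 0) (hyy : br y y = 0)
    (hw : (nilExp k (br x : Module.End k M) * nilExp k (br y : Module.End k M) - 1) ^ N = 0)
    (h : ∀ l : DynkinWord, N ≤ (l.letters x y).length →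
      nestedBracket (fun a b => br a b) (l.letters x y) = 0) :
    ∑ᶠ l : DynkinWord, (((l.letters x y).length : k) * l.coeff k) •
        nestedBracket (fun a b => br a b) (l.letters x y) =
      PowerSeries.nilEval
        (nilExp k (br x : Module.End k M) * nilExp k (br y : Module.End k M) - 1)
        (PowerSeries.logQuot k) (x + nilExp k (br x : Module.End k M) y) := by
  classical
  set F : List (ℕ × ℕ) → M := fun l =>
    ((-1 : k) ^ (l.length + 1) / (l.length : k)) • dynkinTerm br x y l with hF
  have hle : ∀ l : List (ℕ × ℕ), (0, 0) ∉ l →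
      l.length ≤ (l.flatMap (blockLetters x y)).length := by
    intro l hl
    induction l with
    | nil => simp
    | cons p l ih =>
      simp only [List.mem_cons, not_or] at hl
      have := List.length_pos_of_ne_nil (blockLetters_ne_nil x y (Ne.symm hl.1))
      have := ih hl.2
      simp only [List.length_cons, List.flatMap_cons, List.length_append]
      omega
  have hterm : ∀ l : DynkinWord, (((l.letters x y).length : k) * l.coeff k) •
      nestedBracket (fun a b => br a b) (l.letters x y) = F l.1 := by
    rintro ⟨l, hl, h0⟩
    have h1 : ((l.map fun p => p.1 + p.2).sum : ℕ) ≠ 0 := by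
      have := hle l h0
      have hlen := DynkinWord.length_letters x y ⟨l, hl, h0⟩
      have := List.length_pos_of_ne_nil hl
      change (l.flatMap (blockLetters x y)).length = _ at hlen
      simp only at hlen
      omega
    simp only [hF, dynkinTerm, smul_smul, DynkinWord.length_letters, DynkinWord.coeff]
    congr 1
    have h1' : (((l.map fun p => p.1 + p.2).sum : ℕ) : k) ≠ 0 := by exact_mod_cast h1
    rw [div_eq_mul_inv, mul_inv, mul_inv, div_eq_mul_inv]
    field_simp
  have hsub : ∀ l : List (ℕ × ℕ), F l ≠ 0 → l ≠ [] → (0, 0) ∉ l →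
      (l.flatMap (blockLetters x y)).length < N := by
    intro l hl hne h0
    by_contra hlt
    apply hl
    have := h ⟨l, hne, h0⟩ (not_lt.1 hlt)
    change nestedBracket (fun a b => br a b) (l.flatMap (blockLetters x y)) = 0 at this
    simp [hF, dynkinTerm, this]
  have hset : ∑ᶠ l : DynkinWord, F l.1 =
      ∑ᶠ l ∈ {l : List (ℕ × ℕ) | l ≠ [] ∧ (0, 0) ∉ l}, F l :=
    finsum_subtype_eq_finsum_cond _
  rw [finsum_congr hterm, hset,
    finsum_mem_eq_sum_of_inter_support_eq (t := (Finset.range N).biUnion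
      fun n => (blocks N).listsOfLength (n + 1)) F, Finset.sum_biUnion,
    PowerSeries.nilEval_eq_sum hw, LinearMap.sum_apply]
  · refine Finset.sum_congr rfl fun n _ => ?_
    rw [LinearMap.smul_apply, ← sum_listsOfLength_dynkinTerm br hN hx hy hxx hyy, Finset.smul_sum]
    refine Finset.sum_congr rfl fun l hl => ?_
    rw [Finset.mem_listsOfLength] at hl
    simp [hF, hl.1, PowerSeries.logQuot, pow_succ]
  · intro m _ n _ hmn
    refine Finset.disjoint_left.2 fun l hl hl' => hmn ?_
    rw [Finset.mem_listsOfLength] at hl hl'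
    omega
  · ext l
    simp only [Set.mem_inter_iff, Set.mem_ofPred_eq, Function.mem_support, Finset.coe_biUnion,
      Finset.coe_range, Set.mem_Iio, Set.mem_iUnion, Finset.mem_coe, Finset.mem_listsOfLength,
      exists_prop]
    refine and_congr_left fun hFl => ⟨fun ⟨hne, h0⟩ => ?_, fun ⟨n, hn, hlen, hmem⟩ => ?_⟩
    · have hlt := hsub l hFl hne h0
      refine ⟨l.length - 1, ?_, ?_, fun p hp => ?_⟩
      · have := hle l h0
        omega
      · have := List.length_pos_of_ne_nil hne
        omega
      · have hp0 : p ≠ (0, 0) := fun h => h0 (h ▸ hp)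
        have hsum := DynkinWord.length_letters x y ⟨l, hne, h0⟩
        change (l.flatMap (blockLetters x y)).length = _ at hsum
        have hple := List.single_le_sum (by simp) _
          (List.mem_map_of_mem (f := fun p : ℕ × ℕ => p.1 + p.2) hp)
        simp only at hsum hple
        simp only [blocks, Finset.mem_erase, ne_eq, hp0, not_false_eq_true, Finset.mem_product,
          Finset.mem_range, true_and]
        omega
    · refine ⟨fun h => by simp [h] at hlen, fun h0 => ?_⟩
      simpa [blocks] using hmem _ h0

end Dynkin

/-! ### The Campbell--Dynkin--Hausdorff formula in associative algebras -/

section AssociativeBCH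

open PowerSeries

variable (k : Type u) [Field k] [CharZero k] {A : Type v} [Ring A] [Algebra k A]

/-- The commutator as a bilinear map. -/
def commutatorBr (A : Type v) [Ring A] [Algebra k A] : A →ₗ[k] A →ₗ[k] A :=
  LinearMap.mul k A - (LinearMap.mul k A).flip

lemma commutatorBr_apply (a b : A) : commutatorBr k A a b = a * b - b * a := rfl

lemma commutatorBr_eq (a : A) : commutatorBr k A a = commutatorOp k a := rfl

lemma nilExp_sub_one_eq_mul {a : A} (ha : IsNilpotent a) :
    nilExp k a - 1 = nilEval a (expQuot k) * a := by
  have hX : nilEval a (X : k⟦X⟧) = a := nilEvalHom_X ha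
  rw [nilExp_sub_one k ha, ← X_mul_expQuot, mul_comm, nilEval_mul ha, hX]

variable {k}

lemma NonUnitalSubalgebra.nestedBracket_mem (R : NonUnitalSubalgebra k A) :
    ∀ l : List A, (∀ a ∈ l, a ∈ R) → nestedBracket (fun a b => commutatorBr k A a b) l ∈ R
  | [], _ => R.zero_mem
  | [a], h => h a (by simp)
  | a :: b :: l, h => by
    have h1 := NonUnitalSubalgebra.nestedBracket_mem R (b :: l) fun c hc => h c (by simp [hc])
    exact R.sub_mem (R.mul_mem (h a (by simp)) h1) (R.mul_mem h1 (h a (by simp)))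

lemma commutatorBr_nestedBracket {θ : A} :
    ∀ l : List A, (∀ a ∈ l, commutatorBr k A θ a = a) →
      commutatorBr k A θ (nestedBracket (fun a b => commutatorBr k A a b) l) =
        (l.length : k) • nestedBracket (fun a b => commutatorBr k A a b) l
  | [], _ => by simp [nestedBracket]
  | [a], h => by simp [nestedBracket, h a]
  | a :: b :: l, h => by
    have h1 := commutatorBr_nestedBracket (b :: l) fun c hc => h c (by simp [hc])
    have h2 := h a (by simp)
    rw [nestedBracket_cons _ (by simp)]
    set n := nestedBracket (fun a b => commutatorBr k A a b) (b :: l)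
    have h3 : commutatorBr k A θ (commutatorBr k A a n) =
        commutatorBr k A (commutatorBr k A θ a) n + commutatorBr k A a (commutatorBr k A θ n) := by
      simp only [commutatorBr_apply]
      noncomm_ring
    rw [h3, h1, h2, map_smul, List.length_cons (a := a), Nat.cast_add, add_smul, Nat.cast_one,
      one_smul, add_comm]

lemma DynkinWord.mem_letters {M : Type v} {x y : M} {l : DynkinWord} {a : M}
    (ha : a ∈ l.letters x y) : a = x ∨ a = y := by
  simp only [DynkinWord.letters, List.mem_flatMap, List.mem_append, List.mem_replicate] at ha
  obtain ⟨p, _, h | h⟩ := ha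
  exacts [Or.inl h.2, Or.inr h.2]

/-- The formula `exp (bch x y) = exp x exp y` in the presence of an element `θ` whose commutator
is the Euler derivation, and detects the nilpotent elements under consideration. -/
lemma nilExp_bch_of_euler {x y θ : A} (R : NonUnitalSubalgebra k A)
    (hnil : ∀ r ∈ R, IsNilpotent r) (hxR : x ∈ R) (hyR : y ∈ R)
    (hx : commutatorBr k A θ x = x) (hy : commutatorBr k A θ y = y)
    (hθ : ∀ r ∈ R, commutatorBr k A θ r = 0 → r = 0) {N : ℕ}
    (hN : ∀ l : DynkinWord, N ≤ (l.letters x y).length →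
      nestedBracket (fun a b => commutatorBr k A a b) (l.letters x y) = 0) :
    nilExp k (bch k (fun a b => commutatorBr k A a b) x y) = nilExp k x * nilExp k y := by
  have hxn := hnil x hxR
  have hyn := hnil y hyR
  -- the logarithm `Z` of `exp x * exp y`
  have heR : ∀ r ∈ R, nilExp k r - 1 ∈ R := fun r hr => by
    rw [nilExp_sub_one k (hnil r hr)]
    exact nilEval_mem R hr (by simp)
  have huR : nilExp k x * nilExp k y - 1 ∈ R := by
    have h : nilExp k x * nilExp k y - 1 = (nilExp k x - 1) * (nilExp k y - 1) +
        (nilExp k x - 1) + (nilExp k y - 1) := by noncomm_ring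
    rw [h]
    exact R.add_mem (R.add_mem (R.mul_mem (heR x hxR) (heR y hyR)) (heR x hxR)) (heR y hyR)
  set Z := nilLog k (nilExp k x * nilExp k y - 1) with hZ
  have hZR : Z ∈ R := nilEval_mem R huR constantCoeff_log
  have hZn := hnil Z hZR
  have hexpZ : nilExp k Z = nilExp k x * nilExp k y := by
    rw [hZ, nilExp_nilLog k (hnil _ huR)]
    abel
  have hexpZ' : nilExp k (-Z) = nilExp k (-y) * nilExp k (-x) := by
    have h1 := nilExp_neg_mul_nilExp k hZn
    rw [hexpZ] at h1
    calc nilExp k (-Z) = nilExp k (-Z) * (nilExp k x * nilExp k y) *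
          (nilExp k (-y) * nilExp k (-x)) := by
          rw [mul_assoc, mul_assoc (nilExp k x), ← mul_assoc (nilExp k y),
            nilExp_mul_nilExp_neg k hyn, one_mul, nilExp_mul_nilExp_neg k hxn, mul_one]
      _ = _ := by rw [h1, one_mul]
  have hadx := isNilpotent_commutatorOp k hxn
  have hady := isNilpotent_commutatorOp k hyn
  have hadZ := isNilpotent_commutatorOp k hZn
  have hw : nilExp k (commutatorOp k Z) =
      nilExp k (commutatorOp k x) * nilExp k (commutatorOp k y) := by
    ext b
    rw [Module.End.mul_apply, nilExp_commutatorOp k hZn, nilExp_commutatorOp k hxn,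
      nilExp_commutatorOp k hyn, hexpZ, hexpZ']
    noncomm_ring
  have hwn : IsNilpotent
      (nilExp k (commutatorOp k x) * nilExp k (commutatorOp k y) - 1) := by
    rw [← hw]
    exact isNilpotent_nilExp_sub_one k hadZ
  -- the commutator of `θ` with `Z`
  have hθx : commutatorOp k x θ = -x := by
    have h : commutatorOp k x θ = -(commutatorBr k A θ x) := by
      simp [commutatorBr_apply, commutatorOp_apply]
    rw [h, hx]
  have hθy : commutatorOp k y θ = -y := by
    have h : commutatorOp k y θ = -(commutatorBr k A θ y) := by
      simp [commutatorBr_apply, commutatorOp_apply]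
    rw [h, hy]
  have hxx : commutatorOp k x x = 0 := by simp [commutatorOp_apply]
  have hyy : commutatorOp k y y = 0 := by simp [commutatorOp_apply]
  have hv : nilExp k (commutatorOp k Z) θ - θ = -(x + nilExp k (commutatorOp k x) y) := by
    rw [hw, Module.End.mul_apply,
      nilExp_apply_of_apply_apply_eq_zero k hady (by rw [hθy, map_neg, hyy, neg_zero]), hθy,
      map_add, nilExp_apply_of_apply_apply_eq_zero k hadx (by rw [hθx, map_neg, hxx, neg_zero]),
      hθx, map_neg]
    abel
  have hf : nilEval (commutatorOp k Z) (expQuot k) (commutatorBr k A θ Z) =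
      x + nilExp k (commutatorOp k x) y := by
    have h1 : commutatorBr k A θ Z = -(commutatorOp k Z θ) := by
      simp [commutatorBr_apply, commutatorOp_apply]
    have h2 := nilExp_sub_one_eq_mul k hadZ
    have h3 := LinearMap.congr_fun h2 θ
    rw [Module.End.mul_apply, LinearMap.sub_apply, Module.End.one_apply, hv] at h3
    rw [h1, map_neg, ← h3, neg_neg]
  have hg : commutatorBr k A θ Z =
      nilEval (nilExp k (commutatorOp k x) * nilExp k (commutatorOp k y) - 1) (logQuot k)
        (x + nilExp k (commutatorOp k x) y) := by
    rw [← hw, nilExp_sub_one k hadZ, ← nilEval_subst hadZ _ (by simp), ← hf,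
      ← Module.End.mul_apply, ← nilEval_mul hadZ, mul_comm, expQuot_mul_logQuot, nilEval_one hadZ,
      Module.End.one_apply]
  -- comparison with Dynkin's series
  obtain ⟨Nx, hNx⟩ := hadx
  obtain ⟨Ny, hNy⟩ := hady
  obtain ⟨Nw, hNw⟩ := hwn
  have hfin : (Function.support fun l : DynkinWord =>
      l.coeff k • nestedBracket (fun a b => commutatorBr k A a b) (l.letters x y)).Finite := by
    refine (finite_dynkinWord N).subset fun l hl => ?_
    by_contra hlt
    simp only [Set.mem_ofPred_eq, not_lt] at hlt
    rw [← DynkinWord.length_letters x y] at hlt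
    exact hl (by simp [hN l hlt])
  set N' := max 2 (max N (max Nx (max Ny Nw)))
  have hbch : commutatorBr k A θ (bch k (fun a b => commutatorBr k A a b) x y) =
      commutatorBr k A θ Z := by
    rw [hg]
    simp only [← commutatorBr_eq] at hNx hNy hNw ⊢
    rw [← finsum_dynkin (commutatorBr k A) (N := N') (le_max_left _ _)
      (pow_eq_zero_of_le (by simp [N']) hNx) (pow_eq_zero_of_le (by simp [N']) hNy) hxx hyy
      (pow_eq_zero_of_le (by simp [N']) hNw)
      (fun l hl => hN l (le_trans (by simp [N']) hl)), bch, ← LinearMap.toAddMonoidHom_coe,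
      AddMonoidHom.map_finsum _ hfin]
    refine finsum_congr fun l => ?_
    rw [LinearMap.toAddMonoidHom_coe, map_smul, commutatorBr_nestedBracket, smul_smul, mul_comm]
    intro a ha
    rcases DynkinWord.mem_letters ha with rfl | rfl
    exacts [hx, hy]
  have hbR : bch k (fun a b => commutatorBr k A a b) x y ∈ R := by
    refine finsum_induction (· ∈ R) R.zero_mem (fun _ _ => R.add_mem) fun l => ?_
    refine SMulMemClass.smul_mem _ (R.nestedBracket_mem _ fun a ha => ?_)
    rcases DynkinWord.mem_letters ha with rfl | rfl
    exacts [hxR, hyR]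
  have := hθ _ (R.sub_mem hbR hZR) (by rw [map_sub, hbch, sub_self])
  rw [sub_eq_zero.1 this, hexpZ]

/-- A finite multiplicative decreasing filtration of an associative algebra by subspaces. It need
not be exhaustive. -/
structure IsNilFiltration (F : ℕ → Submodule k A) (N : ℕ) : Prop where
  anti : ∀ i j, i ≤ j → F j ≤ F i
  bot : F N = ⊥
  mul_mem : ∀ i j x y, x ∈ F i → y ∈ F j → x * y ∈ F (i + j)

namespace IsNilFiltration

variable {F : ℕ → Submodule k A} {N : ℕ}

lemma isNilpotent (hF : IsNilFiltration F N) {x : A} (hx : x ∈ F 1) : IsNilpotent x := by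
  have h : ∀ n, x ^ (n + 1) ∈ F (n + 1) := by
    intro n
    induction n with
    | zero => simpa
    | succ n ih => rw [pow_succ]; exact hF.mul_mem _ _ _ _ ih hx
  refine ⟨N + 1, ?_⟩
  have := hF.anti N (N + 1) (by omega) (h N)
  rwa [hF.bot] at this

lemma nestedBracket_mem (hF : IsNilFiltration F N) :
    ∀ l : List A, l ≠ [] → (∀ a ∈ l, a ∈ F 1) →
      nestedBracket (fun a b => commutatorBr k A a b) l ∈ F l.length
  | [], h, _ => absurd rfl h
  | [a], _, h => h a (by simp)
  | a :: b :: l, _, h => by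
    have h1 := hF.nestedBracket_mem (b :: l) (by simp) fun c hc => h c (by simp [hc])
    have h2 := h a (by simp)
    have h3 := hF.mul_mem _ _ _ _ h2 h1
    have h4 := hF.mul_mem _ _ _ _ h1 h2
    rw [add_comm] at h3
    exact (F _).sub_mem h3 h4

lemma nestedBracket_eq_zero (hF : IsNilFiltration F N) (l : List A) (h : ∀ a ∈ l, a ∈ F 1)
    (hl : N ≤ l.length) : nestedBracket (fun a b => commutatorBr k A a b) l = 0 := by
  rcases eq_or_ne l [] with rfl | hne
  · rfl
  · have := hF.anti _ _ hl (hF.nestedBracket_mem l hne h)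
    rwa [hF.bot] at this

lemma bch_finite (hF : IsNilFiltration F N) {x y : A} (hx : x ∈ F 1) (hy : y ∈ F 1) :
    (Function.support fun l : DynkinWord =>
      l.coeff k • nestedBracket (fun a b => commutatorBr k A a b) (l.letters x y)).Finite := by
  refine (finite_dynkinWord N).subset fun l hl => ?_
  by_contra hlt
  simp only [Set.mem_ofPred_eq, not_lt] at hlt
  rw [← DynkinWord.length_letters x y] at hlt
  refine hl ?_
  simp only
  rw [hF.nestedBracket_eq_zero _ ?_ hlt, smul_zero]
  intro a ha
  rcases DynkinWord.mem_letters ha with rfl | rfl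
  exacts [hx, hy]

/-- The filtration of `A[X]` by the filtration of the coefficients. -/
def poly (F : ℕ → Submodule k A) (i : ℕ) : Submodule k (Polynomial A) where
  carrier := {p | ∀ n, p.coeff n ∈ F i}
  add_mem' hp hq n := by rw [Polynomial.coeff_add]; exact (F i).add_mem (hp n) (hq n)
  zero_mem' n := by simp
  smul_mem' c p hp n := by rw [Polynomial.coeff_smul]; exact (F i).smul_mem c (hp n)

lemma isNilFiltration_poly (hF : IsNilFiltration F N) : IsNilFiltration (poly F) N where
  anti i j h p hp n := hF.anti i j h (hp n)
  bot := by
    rw [eq_bot_iff]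
    intro p hp
    rw [Submodule.mem_bot]
    ext n
    have := hp n
    rw [hF.bot, Submodule.mem_bot] at this
    rw [this, Polynomial.coeff_zero]
  mul_mem i j p q hp hq n := by
    rw [Polynomial.coeff_mul]
    exact (F (i + j)).sum_mem fun _ _ => hF.mul_mem _ _ _ _ (hp _) (hq _)

lemma X_mul_C_mem_poly {a : A} {i : ℕ} (ha : a ∈ F i) :
    Polynomial.X * Polynomial.C a ∈ poly F i := by
  intro n
  rcases n with _ | n
  · simp
  · rw [Polynomial.coeff_X_mul, Polynomial.coeff_C]
    split_ifs
    exacts [ha, (F i).zero_mem]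

variable (k A) in
/-- The Euler derivation `X d/dX` of `A[X]`. -/
noncomputable def polyEuler : Module.End k (Polynomial A) :=
  LinearMap.mulLeft k Polynomial.X ∘ₗ (Polynomial.derivative (R := A)).restrictScalars k

lemma polyEuler_apply (p : Polynomial A) :
    polyEuler k A p = Polynomial.X * Polynomial.derivative p := rfl

lemma commutatorBr_polyEuler (p : Polynomial A) :
    commutatorBr k _ (polyEuler k A) (LinearMap.mulLeft k p) =
      LinearMap.mulLeft k (polyEuler k A p) := by
  ext q
  simp only [commutatorBr_apply, LinearMap.sub_apply, Module.End.mul_apply, polyEuler_apply,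
    LinearMap.mulLeft_apply, Polynomial.derivative_mul, mul_add, mul_assoc]
  rw [← mul_assoc p, ← Polynomial.X_mul, mul_assoc]
  abel_nf

lemma nilExp_bch_poly (hF : IsNilFiltration F N) {x y : A} (hx : x ∈ F 1) (hy : y ∈ F 1) :
    nilExp k (bch k (fun a b => commutatorBr k (Polynomial A) a b)
        (Polynomial.X * Polynomial.C x) (Polynomial.X * Polynomial.C y)) =
      nilExp k (Polynomial.X * Polynomial.C x) * nilExp k (Polynomial.X * Polynomial.C y) := by
  have hP := hF.isNilFiltration_poly
  have hmem := fun a (ha : a ∈ F 1) => X_mul_C_mem_poly ha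
  set φ : Polynomial A →ₐ[k] Module.End k (Polynomial A) := Algebra.lmul k (Polynomial A) with hφ
  have hφa : ∀ p, φ p = LinearMap.mulLeft k p := fun _ => rfl
  have hφi : Function.Injective φ := fun p q h => by
    simpa [hφa] using LinearMap.congr_fun h (1 : Polynomial A)
  let S : NonUnitalSubalgebra k (Polynomial A) :=
    { carrier := {p | p.coeff 0 = 0 ∧ p ∈ poly F 1}
      add_mem' := fun {p q} hp hq => ⟨by simp [hp.1, hq.1], (poly F 1).add_mem hp.2 hq.2⟩
      zero_mem' := ⟨by simp, (poly F 1).zero_mem⟩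
      mul_mem' := fun {p q} hp hq =>
        ⟨by simp [Polynomial.mul_coeff_zero, hp.1],
          hP.anti 1 2 (by omega) (hP.mul_mem 1 1 _ _ hp.2 hq.2)⟩
      smul_mem' := fun c p hp => ⟨by simp [hp.1], (poly F 1).smul_mem c hp.2⟩ }
  have hS : ∀ a ∈ F 1, Polynomial.X * Polynomial.C a ∈ S := fun a ha =>
    ⟨by simp, hmem a ha⟩
  have hφbr : ∀ a b, φ (commutatorBr k _ a b) = commutatorBr k _ (φ a) (φ b) := fun a b => by
    simp [commutatorBr_apply]
  have hbS : bch k (fun a b => commutatorBr k (Polynomial A) a b)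
      (Polynomial.X * Polynomial.C x) (Polynomial.X * Polynomial.C y) ∈ S := by
    refine finsum_induction (· ∈ S) S.zero_mem (fun _ _ => S.add_mem) fun l => ?_
    refine SMulMemClass.smul_mem _ (S.nestedBracket_mem _ fun a ha => ?_)
    rcases DynkinWord.mem_letters ha with rfl | rfl
    exacts [hS x hx, hS y hy]
  apply hφi
  rw [map_nilExp k φ (hP.isNilpotent hbS.2), map_mul,
    map_nilExp k φ (hP.isNilpotent (hmem x hx)), map_nilExp k φ (hP.isNilpotent (hmem y hy)),
    ← AlgHom.toLinearMap_apply, map_bch _ (fun a b => commutatorBr k _ a b) φ.toLinearMap hφbr _ _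
      (hP.bch_finite (hmem x hx) (hmem y hy))]
  have hE : ∀ a ∈ F 1, commutatorBr k _ (polyEuler k A) (φ (Polynomial.X * Polynomial.C a)) =
      φ (Polynomial.X * Polynomial.C a) := by
    intro a _
    rw [hφa, commutatorBr_polyEuler]
    simp [polyEuler_apply, Polynomial.derivative_mul]
  refine nilExp_bch_of_euler (θ := polyEuler k A) (N := N)
    (S.map (φ : Polynomial A →ₙₐ[k] _)) ?_ ?_ ?_ (hE x hx) (hE y hy) ?_ ?_
  · rintro _ ⟨p, hp, rfl⟩
    exact (hP.isNilpotent hp.2).map φ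
  · exact ⟨_, hS x hx, rfl⟩
  · exact ⟨_, hS y hy, rfl⟩
  · rintro _ ⟨p, hp, rfl⟩ h
    change commutatorBr k _ (polyEuler k A) (φ p) = 0 at h
    rw [hφa, commutatorBr_polyEuler] at h
    have h1 : polyEuler k A p = 0 := by
      simpa using LinearMap.congr_fun h (1 : Polynomial A)
    have hp0 : p = 0 := by
      ext n
      rcases n with _ | n
      · simpa using hp.1
      · have h2 := congrArg (fun q => Polynomial.coeff q (n + 1)) h1
        simp only [polyEuler_apply, Polynomial.coeff_X_mul, Polynomial.coeff_derivative,
          Polynomial.coeff_zero] at h2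
        have h3 : ((n : k) + 1) • p.coeff (n + 1) = 0 := by
          rw [← h2, add_smul, one_smul, mul_add, mul_one, Nat.cast_smul_eq_nsmul, nsmul_eq_mul,
            Nat.cast_comm]
        rw [Polynomial.coeff_zero]
        exact (smul_eq_zero.1 h3).resolve_left (by exact_mod_cast Nat.succ_ne_zero n)
    rw [hp0]
    exact map_zero φ
  · intro l hl
    rw [← DynkinWord.letters_map (fun p => φ.toLinearMap p),
      ← nestedBracket_map (fun a b => commutatorBr k _ a b) (fun a b => commutatorBr k _ a b)
        (fun p => φ.toLinearMap p) (map_zero _) hφbr, hP.nestedBracket_eq_zero, map_zero]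
    · intro a ha
      rcases DynkinWord.mem_letters ha with rfl | rfl
      exacts [hmem x hx, hmem y hy]
    · rwa [DynkinWord.length_letters] at hl ⊢

/-- Dynkin's series computes `log (exp x exp y)` in an associative algebra, for `x` and `y` in the
first step of a finite filtration. -/
theorem nilExp_bch (hF : IsNilFiltration F N) {x y : A} (hx : x ∈ F 1) (hy : y ∈ F 1) :
    nilExp k (bch k (fun a b => commutatorBr k A a b) x y) = nilExp k x * nilExp k y := by
  have hP := hF.isNilFiltration_poly
  have hmem := fun a (ha : a ∈ F 1) => X_mul_C_mem_poly ha
  let ev : Polynomial A →ₐ[k] A :=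
    Polynomial.eval₂AlgHom (AlgHom.id k A) 1 fun a => Commute.one_right a
  have hev : ∀ a, ev (Polynomial.X * Polynomial.C a) = a := fun a => by
    rw [map_mul]
    simp [ev, Polynomial.eval₂AlgHom]
  have hbr : ∀ a b, ev (commutatorBr k _ a b) = commutatorBr k _ (ev a) (ev b) := fun a b => by
    simp [commutatorBr_apply]
  have hb : bch k (fun a b => commutatorBr k (Polynomial A) a b)
      (Polynomial.X * Polynomial.C x) (Polynomial.X * Polynomial.C y) ∈ poly F 1 := by
    refine finsum_induction (· ∈ poly F 1) (Submodule.zero_mem _)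
      (fun _ _ => Submodule.add_mem _) fun l => ?_
    refine Submodule.smul_mem _ _ ?_
    have hne : l.letters (Polynomial.X * Polynomial.C x : Polynomial A)
        (Polynomial.X * Polynomial.C y) ≠ [] := by
      obtain ⟨l, hl, h0⟩ := l
      obtain ⟨p, l', rfl⟩ := List.exists_cons_of_ne_nil hl
      have hp : p ≠ (0, 0) := fun h => h0 (by simp [h])
      have := blockLetters_ne_nil (Polynomial.X * Polynomial.C x : Polynomial A)
        (Polynomial.X * Polynomial.C y) hp
      intro h
      simp only [DynkinWord.letters, List.flatMap_cons, List.append_eq_nil_iff] at h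
      exact this (by simpa [blockLetters] using h.1)
    refine hP.anti 1 _ (List.length_pos_of_ne_nil hne) (hP.nestedBracket_mem _ hne fun a ha => ?_)
    rcases DynkinWord.mem_letters ha with rfl | rfl
    exacts [hmem x hx, hmem y hy]
  have h := congrArg ev (hF.nilExp_bch_poly hx hy)
  rw [map_nilExp k ev (hP.isNilpotent hb), map_mul, map_nilExp k ev (hP.isNilpotent (hmem x hx)),
    map_nilExp k ev (hP.isNilpotent (hmem y hy)), ← AlgHom.toLinearMap_apply,
    map_bch _ (fun a b => commutatorBr k _ a b) ev.toLinearMap hbr _ _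
      (hP.bch_finite (hmem x hx) (hmem y hy))] at h
  rwa [AlgHom.toLinearMap_apply, AlgHom.toLinearMap_apply, hev, hev] at h

end IsNilFiltration

end AssociativeBCH

/-! ### Nilpotent Lie algebras and their nilpotent representations -/

section NilpotentLie

variable {k : Type u} [Field k] [CharZero k] {M : Type v} [AddCommGroup M] [Module k M]

/-- A nilpotent Lie bracket, nilpotence being expressed by a finite multiplicative filtration. -/
structure IsNilpotentLie (br : M →ₗ[k] M →ₗ[k] M) : Prop where
  skew : ∀ x y, br x y = -br y x
  jacobi : ∀ x y z, br x (br y z) = br (br x y) z + br y (br x z)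
  exists_filtration : ∃ (F : ℕ → Submodule k M) (N : ℕ), F 1 = ⊤ ∧ F N = ⊥ ∧
    (∀ i j, i ≤ j → F j ≤ F i) ∧ ∀ i j x y, x ∈ F i → y ∈ F j → br x y ∈ F (i + j)

/-- A representation of a Lie algebra on a finitely filtered space, raising the filtration. -/
structure IsNilRep {V : Type w} [AddCommGroup V] [Module k V] (br : M →ₗ[k] M →ₗ[k] M)
    (α : M →ₗ[k] Module.End k V) : Prop where
  map_br : ∀ a b v, α (br a b) v = α a (α b v) - α b (α a v)
  exists_filtration : ∃ (W : ℕ → Submodule k V) (N : ℕ), W 0 = ⊤ ∧ W N = ⊥ ∧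
    (∀ i j, i ≤ j → W j ≤ W i) ∧ ∀ a i v, v ∈ W i → α a v ∈ W (i + 1)

lemma nilExp_conj {A : Type w} [Ring A] [Algebra k A] {a b : A} (ha : IsNilpotent a)
    (hb : IsNilpotent b) : nilExp k (nilExp k a * b * nilExp k (-a)) =
      nilExp k a * nilExp k b * nilExp k (-a) := by
  obtain ⟨n, hn⟩ := hb
  have h1 : ∀ i, (nilExp k a * b * nilExp k (-a)) ^ i = nilExp k a * b ^ i * nilExp k (-a) :=
    fun i => Units.conj_pow ⟨nilExp k a, nilExp k (-a), nilExp_mul_nilExp_neg k ha,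
      nilExp_neg_mul_nilExp k ha⟩ b i
  have hn' : (nilExp k a * b * nilExp k (-a)) ^ n = 0 := by rw [h1, hn, mul_zero, zero_mul]
  rw [nilExp_eq_sum k hn', nilExp_eq_sum k hn, Finset.mul_sum, Finset.sum_mul]
  refine Finset.sum_congr rfl fun i _ => ?_
  rw [h1, mul_smul_comm, smul_mul_assoc]

lemma nilExp_intertwine {V : Type v} {W : Type w} [AddCommGroup V] [Module k V] [AddCommGroup W]
    [Module k W] (φ : V →ₗ[k] W) {S : Module.End k V} {T : Module.End k W} (hS : IsNilpotent S)
    (hT : IsNilpotent T) (h : ∀ v, φ (S v) = T (φ v)) (v : V) :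
    φ (nilExp k S v) = nilExp k T (φ v) := by
  obtain ⟨m, hm⟩ := hS
  obtain ⟨n, hn⟩ := hT
  rw [nilExp_eq_sum k (pow_eq_zero_of_le (le_max_left m n) hm),
    nilExp_eq_sum k (pow_eq_zero_of_le (le_max_right m n) hn), LinearMap.sum_apply,
    LinearMap.sum_apply, map_sum]
  have hpow : ∀ (i : ℕ) (v : V), φ ((S ^ i) v) = (T ^ i) (φ v) := by
    intro i
    induction i with
    | zero => exact fun v => rfl
    | succ i ih =>
      intro v
      rw [pow_succ, pow_succ, Module.End.mul_apply, Module.End.mul_apply, ih, h]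
  exact Finset.sum_congr rfl fun i _ => by
    rw [LinearMap.smul_apply, LinearMap.smul_apply, map_smul, hpow]

namespace IsNilRep

variable {V : Type w} [AddCommGroup V] [Module k V] {br : M →ₗ[k] M →ₗ[k] M}
  {α : M →ₗ[k] Module.End k V}

lemma isNilpotent (h : IsNilRep br α) (a : M) : IsNilpotent (α a) := by
  obtain ⟨W, N, h0, hN, -, hW⟩ := h.exists_filtration
  refine ⟨N, LinearMap.ext fun v => ?_⟩
  have key : ∀ n, (α a ^ n) v ∈ W n := by
    intro n
    induction n with
    | zero => simp [h0]
    | succ n ih => rw [pow_succ', Module.End.mul_apply]; exact hW a n _ ih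
  have := key N
  rwa [hN, Submodule.mem_bot] at this

/-- The representation on `V × k` that integrates to affine transformations of `V`, attached to a
representation on `V` and a one-cocycle `δ` with values in `V`. -/
def affine (α : M →ₗ[k] Module.End k V) (δ : M →ₗ[k] V) : M →ₗ[k] Module.End k (V × k) :=
  LinearMap.mk₂ k (fun m z => (α m z.1 - z.2 • δ m, (0 : k)))
    (fun a b z => by ext <;> simp [add_sub_add_comm])
    (fun c a z => by ext <;> simp [smul_sub, smul_comm c])
    (fun a z z' => by ext <;> simp [add_smul, add_sub_add_comm])
    (fun c a z => by ext <;> simp [smul_sub, mul_smul])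

@[simp]
lemma affine_apply (α : M →ₗ[k] Module.End k V) (δ : M →ₗ[k] V) (m : M) (z : V × k) :
    affine α δ m z = (α m z.1 - z.2 • δ m, 0) := rfl

lemma isNilRep_affine (h : IsNilRep br α) {δ : M →ₗ[k] V}
    (hδ : ∀ a b, δ (br a b) = α a (δ b) - α b (δ a)) : IsNilRep br (affine α δ) where
  map_br a b z := by
    ext
    · simp only [affine_apply, h.map_br, hδ, map_sub, map_smul, Prod.fst_sub, zero_smul, sub_zero,
        smul_sub]
      abel
    · simp
  exists_filtration := by
    obtain ⟨W, N, h0, hN, hanti, hW⟩ := h.exists_filtration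
    refine ⟨fun i => match i with
      | 0 => ⊤
      | i + 1 => (W i).prod ⊥, N + 1, rfl, by simp [hN], ?_, ?_⟩
    · intro i j hij
      rcases i with _ | i
      · exact le_top
      · rcases j with _ | j
        · omega
        · exact Submodule.prod_mono (hanti i j (by omega)) le_rfl
    · intro a i z hz
      rcases i with _ | i
      · simp [h0]
      · simp only [Submodule.mem_prod, Submodule.mem_bot] at hz ⊢
        simpa [hz.2] using hW a i z.1 hz.1

end IsNilRep

namespace IsNilpotentLie

variable {br : M →ₗ[k] M →ₗ[k] M}

lemma self_eq_zero (h : IsNilpotentLie br) (x : M) : br x x = 0 := by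
  have h1 := h.skew x x
  rw [eq_neg_iff_add_eq_zero, ← two_smul k] at h1
  exact (smul_eq_zero.1 h1).resolve_left two_ne_zero

lemma bch_finite (h : IsNilpotentLie br) (x y : M) :
    (Function.support fun l : DynkinWord =>
      l.coeff k • nestedBracket (fun a b => br a b) (l.letters x y)).Finite := by
  obtain ⟨F, N, h1, hN, hanti, hF⟩ := h.exists_filtration
  exact bch_hasFiniteSupport _ F N h1 hN hanti hF x y

lemma isNilRep_adjoint (h : IsNilpotentLie br) : IsNilRep br br where
  map_br a b v := by rw [h.jacobi a b v, add_sub_cancel_right]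
  exists_filtration := by
    obtain ⟨F, N, h1, hN, hanti, hF⟩ := h.exists_filtration
    refine ⟨fun i => F (i + 1), N, h1, ?_, fun i j hij => hanti _ _ (by omega),
      fun a i v hv => ?_⟩
    · rw [eq_bot_iff, ← hN]
      exact hanti _ _ (by omega)
    · have := hF 1 (i + 1) a v (by simp [h1]) hv
      rwa [add_comm] at this

/-- In a nilpotent representation, the series `bch` computes the product of exponentials. -/
theorem nilExp_rep_bch (h : IsNilpotentLie br) {V : Type w} [AddCommGroup V] [Module k V]
    {α : M →ₗ[k] Module.End k V} (hα : IsNilRep br α) (x y : M) :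
    nilExp k (α (bch k (fun a b => br a b) x y)) = nilExp k (α x) * nilExp k (α y) := by
  obtain ⟨W, N, h0, hN, hanti, hW⟩ := hα.exists_filtration
  let F : ℕ → Submodule k (Module.End k V) := fun i =>
    { carrier := {T | ∀ j, ∀ v ∈ W j, T v ∈ W (j + i)}
      add_mem' := fun hS hT j v hv => (W _).add_mem (hS j v hv) (hT j v hv)
      zero_mem' := fun j v _ => (W _).zero_mem
      smul_mem' := fun c T hT j v hv => (W _).smul_mem c (hT j v hv) }
  have hF : IsNilFiltration F N :=
    { anti := fun i j hij T hT l v hv => hanti _ _ (by omega) (hT l v hv)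
      bot := by
        rw [eq_bot_iff]
        intro T hT
        ext v
        have := hT 0 v (by simp [h0])
        rwa [zero_add, hN, Submodule.mem_bot] at this
      mul_mem := fun i j S T hS hT l v hv => by
        have := hS _ _ (hT l v hv)
        rwa [add_assoc, add_comm j i] at this }
  rw [map_bch _ (fun a b => commutatorBr k _ a b) α (fun a b => LinearMap.ext (hα.map_br a b)) x y
    (h.bch_finite x y)]
  exact hF.nilExp_bch (fun j v hv => hW x j v hv) (fun j v hv => hW y j v hv)

lemma nilExp_rep_bch_nilExp (h : IsNilpotentLie br) {V : Type w} [AddCommGroup V] [Module k V]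
    {α : M →ₗ[k] Module.End k V} (hα : IsNilRep br α) (x y : M) :
    nilExp k (α (bch k (fun a b => br a b) (nilExp k (br x) y) x)) =
      nilExp k (α (bch k (fun a b => br a b) x y)) := by
  have hconj : α (nilExp k (br x) y) = nilExp k (α x) * α y * nilExp k (-α x) := by
    rw [← nilExp_commutatorOp k (hα.isNilpotent _)]
    exact nilExp_intertwine α (h.isNilRep_adjoint.isNilpotent _)
      (isNilpotent_commutatorOp k (hα.isNilpotent _))
      (fun v => show _ = α x * α v - α v * α x from LinearMap.ext (hα.map_br x v)) y
  rw [h.nilExp_rep_bch hα, h.nilExp_rep_bch hα, hconj,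
    nilExp_conj (hα.isNilpotent _) (hα.isNilpotent _), mul_assoc,
    nilExp_neg_mul_nilExp k (hα.isNilpotent _), mul_one]

end IsNilpotentLie

end NilpotentLie

/-! ### The group of a nilpotent Lie algebra -/

section PolyLie

open Polynomial (X)

variable {k : Type u} [Field k] [CharZero k] {M : Type v} [AddCommGroup M] [Module k M]

/-- The bracket of `k[X] ⊗ M`. -/
noncomputable def polyBr (br : M →ₗ[k] M →ₗ[k] M) :
    Polynomial k ⊗[k] M →ₗ[k] Polynomial k ⊗[k] M →ₗ[k] Polynomial k ⊗[k] M :=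
  TensorProduct.map₂ (LinearMap.mul k (Polynomial k)) br

@[simp]
lemma polyBr_tmul (br : M →ₗ[k] M →ₗ[k] M) (p q : Polynomial k) (x y : M) :
    polyBr br (p ⊗ₜ x) (q ⊗ₜ y) = (p * q) ⊗ₜ br x y := rfl

variable (k M) in
/-- The Euler derivation `X d/dX` of `k[X] ⊗ M`. -/
noncomputable def polyLieEuler : Polynomial k ⊗[k] M →ₗ[k] Polynomial k ⊗[k] M :=
  (LinearMap.mulLeft k (X : Polynomial k) ∘ₗ Polynomial.derivative).rTensor M

@[simp]
lemma polyLieEuler_tmul (p : Polynomial k) (x : M) :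
    polyLieEuler k M (p ⊗ₜ x) = (X * Polynomial.derivative p) ⊗ₜ x := rfl

variable (M) in
/-- The evaluation `X = c` from `k[X] ⊗ M` to `M`. -/
noncomputable def polyLieEval (c : k) : Polynomial k ⊗[k] M →ₗ[k] M :=
  TensorProduct.lid k M ∘ₗ (Polynomial.leval c).rTensor M

@[simp]
lemma polyLieEval_tmul (c : k) (p : Polynomial k) (x : M) :
    polyLieEval M c (p ⊗ₜ x) = p.eval c • x := rfl

lemma polyLieEval_polyBr (br : M →ₗ[k] M →ₗ[k] M) (c : k) (z z' : Polynomial k ⊗[k] M) :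
    polyLieEval M c (polyBr br z z') = br (polyLieEval M c z) (polyLieEval M c z') := by
  induction z using TensorProduct.induction_on with
  | zero => simp
  | add x y hx hy => simp only [map_add, LinearMap.add_apply, hx, hy]
  | tmul p x =>
    induction z' using TensorProduct.induction_on with
    | zero => simp
    | add x y hx hy => simp only [map_add, hx, hy]
    | tmul q y =>
      simp only [polyBr_tmul, polyLieEval_tmul, Polynomial.eval_mul, map_smul,
        LinearMap.smul_apply, smul_smul]
      rw [mul_comm]

lemma polyLieEuler_polyBr (br : M →ₗ[k] M →ₗ[k] M) (z z' : Polynomial k ⊗[k] M) :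
    polyLieEuler k M (polyBr br z z') =
      polyBr br (polyLieEuler k M z) z' + polyBr br z (polyLieEuler k M z') := by
  induction z using TensorProduct.induction_on with
  | zero => simp
  | add x y hx hy =>
    simp only [map_add, LinearMap.add_apply, hx, hy]
    abel
  | tmul p x =>
    induction z' using TensorProduct.induction_on with
    | zero => simp
    | add x y hx hy =>
      simp only [map_add, hx, hy]
      abel
    | tmul q y =>
      simp only [polyLieEuler_tmul, polyBr_tmul, Polynomial.derivative_mul, ← TensorProduct.add_tmul]
      congr 1
      ring

/-- An element of `k[X] ⊗ M` is determined by its Euler derivative and its constant term. -/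
lemma eq_zero_of_polyLieEuler_eq_zero {z : Polynomial k ⊗[k] M} (h : polyLieEuler k M z = 0)
    (h0 : polyLieEval M 0 z = 0) : z = 0 := by
  -- `I` divides the coefficient of `X ^ n` by `n`
  let I : Polynomial k →ₗ[k] Polynomial k :=
    (Polynomial.basisMonomials k).constr k fun n => (n : k)⁻¹ • Polynomial.monomial n (1 : k)
  have hI : ∀ n, I (Polynomial.monomial n 1) = (n : k)⁻¹ • Polynomial.monomial n (1 : k) := by
    intro n
    have := (Polynomial.basisMonomials k).constr_basis k
      (fun n => (n : k)⁻¹ • Polynomial.monomial n (1 : k)) n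
    simpa [I] using this
  have key : ∀ p : Polynomial k,
      I (X * Polynomial.derivative p) + Polynomial.C (p.eval 0) = p := by
    intro p
    induction p using Polynomial.induction_on' with
    | add p q hp hq =>
      rw [Polynomial.derivative_add, mul_add, map_add, Polynomial.eval_add, Polynomial.C_add]
      conv_rhs => rw [← hp, ← hq]
      abel
    | monomial n a =>
      rcases n with _ | n
      · simp
      · have h1 : X * Polynomial.derivative (Polynomial.monomial (n + 1) a) =
            (a * ((n : k) + 1)) • Polynomial.monomial (n + 1) (1 : k) := by
          rw [Polynomial.derivative_monomial, Nat.add_sub_cancel, Polynomial.X_mul_monomial,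
            Polynomial.smul_monomial]
          simp
        have hn : ((n : k) + 1) ≠ 0 := by exact_mod_cast Nat.succ_ne_zero n
        rw [h1, map_smul, hI, smul_smul, Polynomial.smul_monomial]
        simp [hn]
  have hz : ∀ z : Polynomial k ⊗[k] M,
      I.rTensor M (polyLieEuler k M z) + (1 : Polynomial k) ⊗ₜ polyLieEval M 0 z = z := by
    intro z
    induction z using TensorProduct.induction_on with
    | zero => simp
    | add x y hx hy =>
      rw [map_add, map_add, map_add, TensorProduct.tmul_add]
      conv_rhs => rw [← hx, ← hy]
      abel
    | tmul p x =>
      rw [polyLieEuler_tmul, LinearMap.rTensor_tmul, polyLieEval_tmul, ← TensorProduct.smul_tmul,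
        ← TensorProduct.add_tmul]
      congr 1
      conv_rhs => rw [← key p]
      rw [Polynomial.smul_eq_C_mul, mul_one]
  rw [← hz z, h, h0, map_zero, TensorProduct.tmul_zero, add_zero]

namespace IsNilpotentLie

variable {br : M →ₗ[k] M →ₗ[k] M}

lemma isNilpotentLie_polyBr (h : IsNilpotentLie br) : IsNilpotentLie (polyBr br) where
  skew z z' := by
    induction z using TensorProduct.induction_on with
    | zero => simp
    | add x y hx hy =>
      simp only [map_add, LinearMap.add_apply, hx, hy]
      abel
    | tmul p x =>
      induction z' using TensorProduct.induction_on with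
      | zero => simp
      | add x y hx hy =>
        simp only [map_add, LinearMap.add_apply, hx, hy]
        abel
      | tmul q y => rw [polyBr_tmul, polyBr_tmul, h.skew, TensorProduct.tmul_neg, mul_comm]
  jacobi a b c := by
    induction a using TensorProduct.induction_on with
    | zero => simp
    | add x y hx hy =>
      simp only [map_add, LinearMap.add_apply, hx, hy]
      abel
    | tmul p x =>
      induction b using TensorProduct.induction_on with
      | zero => simp
      | add x y hx hy =>
        simp only [map_add, LinearMap.add_apply, hx, hy]
        abel
      | tmul q y =>
        induction c using TensorProduct.induction_on with
        | zero => simp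
        | add x y hx hy =>
          simp only [map_add, hx, hy]
          abel
        | tmul r z =>
          simp only [polyBr_tmul]
          rw [h.jacobi, TensorProduct.tmul_add, mul_assoc, mul_left_comm q]
  exists_filtration := by
    obtain ⟨F, N, h1, hN, hanti, hF⟩ := h.exists_filtration
    refine ⟨fun i => Submodule.span k {z | ∃ (p : Polynomial k) (x : M), x ∈ F i ∧ p ⊗ₜ x = z}, N,
      ?_, ?_, fun i j hij => Submodule.span_mono ?_, fun i j x y hx hy => ?_⟩
    · rw [eq_top_iff, ← TensorProduct.span_tmul_eq_top]
      apply Submodule.span_mono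
      rintro _ ⟨p, x, rfl⟩
      exact ⟨p, x, by simp [h1], rfl⟩
    · rw [Submodule.span_eq_bot]
      rintro _ ⟨p, x, hx, rfl⟩
      rw [hN, Submodule.mem_bot] at hx
      rw [hx, TensorProduct.tmul_zero]
    · rintro _ ⟨p, x, hx, rfl⟩
      exact ⟨p, x, hanti i j hij hx, rfl⟩
    · refine Submodule.map₂_le.1 ?_ x hx y hy
      rw [Submodule.map₂_span_span, Submodule.span_le]
      rintro _ ⟨_, ⟨p, x, hx, rfl⟩, _, ⟨q, y, hy, rfl⟩, rfl⟩
      exact Submodule.subset_span ⟨p * q, br x y, hF i j x y hx hy, rfl⟩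

/-- The affine representation of `k[X] ⊗ M` on itself, with the Euler derivation as cocycle. Its
kernel consists of the constant polynomials. -/
lemma isNilRep_polyEuler (h : IsNilpotentLie br) :
    IsNilRep (polyBr br) (IsNilRep.affine (polyBr br) (polyLieEuler k M)) :=
  h.isNilpotentLie_polyBr.isNilRep_adjoint.isNilRep_affine fun a b => by
    rw [polyLieEuler_polyBr, h.isNilpotentLie_polyBr.skew (polyLieEuler k M a) b]
    abel

lemma polyLieEval_bch (h : IsNilpotentLie br) (c : k) (p q : Polynomial k ⊗[k] M) :
    polyLieEval M c (bch k (fun a b => polyBr br a b) p q) =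
      bch k (fun a b => br a b) (polyLieEval M c p) (polyLieEval M c q) :=
  map_bch _ _ _ (polyLieEval_polyBr br c) p q (h.isNilpotentLie_polyBr.bch_finite p q)

lemma polyLieEval_nilExp (h : IsNilpotentLie br) (c : k) (p q : Polynomial k ⊗[k] M) :
    polyLieEval M c (nilExp k (polyBr br p) q) =
      nilExp k (br (polyLieEval M c p)) (polyLieEval M c q) :=
  nilExp_intertwine (polyLieEval M c) (h.isNilpotentLie_polyBr.isNilRep_adjoint.isNilpotent p)
    (h.isNilRep_adjoint.isNilpotent _) (fun v => polyLieEval_polyBr br c p v) q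

/-- To prove an identity in the group of `M` it is enough to prove it for polynomials without
constant term and after exponentiation in the affine representation. -/
lemma eq_of_polyEuler (h : IsNilpotentLie br) {p q : Polynomial k ⊗[k] M}
    (hp : polyLieEval M 0 p = 0) (hq : polyLieEval M 0 q = 0)
    (hpq : nilExp k (IsNilRep.affine (polyBr br) (polyLieEuler k M) p) =
      nilExp k (IsNilRep.affine (polyBr br) (polyLieEuler k M) q)) :
    polyLieEval M 1 p = polyLieEval M 1 q := by
  have h1 := nilExp_injective k (h.isNilRep_polyEuler.isNilpotent p)
    (h.isNilRep_polyEuler.isNilpotent q) hpq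
  have h2 := congrArg Prod.fst (LinearMap.congr_fun h1 ((0 : Polynomial k ⊗[k] M), (1 : k)))
  simp only [IsNilRep.affine_apply, map_zero, one_smul, zero_sub, neg_inj] at h2
  have h3 := eq_zero_of_polyLieEuler_eq_zero (z := p - q) (by rw [map_sub, h2, sub_self])
    (by rw [map_sub, hp, hq, sub_self])
  rw [sub_eq_zero.1 h3]

lemma bch_zero_zero (h : IsNilpotentLie br) : bch k (fun a b => br a b) 0 0 = (0 : M) :=
  (map_bch (fun a b => br a b) (fun a b => br a b) (0 : M →ₗ[k] M) (fun a b => by simp) 0 0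
    (h.bch_finite 0 0)).symm

lemma bch_assoc (h : IsNilpotentLie br) (x y z : M) :
    bch k (fun a b => br a b) (bch k (fun a b => br a b) x y) z =
      bch k (fun a b => br a b) x (bch k (fun a b => br a b) y z) := by
  have hP := h.isNilpotentLie_polyBr
  have key := h.eq_of_polyEuler
    (p := bch k (fun a b => polyBr br a b) (bch k (fun a b => polyBr br a b) (X ⊗ₜ x) (X ⊗ₜ y))
      (X ⊗ₜ z))
    (q := bch k (fun a b => polyBr br a b) (X ⊗ₜ x) (bch k (fun a b => polyBr br a b) (X ⊗ₜ y)
      (X ⊗ₜ z)))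
    (by simp [h.polyLieEval_bch, h.bch_zero_zero]) (by simp [h.polyLieEval_bch, h.bch_zero_zero])
    (by simp only [hP.nilExp_rep_bch h.isNilRep_polyEuler, mul_assoc])
  simpa [h.polyLieEval_bch] using key

lemma zero_bch (h : IsNilpotentLie br) (x : M) : bch k (fun a b => br a b) 0 x = x := by
  have hP := h.isNilpotentLie_polyBr
  have key := h.eq_of_polyEuler (p := bch k (fun a b => polyBr br a b) 0 (X ⊗ₜ x)) (q := X ⊗ₜ x)
    (by simp [h.polyLieEval_bch, h.bch_zero_zero]) (by simp)
    (by rw [hP.nilExp_rep_bch h.isNilRep_polyEuler, map_zero, nilExp_zero, one_mul])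
  simpa [h.polyLieEval_bch] using key

/-- The group of a nilpotent Lie algebra multiplies commuting elements by adding them. -/
lemma bch_of_commute (h : IsNilpotentLie br) {x y : M} (hxy : br x y = 0) :
    bch k (fun a b => br a b) x y = x + y := by
  have hP := h.isNilpotentLie_polyBr
  have hR := h.isNilRep_polyEuler
  have hc : Commute (IsNilRep.affine (polyBr br) (polyLieEuler k M) (X ⊗ₜ x))
      (IsNilRep.affine (polyBr br) (polyLieEuler k M) (X ⊗ₜ y)) := by
    refine LinearMap.ext fun v => ?_
    have := hR.map_br (X ⊗ₜ x) (X ⊗ₜ y) v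
    rw [polyBr_tmul, hxy, TensorProduct.tmul_zero, map_zero, LinearMap.zero_apply] at this
    exact (sub_eq_zero.1 this.symm)
  have key := h.eq_of_polyEuler (p := bch k (fun a b => polyBr br a b) (X ⊗ₜ x) (X ⊗ₜ y))
    (q := X ⊗ₜ x + X ⊗ₜ y)
    (by simp [h.polyLieEval_bch, h.bch_zero_zero]) (by simp)
    (by rw [hP.nilExp_rep_bch hR, map_add, nilExp_add_of_commute k hc (hR.isNilpotent _)
      (hR.isNilpotent _)])
  simpa [h.polyLieEval_bch] using key

lemma neg_bch_self (h : IsNilpotentLie br) (x : M) : bch k (fun a b => br a b) (-x) x = 0 := by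
  rw [h.bch_of_commute (by rw [map_neg, LinearMap.neg_apply, h.self_eq_zero, neg_zero]),
    neg_add_cancel]

/-- Conjugation in the group of a nilpotent Lie algebra is the exponential of the adjoint
action. -/
lemma bch_nilExp_adjoint (h : IsNilpotentLie br) (x y : M) :
    bch k (fun a b => br a b) (nilExp k (br x) y) x = bch k (fun a b => br a b) x y := by
  have hP := h.isNilpotentLie_polyBr
  have key := h.eq_of_polyEuler
    (p := bch k (fun a b => polyBr br a b) (nilExp k (polyBr br (X ⊗ₜ x)) (X ⊗ₜ y)) (X ⊗ₜ x))
    (q := bch k (fun a b => polyBr br a b) (X ⊗ₜ x) (X ⊗ₜ y))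
    (by simp [h.polyLieEval_bch, h.polyLieEval_nilExp, h.bch_zero_zero])
    (by simp [h.polyLieEval_bch, h.bch_zero_zero])
    (hP.nilExp_rep_bch_nilExp h.isNilRep_polyEuler _ _)
  simpa [h.polyLieEval_bch, h.polyLieEval_nilExp] using key

end IsNilpotentLie

end PolyLie

/-! ### The group of a nilpotent DGLA and its adjoint action -/

/-- Exponentials of operators that act as derivations of a bilinear map act as automorphisms. -/
lemma nilExp_bilinear {k : Type u} [Field k] [CharZero k] {V : Type*} {V' : Type*}
    {V'' : Type*} [AddCommGroup V]
    [Module k V] [AddCommGroup V'] [Module k V'] [AddCommGroup V''] [Module k V'']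
    (B : V →ₗ[k] V' →ₗ[k] V'') {S : Module.End k V} {S' : Module.End k V'} {S'' : Module.End k V''}
    (hS : IsNilpotent S) (hS' : IsNilpotent S') (hS'' : IsNilpotent S'')
    (h : ∀ v v', S'' (B v v') = B (S v) v' + B v (S' v')) (v : V) (v' : V') :
    nilExp k S'' (B v v') = B (nilExp k S v) (nilExp k S' v') := by
  have hr (T : Module.End k V) (x : V) (y : V') :
      Module.End.rTensorAlgHom k V V' T (x ⊗ₜ y) = T x ⊗ₜ y := rfl
  have hl (T : Module.End k V') (x : V) (y : V') :
      Module.End.lTensorAlgHom k V' V T (x ⊗ₜ y) = x ⊗ₜ T y := rfl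
  have h1 := hS.map (Module.End.rTensorAlgHom k V V')
  have h2 := hS'.map (Module.End.lTensorAlgHom k V' V)
  have hc : Commute (Module.End.rTensorAlgHom k V V' S) (Module.End.lTensorAlgHom k V' V S') :=
    TensorProduct.ext' fun x y => by
      rw [Module.End.mul_apply, Module.End.mul_apply, hr, hl, hl, hr]
  have key := nilExp_intertwine (TensorProduct.lift B) (hc.isNilpotent_add h1 h2) hS''
    (fun z => by
      induction z using TensorProduct.induction_on with
      | zero => simp
      | add x y hx hy => rw [map_add, map_add, hx, hy, map_add, map_add]
      | tmul x y => rw [LinearMap.add_apply, hr, hl, map_add, TensorProduct.lift.tmul,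
          TensorProduct.lift.tmul, TensorProduct.lift.tmul, h]) (v ⊗ₜ v')
  rw [nilExp_add_of_commute k hc h1 h2, ← map_nilExp k _ hS, ← map_nilExp k _ hS',
    Module.End.mul_apply, hl, hr, TensorProduct.lift.tmul, TensorProduct.lift.tmul] at key
  exact key.symm

namespace DGLA

variable {k : Type u} [Field k] [CharZero k] (g : DGLA.{u, v} k) [hg : g.IsNilp]

lemma isNilpotentLie_bracket : IsNilpotentLie (g.bracket 0 0 0 rfl) where
  skew x y := by simpa using g.skew 0 0 0 rfl rfl x y
  jacobi x y z := by simpa using g.jacobi 0 0 0 0 0 0 0 rfl rfl rfl rfl rfl rfl x y z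
  exists_filtration := by
    obtain ⟨F, N, h1, hN, hanti, -, hbr⟩ := hg.exists_filtration
    exact ⟨fun i => F i 0, N, h1 0, hN 0, fun i j => hanti i j 0,
      fun i j x y => hbr i j 0 0 0 rfl x y⟩

lemma isNilRep_bracket (p : ℤ) :
    IsNilRep (g.bracket 0 0 0 rfl) (g.bracket 0 p p (zero_add p)) where
  map_br a b v := by
    have := g.jacobi 0 0 p 0 p p p rfl (zero_add p) (zero_add p) (zero_add p) (zero_add p)
      (zero_add p) a b v
    rw [this]
    simp
  exists_filtration := by
    obtain ⟨F, N, h1, hN, hanti, -, hbr⟩ := hg.exists_filtration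
    refine ⟨fun i => F (i + 1) p, N, h1 p, ?_, fun i j hij => hanti _ _ _ (by omega),
      fun a i v hv => ?_⟩
    · rw [eq_bot_iff, ← hN p]
      exact hanti _ _ _ (by omega)
    · have := hbr 1 (i + 1) 0 p p (zero_add p) a v (by simp [h1]) hv
      rwa [add_comm] at this

lemma isNilpotent_ad {p : ℤ} (X : g.V 0) : IsNilpotent (g.ad (p := p) X) :=
  (g.isNilRep_bracket p).isNilpotent X

lemma expAd_eq {p : ℤ} (X : g.V 0) (v : g.V p) : g.expAd X v = nilExp k (g.ad X) v := by
  obtain ⟨N, hN⟩ := g.isNilpotent_ad (p := p) X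
  rw [nilExp_eq_sum k hN, LinearMap.sum_apply, expAd]
  refine finsum_eq_sum_of_support_subset _ fun n hn => ?_
  simp only [Finset.coe_range, Set.mem_Iio]
  by_contra hlt
  exact hn (by simp [pow_eq_zero_of_le (not_lt.1 hlt) hN])

lemma expAd_add {p : ℤ} (X : g.V 0) (v w : g.V p) :
    g.expAd X (v + w) = g.expAd X v + g.expAd X w := by
  simp only [expAd_eq, map_add]

lemma expAd_neg {p : ℤ} (X : g.V 0) (v : g.V p) : g.expAd X (-v) = -g.expAd X v := by
  simp only [expAd_eq, map_neg]

lemma zero_expAd {p : ℤ} (v : g.V p) : g.expAd 0 v = v := by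
  have : g.ad (p := p) 0 = 0 := map_zero _
  rw [expAd_eq, this, nilExp_zero, Module.End.one_apply]

lemma mul_expAd {p : ℤ} (X Y : g.V 0) (v : g.V p) :
    g.expAd (g.mul X Y) v = g.expAd X (g.expAd Y v) := by
  simp only [expAd_eq]
  exact LinearMap.congr_fun (g.isNilpotentLie_bracket.nilExp_rep_bch (g.isNilRep_bracket p) X Y) v

protected lemma mul_assoc (X Y Z : g.V 0) : g.mul (g.mul X Y) Z = g.mul X (g.mul Y Z) :=
  g.isNilpotentLie_bracket.bch_assoc X Y Z

protected lemma zero_mul (X : g.V 0) : g.mul 0 X = X := g.isNilpotentLie_bracket.zero_bch X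

lemma mul_of_commute {X Y : g.V 0} (h : g.bracket 0 0 0 rfl X Y = 0) : g.mul X Y = X + Y :=
  g.isNilpotentLie_bracket.bch_of_commute h

protected lemma mul_zero (X : g.V 0) : g.mul X 0 = X := by
  rw [g.mul_of_commute (map_zero _), add_zero]

lemma neg_mul_self (X : g.V 0) : g.mul (-X) X = 0 := g.isNilpotentLie_bracket.neg_bch_self X

lemma mul_neg_self (X : g.V 0) : g.mul X (-X) = 0 := by
  simpa using g.neg_mul_self (-X)

lemma neg_mul_cancel_left (X Y : g.V 0) : g.mul (-X) (g.mul X Y) = Y := by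
  rw [← g.mul_assoc, neg_mul_self, g.zero_mul]

lemma neg_expAd_expAd {p : ℤ} (X : g.V 0) (v : g.V p) : g.expAd (-X) (g.expAd X v) = v := by
  rw [← mul_expAd, neg_mul_self, zero_expAd]

/-- `exp (ad X)` is conjugation by `exp X`. -/
lemma expAd_mul_self (X Y : g.V 0) : g.mul (g.expAd X Y) X = g.mul X Y := by
  rw [expAd_eq]
  exact g.isNilpotentLie_bracket.bch_nilExp_adjoint X Y

lemma ad_bracket {p q r : ℤ} (h : p + q = r) (X : g.V 0) (a : g.V p) (b : g.V q) :
    g.ad X (g.bracket p q r h a b) = g.bracket p q r h (g.ad X a) b +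
      g.bracket p q r h a (g.ad X b) := by
  have := g.jacobi 0 p q p r q r (zero_add p) h (zero_add q) (zero_add r) h h X a b
  simpa [ad] using this

lemma expAd_bracket {p q r : ℤ} (h : p + q = r) (X : g.V 0) (a : g.V p) (b : g.V q) :
    g.expAd X (g.bracket p q r h a b) = g.bracket p q r h (g.expAd X a) (g.expAd X b) := by
  simp only [expAd_eq]
  exact nilExp_bilinear _ (g.isNilpotent_ad X) (g.isNilpotent_ad X) (g.isNilpotent_ad X)
    (g.ad_bracket h X) a b

/-! ### The gauge action -/

lemma d_bracket_zero (a b : g.V 0) : g.d 0 1 rfl (g.bracket 0 0 0 rfl a b) =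
    g.bracket 0 1 1 (zero_add 1) a (g.d 0 1 rfl b) -
      g.bracket 0 1 1 (zero_add 1) b (g.d 0 1 rfl a) := by
  rw [g.leibniz 0 0 0 1 1 1 rfl rfl rfl rfl rfl rfl a b, g.skew 1 0 1 rfl rfl _ b]
  simp only [Int.negOnePow_zero, one_smul, mul_zero]
  abel

/-- The infinitesimal gauge action, on pairs `(v, c)` standing for `v + c d`. -/
def gaugeRep : g.V 0 →ₗ[k] Module.End k (g.V 1 × k) :=
  IsNilRep.affine (g.bracket 0 1 1 (zero_add 1)) (g.d 0 1 rfl)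

lemma gaugeRep_apply (X : g.V 0) (z : g.V 1 × k) :
    g.gaugeRep X z = (g.ad X z.1 - z.2 • g.d 0 1 rfl X, 0) := rfl

lemma isNilRep_gaugeRep : IsNilRep (g.bracket 0 0 0 rfl) g.gaugeRep :=
  (g.isNilRep_bracket 1).isNilRep_affine g.d_bracket_zero

lemma nilExp_gaugeRep (X : g.V 0) (lam : g.V 1) :
    nilExp k (g.gaugeRep X) (lam, 1) = (g.gaugeAct X lam, 1) := by
  obtain ⟨N₁, hN₁⟩ := g.isNilpotent_ad (p := 1) X
  obtain ⟨N₂, hN₂⟩ := g.isNilRep_gaugeRep.isNilpotent X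
  set N := max N₁ N₂
  have h1 : g.ad (p := 1) X ^ N = 0 := pow_eq_zero_of_le (le_max_left _ _) hN₁
  have h2 : g.gaugeRep X ^ (N + 1) = 0 :=
    pow_eq_zero_of_le ((le_max_right N₁ N₂).trans (Nat.le_succ _)) hN₂
  have h1' : g.ad (p := 1) X ^ (N + 1) = 0 := pow_eq_zero_of_le (Nat.le_succ _) h1
  have hpow : ∀ n, (g.gaugeRep X ^ (n + 1)) (lam, 1) =
      ((g.ad X ^ (n + 1)) lam - (g.ad X ^ n) (g.d 0 1 rfl X), 0) := by
    intro n
    induction n with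
    | zero => simp [gaugeRep_apply]
    | succ n ih =>
      rw [pow_succ', Module.End.mul_apply, ih, gaugeRep_apply]
      simp only [map_sub, zero_smul, sub_zero]
      rw [pow_succ' _ (n + 1), pow_succ' _ n]
      rfl
  have hfin : ∑ᶠ n : ℕ, ((n + 1).factorial : k)⁻¹ • ((g.ad X) ^ n) (g.d 0 1 rfl X) =
      ∑ n ∈ Finset.range N, ((n + 1).factorial : k)⁻¹ • ((g.ad X) ^ n) (g.d 0 1 rfl X) := by
    refine finsum_eq_sum_of_support_subset _ fun n hn => ?_
    simp only [Finset.coe_range, Set.mem_Iio]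
    by_contra hlt
    exact hn (by simp [pow_eq_zero_of_le (not_lt.1 hlt) h1])
  rw [nilExp_eq_sum k h2, LinearMap.sum_apply, Finset.sum_range_succ', gaugeAct, expAd_eq,
    nilExp_eq_sum k h1', LinearMap.sum_apply, Finset.sum_range_succ', hfin]
  simp only [LinearMap.smul_apply, hpow]
  ext
  · simp only [Prod.fst_add, Prod.fst_sum, Prod.smul_fst, smul_sub, Finset.sum_sub_distrib]
    simp
    abel
  · simp [Prod.snd_sum]

lemma mul_gaugeAct (X Y : g.V 0) (lam : g.V 1) :
    g.gaugeAct (g.mul X Y) lam = g.gaugeAct X (g.gaugeAct Y lam) := by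
  have h := LinearMap.congr_fun
    (g.isNilpotentLie_bracket.nilExp_rep_bch g.isNilRep_gaugeRep X Y) (lam, 1)
  rw [Module.End.mul_apply, nilExp_gaugeRep g Y, nilExp_gaugeRep g X] at h
  exact congrArg Prod.fst ((g.nilExp_gaugeRep (g.mul X Y) lam).symm.trans h)

lemma gaugeAct_of_fixed {X : g.V 0} {lam : g.V 1}
    (h : g.ad X (g.ad X lam - g.d 0 1 rfl X) = 0) :
    g.gaugeAct X lam = lam + (g.ad X lam - g.d 0 1 rfl X) := by
  have h1 := nilExp_apply_of_apply_apply_eq_zero k (g.isNilRep_gaugeRep.isNilpotent X)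
    (m := (lam, 1)) (by simp [gaugeRep_apply, h])
  rw [nilExp_gaugeRep] at h1
  simpa [gaugeRep_apply] using congrArg Prod.fst h1

lemma zero_gaugeAct (lam : g.V 1) : g.gaugeAct 0 lam = lam := by
  have h0 : g.ad (p := 1) 0 = 0 := map_zero _
  rw [g.gaugeAct_of_fixed (by simp [h0])]
  simp [h0]

lemma gaugeAct_add (X : g.V 0) (lam v : g.V 1) :
    g.gaugeAct X (lam + v) = g.gaugeAct X lam + g.expAd X v := by
  rw [gaugeAct, gaugeAct, expAd_add]
  abel

/-- The curvature `d λ + ½ [λ, λ]`. -/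
def curv (lam : g.V 1) : g.V 2 := g.d 1 2 rfl lam + (2 : k)⁻¹ • g.bracket 1 1 2 rfl lam lam

lemma ad_d {p q : ℤ} (h : p + 1 = q) (X : g.V 0) (v : g.V p) :
    g.ad X (g.d p q h v) = g.d p q h (g.ad X v) -
      g.bracket 1 p q (by omega) (g.d 0 1 rfl X) v := by
  have := g.leibniz 0 p p 1 q q (zero_add p) rfl h h (by omega) (zero_add q) X v
  simp only [ad, this, Int.negOnePow_zero, one_smul]
  abel

/-- The bracket of `v + c d` and `w`, for `w` of degree `p`. -/
def gaugeBr (p q : ℤ) (h : p + 1 = q) : (g.V 1 × k) →ₗ[k] g.V p →ₗ[k] g.V q :=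
  (g.bracket 1 p q (by omega)) ∘ₗ LinearMap.fst k _ _ +
    (LinearMap.lsmul k _).flip (g.d p q h) ∘ₗ LinearMap.snd k _ _

lemma gaugeBr_apply (p q : ℤ) (h : p + 1 = q) (z : g.V 1 × k) (w : g.V p) :
    g.gaugeBr p q h z w = g.bracket 1 p q (by omega) z.1 w + z.2 • g.d p q h w := rfl

lemma expAd_gaugeBr (p q : ℤ) (h : p + 1 = q) (X : g.V 0) (lam : g.V 1) (w : g.V p) :
    g.expAd X (g.gaugeBr p q h (lam, 1) w) =
      g.gaugeBr p q h (g.gaugeAct X lam, 1) (g.expAd X w) := by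
  rw [← nilExp_gaugeRep, expAd_eq, expAd_eq]
  refine nilExp_bilinear _ (g.isNilRep_gaugeRep.isNilpotent X) (g.isNilpotent_ad X)
    (g.isNilpotent_ad X) (fun z v => ?_) _ _
  simp only [gaugeBr_apply, gaugeRep_apply, map_add, map_smul, map_sub, LinearMap.sub_apply,
    LinearMap.smul_apply, zero_smul, add_zero, ad_bracket, ad_d, smul_sub]
  abel

/-- The bracket of `v + c d` and `v' + c' d`. -/
def curvBr : (g.V 1 × k) →ₗ[k] (g.V 1 × k) →ₗ[k] g.V 2 :=
  (g.gaugeBr 1 2 rfl).compl₂ (LinearMap.fst k _ _) +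
    (LinearMap.lsmul k (g.V 2)).flip.compl₁₂ (g.d 1 2 rfl ∘ₗ LinearMap.fst k (g.V 1) k)
      (LinearMap.snd k (g.V 1) k)

lemma curvBr_apply (z z' : g.V 1 × k) : g.curvBr z z' =
    g.bracket 1 1 2 rfl z.1 z'.1 + z.2 • g.d 1 2 rfl z'.1 + z'.2 • g.d 1 2 rfl z.1 := rfl

lemma curvBr_self (lam : g.V 1) : g.curvBr (lam, 1) (lam, 1) = (2 : k) • g.curv lam := by
  rw [curvBr_apply, curv, smul_add, smul_smul, mul_inv_cancel₀ two_ne_zero]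
  simp only [one_smul, two_smul]
  abel

/-- The curvature is equivariant for the gauge action. -/
lemma curv_gaugeAct (X : g.V 0) (lam : g.V 1) :
    g.curv (g.gaugeAct X lam) = g.expAd X (g.curv lam) := by
  have hder : ∀ z z', g.ad X (g.curvBr z z') =
      g.curvBr (g.gaugeRep X z) z' + g.curvBr z (g.gaugeRep X z') := by
    intro z z'
    have hs := g.skew 1 1 2 rfl rfl (g.d 0 1 rfl X) z.1
    simp only [mul_one, Int.negOnePow_one, Units.neg_smul, one_smul, neg_neg] at hs
    simp only [curvBr_apply, gaugeRep_apply, map_add, map_smul, map_sub, LinearMap.sub_apply,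
      LinearMap.smul_apply, zero_smul, add_zero, ad_bracket, ad_d, smul_sub, g.d_d, smul_zero,
      sub_zero, hs]
    abel
  have h := nilExp_bilinear g.curvBr (g.isNilRep_gaugeRep.isNilpotent X)
    (g.isNilRep_gaugeRep.isNilpotent X) (g.isNilpotent_ad X) hder (lam, 1) (lam, 1)
  rw [nilExp_gaugeRep, curvBr_self, curvBr_self, map_smul, ← expAd_eq] at h
  exact (smul_right_injective _ (two_ne_zero (α := k)) h).symm

/-- The Bianchi identity. -/
lemma d_curv (lam : g.V 1) :
    g.d 2 3 rfl (g.curv lam) = g.bracket 2 1 3 rfl (g.curv lam) lam := by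
  have h1 := g.leibniz 1 1 2 2 2 3 rfl rfl rfl rfl rfl rfl lam lam
  have h2 := g.jacobi 1 1 1 2 2 2 3 rfl rfl rfl rfl rfl rfl lam lam lam
  have h3 := g.skew 2 1 3 rfl rfl (g.bracket 1 1 2 rfl lam lam) lam
  have h4 := g.skew 1 2 3 rfl rfl lam (g.d 1 2 rfl lam)
  have hn : Int.negOnePow (1 * 2) = 1 := rfl
  have hn' : Int.negOnePow 2 = 1 := rfl
  simp only [mul_one, Int.negOnePow_one, Units.neg_smul, one_smul, hn, hn'] at h1 h2 h3 h4
  have h5 : g.bracket 2 1 3 rfl (g.bracket 1 1 2 rfl lam lam) lam = 0 := by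
    rw [h3] at h2
    have : (3 : k) • g.bracket 1 2 3 rfl lam (g.bracket 1 1 2 rfl lam lam) = 0 := by
      have h6 : (3 : k) • g.bracket 1 2 3 rfl lam (g.bracket 1 1 2 rfl lam lam) =
          g.bracket 1 2 3 rfl lam (g.bracket 1 1 2 rfl lam lam) +
          (g.bracket 1 2 3 rfl lam (g.bracket 1 1 2 rfl lam lam) +
          g.bracket 1 2 3 rfl lam (g.bracket 1 1 2 rfl lam lam)) := by
        rw [show (3 : k) = 1 + (1 + 1) by norm_num, add_smul, add_smul, one_smul]
      rw [h6]
      nth_rewrite 1 [h2]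
      abel
    rw [h3, (smul_eq_zero.1 this).resolve_left three_ne_zero, neg_zero]
  rw [curv, map_add, map_smul, g.d_d, h1, h4, map_add, map_smul, LinearMap.add_apply,
    LinearMap.smul_apply, h5, smul_zero, add_zero, zero_add, neg_neg, ← two_smul k, smul_smul,
    inv_mul_cancel₀ two_ne_zero, one_smul]

end DGLA

namespace DGLA

variable {k : Type u} [Field k] [CharZero k] (g : DGLA.{u, v} k)

/-! ### Central elements -/

/-- An element of a DGLA is central if its brackets with all elements vanish. -/
def IsCentral {p : ℤ} (z : g.V p) : Prop :=
  ∀ (q r : ℤ) (h : p + q = r) (x : g.V q), g.bracket p q r h z x = 0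

variable {g}

lemma isCentral_zero {p : ℤ} : g.IsCentral (0 : g.V p) := fun q r h x => by
  rw [map_zero, LinearMap.zero_apply]

lemma IsCentral.neg {p : ℤ} {z : g.V p} (hz : g.IsCentral z) : g.IsCentral (-z) :=
  fun q r h x => by rw [map_neg, LinearMap.neg_apply, hz q r h x, neg_zero]

lemma IsCentral.bracket_left {p q r : ℤ} {z : g.V p} (hz : g.IsCentral z) (h : p + q = r)
    (x : g.V q) : g.bracket p q r h z x = 0 := hz q r h x

lemma IsCentral.bracket_right {p q r : ℤ} {z : g.V p} (hz : g.IsCentral z) (h : q + p = r)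
    (x : g.V q) : g.bracket q p r h x z = 0 := by
  rw [g.skew q p r h (by omega), hz q r _ x, smul_zero, neg_zero]

lemma IsCentral.d {p q : ℤ} {z : g.V p} (hz : g.IsCentral z) (h : p + 1 = q) :
    g.IsCentral (g.d p q h z) := fun q' r h' x => by
  have := g.leibniz p q' (p + q') q (q' + 1) r rfl h rfl (by omega) h' (by omega) z x
  rw [hz, hz, map_zero, smul_zero, add_zero] at this
  exact this.symm

lemma IsCentral.ad {p : ℤ} {z : g.V p} (hz : g.IsCentral z) (X : g.V 0) : g.ad X z = 0 :=
  hz.bracket_right _ X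

lemma curv_add {lam z : g.V 1} (hz : g.IsCentral z) :
    g.curv (lam + z) = g.curv lam + g.d 1 2 rfl z := by
  simp only [curv, map_add, LinearMap.add_apply, hz.bracket_left, hz.bracket_right, add_zero]
  abel

lemma twistedD_add (mu : g.V 1) (s t : g.V (-1)) :
    g.twistedD mu (s + t) = g.twistedD mu s + g.twistedD mu t := by
  simp only [twistedD, map_add]
  abel

lemma twistedD_neg (mu : g.V 1) (t : g.V (-1)) : g.twistedD mu (-t) = -g.twistedD mu t := by
  simp only [twistedD, map_neg]
  abel

lemma IsCentral.twistedD {mu : g.V 1} {z : g.V (-1)} (hz : g.IsCentral z) :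
    g.twistedD mu z = g.d (-1) 0 rfl z := by
  rw [DGLA.twistedD, hz.bracket_right, add_zero]

lemma twistedD_add_left {mu z : g.V 1} (hz : g.IsCentral z) (t : g.V (-1)) :
    g.twistedD (mu + z) t = g.twistedD mu t := by
  simp only [DGLA.twistedD, map_add, LinearMap.add_apply, hz.bracket_left, add_zero]

lemma mulAt_add_left {mu z : g.V 1} (hz : g.IsCentral z) (s t : g.V (-1)) :
    g.mulAt (mu + z) s t = g.mulAt mu s t := by
  have : g.twistedBracket (mu + z) = g.twistedBracket mu := by
    funext a b
    rw [twistedBracket, twistedBracket, twistedD_add_left hz]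
  rw [mulAt, mulAt, this]

section Nilp

variable [hg : g.IsNilp]

lemma IsCentral.expAd {p : ℤ} {z : g.V p} (hz : g.IsCentral z) (X : g.V 0) :
    g.expAd X z = z := by
  rw [expAd_eq, nilExp_apply_of_apply_apply_eq_zero k (g.isNilpotent_ad X) (by simp [hz.ad]),
    hz.ad, add_zero]

lemma mul_add_right {z : g.V 0} (hz : g.IsCentral z) (X Y : g.V 0) :
    g.mul X (Y + z) = g.mul X Y + z := by
  rw [← g.mul_of_commute (hz.bracket_right _ Y), ← g.mul_assoc,
    g.mul_of_commute (hz.bracket_right _ _)]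

lemma mul_add_left {z : g.V 0} (hz : g.IsCentral z) (X Y : g.V 0) :
    g.mul (X + z) Y = g.mul X Y + z := by
  rw [add_comm X, ← g.mul_of_commute (hz.bracket_left _ X), g.mul_assoc,
    g.mul_of_commute (hz.bracket_left _ _), add_comm]

lemma gaugeAct_of_isCentral {z : g.V 0} (hz : g.IsCentral z) (lam : g.V 1) :
    g.gaugeAct z lam = lam - g.d 0 1 rfl z := by
  have h : g.ad z lam = 0 := hz.bracket_left _ _
  rw [g.gaugeAct_of_fixed, h, zero_sub, sub_eq_add_neg]
  rw [h, zero_sub, map_neg, (hz.d _).ad, neg_zero]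

lemma gaugeAct_add_right {z : g.V 1} (hz : g.IsCentral z) (X : g.V 0) (lam : g.V 1) :
    g.gaugeAct X (lam + z) = g.gaugeAct X lam + z := by
  rw [gaugeAct_add, hz.expAd]

lemma gaugeAct_add_left {z : g.V 0} (hz : g.IsCentral z) (X : g.V 0) (lam : g.V 1) :
    g.gaugeAct (X + z) lam = g.gaugeAct X lam - g.d 0 1 rfl z := by
  rw [← g.mul_of_commute (hz.bracket_right _ X), mul_gaugeAct, gaugeAct_of_isCentral hz,
    sub_eq_add_neg, gaugeAct_add_right (hz.d _).neg, sub_eq_add_neg]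

lemma expAd_add_left {z : g.V 0} (hz : g.IsCentral z) (X : g.V 0) {p : ℤ} (v : g.V p) :
    g.expAd (X + z) v = g.expAd X v := by
  have : g.ad (p := p) (X + z) = g.ad X := LinearMap.ext fun v => by
    change g.bracket 0 p p _ (X + z) v = _
    rw [map_add, LinearMap.add_apply, hz.bracket_left, add_zero]
    rfl
  rw [expAd_eq, expAd_eq, this]

end Nilp

/-! ### The crossed module of an element with central curvature -/

lemma d_twistedD (lam : g.V 1) (t : g.V (-1)) :
    g.d 0 1 rfl (g.twistedD lam t) + g.bracket 1 0 1 rfl lam (g.twistedD lam t) =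
      g.bracket 2 (-1) 1 rfl (g.curv lam) t := by
  have h1 := g.leibniz 1 (-1) 0 2 0 1 rfl rfl rfl rfl rfl rfl lam t
  have h2 := g.jacobi 1 1 (-1) 2 0 0 1 rfl rfl rfl rfl rfl rfl lam lam t
  have hn : Int.negOnePow (1 * 1) = -1 := rfl
  simp only [hn, Int.negOnePow_one, Units.neg_smul, one_smul] at h1 h2
  have h3 : g.bracket 1 0 1 rfl lam (g.bracket 1 (-1) 0 rfl lam t) =
      (2 : k)⁻¹ • g.bracket 2 (-1) 1 rfl (g.bracket 1 1 2 rfl lam lam) t := by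
    rw [eq_inv_smul_iff₀ two_ne_zero, two_smul]
    nth_rewrite 1 [h2]
    abel
  simp only [twistedD, curv, map_add, map_smul, g.d_d, h1, h3, LinearMap.add_apply,
    LinearMap.smul_apply]
  abel

section CrossedModule

variable [Subsingleton (g.V (-2))]

lemma twistedBracket_skew (lam : g.V 1) (a b : g.V (-1)) :
    g.twistedBracket lam a b = -g.twistedBracket lam b a := by
  have h1 := g.leibniz (-1) (-1) (-2) 0 0 (-1) rfl rfl rfl rfl rfl rfl a b
  have h2 := g.jacobi 1 (-1) (-1) 0 (-2) 0 (-1) rfl rfl rfl rfl rfl rfl lam a b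
  rw [Subsingleton.elim (g.bracket (-1) (-1) (-2) rfl a b) 0, map_zero] at h1 h2
  have hn : Int.negOnePow (1 * -1) = -1 := rfl
  have hn' : Int.negOnePow (-1) = -1 := rfl
  have hn'' : Int.negOnePow (-1 * 0) = 1 := rfl
  have h3 := g.skew (-1) 0 (-1) rfl rfl b (g.d (-1) 0 rfl a)
  have h4 := g.skew (-1) 0 (-1) rfl rfl b (g.bracket 1 (-1) 0 rfl lam a)
  simp only [hn, hn', hn'', Units.neg_smul, one_smul] at h1 h2 h3 h4
  simp only [twistedBracket, twistedD, map_add, h3, h4]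
  rw [eq_neg_of_add_eq_zero_left h1.symm, eq_neg_of_add_eq_zero_left h2.symm]
  abel

variable (g) in
/-- The bracket `[a, b]_λ` on the component of degree `-1`, as a bilinear map. -/
def twistedBr (lam : g.V 1) : g.V (-1) →ₗ[k] g.V (-1) →ₗ[k] g.V (-1) :=
  (g.bracket (-1) 0 (-1) rfl).compl₂ (g.d (-1) 0 rfl + g.bracket 1 (-1) 0 rfl lam)

lemma twistedBr_apply (lam : g.V 1) (a b : g.V (-1)) :
    g.twistedBr lam a b = g.twistedBracket lam a b := rfl

/-- `[a, b]_λ` is also `[d_λ a, b]`, since `[a, b]` has degree `-2`. -/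
lemma twistedBr_eq_ad (lam : g.V 1) (a b : g.V (-1)) :
    g.twistedBr lam a b = g.ad (g.twistedD lam a) b := by
  have hn : Int.negOnePow (-1 * 0) = 1 := rfl
  rw [twistedBr_apply, twistedBracket_skew, twistedBracket, g.skew (-1) 0 (-1) rfl rfl, neg_neg, hn,
    one_smul]
  rfl

lemma twistedD_twistedBracket {lam : g.V 1} (hl : g.IsCentral (g.curv lam)) (a b : g.V (-1)) :
    g.twistedD lam (g.twistedBracket lam a b) =
      g.bracket 0 0 0 rfl (g.twistedD lam a) (g.twistedD lam b) := by
  have h1 := g.leibniz (-1) 0 (-1) 0 1 0 rfl rfl rfl rfl rfl rfl a (g.twistedD lam b)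
  have h2 := g.jacobi 1 (-1) 0 0 (-1) 1 0 rfl rfl rfl rfl rfl rfl lam a (g.twistedD lam b)
  have h3 := (d_twistedD lam b).trans (hl.bracket_left _ _)
  have hn : Int.negOnePow (1 * -1) = -1 := rfl
  have hn' : Int.negOnePow (-1) = -1 := rfl
  simp only [hn, hn', Units.neg_smul, one_smul] at h1 h2
  rw [twistedBracket]
  set y := g.twistedD lam b
  rw [twistedD, h1, h2, eq_neg_of_add_eq_zero_left h3]
  simp only [twistedD, map_neg, map_add, LinearMap.add_apply]
  abel

variable [hg : g.IsNilp]

lemma gaugeBr_one (lam : g.V 1) (t : g.V (-1)) :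
    g.gaugeBr (-1) 0 rfl (lam, 1) t = g.twistedD lam t := by
  rw [gaugeBr_apply, one_smul, twistedD, add_comm]

lemma isNilpotentLie_twistedBr {lam : g.V 1} (hl : g.IsCentral (g.curv lam)) :
    IsNilpotentLie (g.twistedBr lam) where
  skew a b := twistedBracket_skew lam a b
  jacobi a b c := by
    simp only [twistedBr_apply]
    have h := g.jacobi (-1) 0 0 (-1) 0 (-1) (-1) rfl rfl rfl rfl rfl rfl a (g.twistedD lam b)
      (g.twistedD lam c)
    have hn : Int.negOnePow (-1 * 0) = 1 := rfl
    rw [hn, one_smul] at h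
    rw [twistedBracket, twistedD_twistedBracket hl, h]
    congr 1
    exact (twistedBr_eq_ad lam b _).symm
  exists_filtration := by
    obtain ⟨F, N, h1, hN, hanti, hd, hbr⟩ := hg.exists_filtration
    refine ⟨fun i => F i (-1), N, h1 _, hN _, fun i j => hanti i j _, fun i j x y hx hy => ?_⟩
    refine hbr i j (-1) 0 (-1) rfl _ _ hx (Submodule.add_mem _ (hd _ _ _ _ _ hy) ?_)
    exact hanti _ _ _ (by omega) (hbr 1 j 1 (-1) 0 rfl lam y (by simp [h1]) hy)

section Group

variable {lam : g.V 1} (hl : g.IsCentral (g.curv lam))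

include hl

lemma mulAt_assoc (a b c : g.V (-1)) :
    g.mulAt lam (g.mulAt lam a b) c = g.mulAt lam a (g.mulAt lam b c) :=
  (isNilpotentLie_twistedBr hl).bch_assoc a b c

lemma zero_mulAt (a : g.V (-1)) : g.mulAt lam 0 a = a := (isNilpotentLie_twistedBr hl).zero_bch a

lemma mulAt_of_commute {a b : g.V (-1)} (h : g.twistedBracket lam a b = 0) :
    g.mulAt lam a b = a + b := (isNilpotentLie_twistedBr hl).bch_of_commute h

lemma mulAt_zero (a : g.V (-1)) : g.mulAt lam a 0 = a := by
  rw [mulAt_of_commute hl (map_zero (g.twistedBr lam a)), add_zero]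

lemma neg_mulAt_self (a : g.V (-1)) : g.mulAt lam (-a) a = 0 :=
  (isNilpotentLie_twistedBr hl).neg_bch_self a

lemma mulAt_neg_self (a : g.V (-1)) : g.mulAt lam a (-a) = 0 := by
  simpa using neg_mulAt_self hl (-a)

lemma neg_mulAt_cancel_left (a b : g.V (-1)) : g.mulAt lam (-a) (g.mulAt lam a b) = b := by
  rw [← mulAt_assoc hl, neg_mulAt_self hl, zero_mulAt hl]

lemma mulAt_neg_cancel_left (a b : g.V (-1)) : g.mulAt lam a (g.mulAt lam (-a) b) = b := by
  rw [← mulAt_assoc hl, mulAt_neg_self hl, zero_mulAt hl]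

lemma mulAt_left_cancel {a b c : g.V (-1)} (h : g.mulAt lam a b = g.mulAt lam a c) : b = c := by
  rw [← neg_mulAt_cancel_left hl a b, h, neg_mulAt_cancel_left hl]

lemma twistedD_mulAt (a b : g.V (-1)) :
    g.twistedD lam (g.mulAt lam a b) = g.mul (g.twistedD lam a) (g.twistedD lam b) :=
  map_bch (g.twistedBracket lam) (fun a b => g.bracket 0 0 0 rfl a b)
    (g.d (-1) 0 rfl + g.bracket 1 (-1) 0 rfl lam) (twistedD_twistedBracket hl) a b
    ((isNilpotentLie_twistedBr hl).bch_finite a b)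

/-- The Peiffer identity of the crossed module `d_λ`. -/
lemma mulAt_expAd_twistedD (t a : g.V (-1)) :
    g.mulAt lam (g.expAd (g.twistedD lam t) a) t = g.mulAt lam t a := by
  have h : g.ad (g.twistedD lam t) = g.twistedBr lam t :=
    LinearMap.ext fun b => (twistedBr_eq_ad lam t b).symm
  rw [expAd_eq, h]
  exact (isNilpotentLie_twistedBr hl).bch_nilExp_adjoint t a

lemma gaugeAct_twistedD (t : g.V (-1)) : g.gaugeAct (g.twistedD lam t) lam = lam := by
  have h : g.ad (g.twistedD lam t) lam - g.d 0 1 rfl (g.twistedD lam t) = 0 := by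
    have h1 := (d_twistedD lam t).trans (hl.bracket_left _ _)
    have h2 := g.skew 0 1 1 rfl rfl (g.twistedD lam t) lam
    have hn : Int.negOnePow (0 * 1) = 1 := rfl
    rw [hn, one_smul] at h2
    rw [eq_neg_of_add_eq_zero_left h1, sub_neg_eq_add]
    exact h2 ▸ neg_add_cancel _
  rw [g.gaugeAct_of_fixed (by rw [h, map_zero]), h, add_zero]

lemma mulAt_add_central_right {z : g.V (-1)} (hz : g.IsCentral z) (a b : g.V (-1)) :
    g.mulAt lam a (b + z) = g.mulAt lam a b + z := by
  have h : ∀ x, g.twistedBracket lam x z = 0 := fun x => by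
    rw [twistedBracket, hz.twistedD, (hz.d _).bracket_right]
  rw [← mulAt_of_commute hl (h b), ← mulAt_assoc hl, mulAt_of_commute hl (h _)]

lemma mulAt_add_central_left {z : g.V (-1)} (hz : g.IsCentral z) (a b : g.V (-1)) :
    g.mulAt lam (a + z) b = g.mulAt lam a b + z := by
  have h : ∀ x, g.twistedBracket lam z x = 0 := fun x => hz.bracket_left _ _
  rw [add_comm a, ← mulAt_of_commute hl (h a), mulAt_assoc hl, mulAt_of_commute hl (h _), add_comm]

lemma expAd_mulAt (X : g.V 0) (a b : g.V (-1)) :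
    g.expAd X (g.mulAt lam a b) = g.mulAt (g.gaugeAct X lam) (g.expAd X a) (g.expAd X b) := by
  have h := map_bch (g.twistedBracket lam) (g.twistedBracket (g.gaugeAct X lam))
    (nilExp k (g.ad X)) (fun a b => by
      have h1 := g.expAd_gaugeBr (-1) 0 rfl X lam b
      rw [gaugeBr_one, gaugeBr_one] at h1
      rw [← expAd_eq, ← expAd_eq, ← expAd_eq, twistedBracket, g.expAd_bracket (p := -1) (q := 0) (r := -1) rfl, h1]
      rfl) a b ((isNilpotentLie_twistedBr hl).bch_finite a b)
  simp only [expAd_eq]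
  exact h

end Group

lemma expAd_twistedD (X : g.V 0) (lam : g.V 1) (t : g.V (-1)) :
    g.expAd X (g.twistedD lam t) = g.twistedD (g.gaugeAct X lam) (g.expAd X t) := by
  have h := g.expAd_gaugeBr (-1) 0 rfl X lam t
  rwa [gaugeBr_one, gaugeBr_one] at h

end CrossedModule

end DGLA

/-! ### Identities between defects in a single DGLA -/

namespace DGLA

variable {k : Type u} [Field k] [CharZero k] {g : DGLA.{u, v} k} [hg : g.IsNilp]

lemma d_curv_eq_zero {lam : g.V 1} (hl : g.IsCentral (g.curv lam)) :
    g.d 2 3 rfl (g.curv lam) = 0 := by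
  rw [d_curv, hl.bracket_left]

/-- The defect of `exp G` from being a gauge transformation is a primitive of the difference of
the curvatures. -/
lemma d_gauge_defect {G : g.V 0} {l m e : g.V 1} (hl : g.IsCentral (g.curv l))
    (he : g.IsCentral e) (h : g.gaugeAct G l = m + e) :
    g.d 1 2 rfl e = g.curv l - g.curv m := by
  have := g.curv_gaugeAct G l
  rw [h, curv_add he, hl.expAd] at this
  rw [← this, add_sub_cancel_left]

variable [Subsingleton (g.V (-2))]

section Transport

variable {X : g.V 0} {l m e : g.V 1}

/-- A gauge transformation up to a central defect transports the groups of two-morphisms. -/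
lemma expAd_mulAt_of_gauge (hl : g.IsCentral (g.curv l)) (he : g.IsCentral e)
    (h : g.gaugeAct X l = m + e) (a b : g.V (-1)) :
    g.expAd X (g.mulAt l a b) = g.mulAt m (g.expAd X a) (g.expAd X b) := by
  rw [expAd_mulAt hl, h, mulAt_add_left he]

lemma expAd_twistedD_of_gauge (he : g.IsCentral e) (h : g.gaugeAct X l = m + e) (t : g.V (-1)) :
    g.expAd X (g.twistedD l t) = g.twistedD m (g.expAd X t) := by
  rw [expAd_twistedD, h, twistedD_add_left he]

/-- A two-morphism applied to the right factor of a product acts on the whole product through the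
adjoint action. -/
lemma twistedD_expAd_mul (he : g.IsCentral e) (h : g.gaugeAct X l = m + e) (t : g.V (-1))
    (Y : g.V 0) :
    g.mul (g.twistedD m (g.expAd X t)) (g.mul X Y) = g.mul X (g.mul (g.twistedD l t) Y) := by
  rw [← expAd_twistedD_of_gauge he h, ← g.mul_assoc, expAd_mul_self, g.mul_assoc]

/-- Conjugation by a two-morphism exchanges the actions of its source and of its target. -/
lemma mulAt_expAd_of_twistedD_mul (hl : g.IsCentral (g.curv l)) {t : g.V (-1)} {Y Z z : g.V 0}
    (hz : g.IsCentral z) (h : g.mul (g.twistedD l t) Y = Z + z) (a : g.V (-1)) :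
    g.mulAt l t (g.expAd Y a) = g.mulAt l (g.expAd Z a) t := by
  rw [← mulAt_expAd_twistedD hl, ← mul_expAd, h, expAd_add_left hz]

end Transport

/-! #### Descent data -/

/-- The defect of `c` on a triangle is a primitive of the alternating sum of the defects of `G` on its
edges: let both sides of `Hc` act on `l2`. -/
lemma d_triangle_defect {l0 l1 l2 e01 e12 e02 : g.V 1} {G01 G12 G02 e : g.V 0} {c : g.V (-1)}
    (hl : g.IsCentral (g.curv l0)) (h01 : g.IsCentral e01) (h12 : g.IsCentral e12)
    (he : g.IsCentral e) (H01 : g.gaugeAct G01 l1 = l0 + e01) (H12 : g.gaugeAct G12 l2 = l1 + e12)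
    (H02 : g.gaugeAct G02 l2 = l0 + e02)
    (Hc : g.mul (g.twistedD l0 c) (g.mul G01 G12) = G02 + e) :
    g.d 0 1 rfl e = e02 - e01 - e12 := by
  have h := congrArg (fun X => g.gaugeAct X l2) Hc
  simp only [mul_gaugeAct, H12, gaugeAct_add_right h12, H01, gaugeAct_add_right h01,
    gaugeAct_twistedD hl, gaugeAct_add_left he, H02] at h
  linear_combination (norm := abel) h

/-- The defect of the cocycle condition on a tetrahedron is a primitive of the alternating sum of the
defects of `c` on its faces: compare both sides as two-morphisms out of `G01 G12 G23`. -/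
lemma d_tetrahedron_defect {l0 l1 e01 : g.V 1} {G01 G12 G23 G02 G13 G03 e012 e013 e023 e123 : g.V 0}
    {c012 c013 c023 c123 e : g.V (-1)} (hl0 : g.IsCentral (g.curv l0))
    (h01 : g.IsCentral e01) (h012 : g.IsCentral e012)
    (h123 : g.IsCentral e123) (he : g.IsCentral e) (H01 : g.gaugeAct G01 l1 = l0 + e01)
    (H012 : g.mul (g.twistedD l0 c012) (g.mul G01 G12) = G02 + e012)
    (H013 : g.mul (g.twistedD l0 c013) (g.mul G01 G13) = G03 + e013)
    (H023 : g.mul (g.twistedD l0 c023) (g.mul G02 G23) = G03 + e023)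
    (H123 : g.mul (g.twistedD l1 c123) (g.mul G12 G23) = G13 + e123)
    (H : g.mulAt l0 c013 (g.expAd G01 c123) = g.mulAt l0 c023 c012 + e) :
    g.d (-1) 0 rfl e = e123 - e023 + e013 - e012 := by
  have h := congrArg (fun t => g.mul (g.twistedD l0 t) (g.mul G01 (g.mul G12 G23))) H
  simp only [twistedD_add, he.twistedD, mul_add_left (he.d _), twistedD_mulAt hl0] at h
  rw [g.mul_assoc, g.mul_assoc, twistedD_expAd_mul h01 H01, H123, mul_add_right h123,
    mul_add_right h123, H013, ← g.mul_assoc G01, ← g.mul_assoc (g.twistedD l0 c012), H012,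
    mul_add_left h012, mul_add_right h012, H023] at h
  linear_combination (norm := abel) -h

/-- The pentagon of the faces of a four-simplex. -/
lemma pentagon_defect {l0 l1 e01 : g.V 1} {G01 G12 G02 e012 : g.V 0}
    {c012 c013 c014 c023 c024 c034 c123 c124 c134 c234 e0123 e0124 e0134 e0234 e1234 : g.V (-1)}
    (hl0 : g.IsCentral (g.curv l0)) (hl1 : g.IsCentral (g.curv l1))
    (h01 : g.IsCentral e01) (h012 : g.IsCentral e012) (h0123 : g.IsCentral e0123)
    (h0124 : g.IsCentral e0124) (h0134 : g.IsCentral e0134) (h0234 : g.IsCentral e0234)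
    (h1234 : g.IsCentral e1234) (H01 : g.gaugeAct G01 l1 = l0 + e01)
    (H012 : g.mul (g.twistedD l0 c012) (g.mul G01 G12) = G02 + e012)
    (H0123 : g.mulAt l0 c013 (g.expAd G01 c123) = g.mulAt l0 c023 c012 + e0123)
    (H0124 : g.mulAt l0 c014 (g.expAd G01 c124) = g.mulAt l0 c024 c012 + e0124)
    (H0134 : g.mulAt l0 c014 (g.expAd G01 c134) = g.mulAt l0 c034 c013 + e0134)
    (H0234 : g.mulAt l0 c024 (g.expAd G02 c234) = g.mulAt l0 c034 c023 + e0234)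
    (H1234 : g.mulAt l1 c124 (g.expAd G12 c234) = g.mulAt l1 c134 c123 + e1234) :
    e1234 - e0234 + e0134 - e0124 + e0123 = 0 := by
  have h := congrArg (fun t => g.mulAt l0 c014 (g.expAd G01 t)) H1234
  simp only [expAd_add, h1234.expAd, expAd_mulAt_of_gauge hl1 h01 H01] at h
  rw [mulAt_add_central_right hl0 h1234, ← mulAt_assoc hl0, ← mulAt_assoc hl0, H0124, H0134,
    mulAt_add_central_left hl0 h0124, mulAt_add_central_left hl0 h0134, mulAt_assoc hl0,
    ← mul_expAd, mulAt_expAd_of_twistedD_mul hl0 h012 H012, ← mulAt_assoc hl0, H0234,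
    mulAt_add_central_left hl0 h0234, mulAt_assoc hl0 c034 c013, H0123,
    mulAt_add_central_right hl0 h0123, ← mulAt_assoc hl0] at h
  linear_combination (norm := abel) -h

/-! #### Isomorphisms -/

/-- The defect of `b` on an edge: let both sides of `Hb` act on `l1`. -/
lemma d_square_defect {l0 l1 m0 m1 e e' f0 f1 : g.V 1} {G G' H0 H1 f : g.V 0} {b : g.V (-1)}
    (hm : g.IsCentral (g.curv m0)) (he : g.IsCentral e) (hf0 : g.IsCentral f0)
    (hf1 : g.IsCentral f1) (hf : g.IsCentral f)
    (HG : g.gaugeAct G l1 = l0 + e) (HG' : g.gaugeAct G' m1 = m0 + e')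
    (HH0 : g.gaugeAct H0 l0 = m0 + f0) (HH1 : g.gaugeAct H1 l1 = m1 + f1)
    (Hb : g.mul (g.twistedD m0 b) (g.mul H0 G) = g.mul G' H1 + f) :
    -g.d 0 1 rfl f + (f1 - f0) = e - e' := by
  have h := congrArg (fun X => g.gaugeAct X l1) Hb
  simp only [gaugeAct_add_left hf, mul_gaugeAct, HG, HH1, gaugeAct_add_right he, HH0,
    gaugeAct_add_right hf0, gaugeAct_add_right hf1, HG', gaugeAct_twistedD hm] at h
  linear_combination (norm := abel) -h

/-- The defect of the compatibility condition of an isomorphism on a triangle: compare both sides as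
two-morphisms out of `H0 G01 G12`. -/
lemma d_prism_defect {l0 m0 m1 f0 e01' : g.V 1}
    {G01 G12 G02 G01' G12' G02' H0 H1 H2 f01 f12 f02 e e' : g.V 0}
    {b01 b12 b02 c c' f : g.V (-1)} (hm0 : g.IsCentral (g.curv m0)) (hf0 : g.IsCentral f0)
    (he01' : g.IsCentral e01') (hf01 : g.IsCentral f01) (hf12 : g.IsCentral f12)
    (he : g.IsCentral e) (he' : g.IsCentral e') (hf : g.IsCentral f)
    (HH : g.gaugeAct H0 l0 = m0 + f0) (HG' : g.gaugeAct G01' m1 = m0 + e01')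
    (H01 : g.mul (g.twistedD m0 b01) (g.mul H0 G01) = g.mul G01' H1 + f01)
    (H12 : g.mul (g.twistedD m1 b12) (g.mul H1 G12) = g.mul G12' H2 + f12)
    (H02 : g.mul (g.twistedD m0 b02) (g.mul H0 G02) = g.mul G02' H2 + f02)
    (Hc : g.mul (g.twistedD l0 c) (g.mul G01 G12) = G02 + e)
    (Hc' : g.mul (g.twistedD m0 c') (g.mul G01' G12') = G02' + e')
    (H : g.mulAt m0 b02 (g.expAd H0 c) =
      g.mulAt m0 (g.mulAt m0 c' (g.expAd G01' b12)) b01 + f) :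
    g.d (-1) 0 rfl f + (f12 - f02 + f01) = e - e' := by
  have h := congrArg (fun t => g.mul (g.twistedD m0 t) (g.mul H0 (g.mul G01 G12))) H
  simp only [twistedD_add, hf.twistedD, mul_add_left (hf.d _), twistedD_mulAt hm0] at h
  rw [g.mul_assoc, twistedD_expAd_mul hf0 HH, Hc, mul_add_right he, mul_add_right he, H02,
    g.mul_assoc, g.mul_assoc, ← g.mul_assoc H0, ← g.mul_assoc (g.twistedD m0 b01), H01,
    mul_add_left hf01, mul_add_right hf01, mul_add_right hf01, g.mul_assoc G01',
    twistedD_expAd_mul he01' HG', H12, mul_add_right hf12, mul_add_right hf12, ← g.mul_assoc G01',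
    ← g.mul_assoc (g.twistedD m0 c'), Hc', mul_add_left he'] at h
  linear_combination (norm := abel) -h

/-- The compatibility conditions of an isomorphism on the faces of a tetrahedron. -/
lemma prism_defect {l0 m0 m1 f0 e01' : g.V 1}
    {G01 G01' G12' G02' H0 H1 f01 e012' : g.V 0}
    {b01 b02 b03 b12 b13 b23 c012 c013 c023 c123 c012' c013' c023' c123' f012 f013 f023 f123 e
      e' : g.V (-1)} (hl0 : g.IsCentral (g.curv l0)) (hm0 : g.IsCentral (g.curv m0))
    (hm1 : g.IsCentral (g.curv m1)) (hf0 : g.IsCentral f0)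
    (he01' : g.IsCentral e01') (hf01 : g.IsCentral f01) (he012' : g.IsCentral e012')
    (hf012 : g.IsCentral f012) (hf013 : g.IsCentral f013) (hf023 : g.IsCentral f023)
    (hf123 : g.IsCentral f123) (he : g.IsCentral e) (he' : g.IsCentral e')
    (HH0 : g.gaugeAct H0 l0 = m0 + f0) (HG' : g.gaugeAct G01' m1 = m0 + e01')
    (H01 : g.mul (g.twistedD m0 b01) (g.mul H0 G01) = g.mul G01' H1 + f01)
    (Hc' : g.mul (g.twistedD m0 c012') (g.mul G01' G12') = G02' + e012')
    (H012 : g.mulAt m0 b02 (g.expAd H0 c012) =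
      g.mulAt m0 (g.mulAt m0 c012' (g.expAd G01' b12)) b01 + f012)
    (H013 : g.mulAt m0 b03 (g.expAd H0 c013) =
      g.mulAt m0 (g.mulAt m0 c013' (g.expAd G01' b13)) b01 + f013)
    (H023 : g.mulAt m0 b03 (g.expAd H0 c023) =
      g.mulAt m0 (g.mulAt m0 c023' (g.expAd G02' b23)) b02 + f023)
    (H123 : g.mulAt m1 b13 (g.expAd H1 c123) =
      g.mulAt m1 (g.mulAt m1 c123' (g.expAd G12' b23)) b12 + f123)
    (H : g.mulAt l0 c013 (g.expAd G01 c123) = g.mulAt l0 c023 c012 + e)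
    (H' : g.mulAt m0 c013' (g.expAd G01' c123') = g.mulAt m0 c023' c012' + e') :
    f123 - f023 + f013 - f012 = e - e' := by
  have h := congrArg (fun t => g.mulAt m0 b03 (g.expAd H0 t)) H
  simp only [expAd_add, he.expAd, expAd_mulAt_of_gauge hl0 hf0 HH0] at h
  have h' := congrArg (fun t => g.expAd G01' t) H123
  simp only [expAd_add, hf123.expAd, expAd_mulAt_of_gauge hm1 he01' HG'] at h'
  rw [mulAt_add_central_right hm0 he, ← mulAt_assoc hm0, ← mulAt_assoc hm0, H013, H023,
    mulAt_add_central_left hm0 hf013, mulAt_add_central_left hm0 hf023,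
    mulAt_assoc hm0 _ b02, H012, mulAt_add_central_right hm0 hf012,
    mulAt_assoc hm0 _ b01, ← mul_expAd, mulAt_expAd_of_twistedD_mul hm0 hf01 H01, mul_expAd,
    mulAt_assoc hm0 c013', ← mulAt_assoc hm0 _ _ b01, h',
    mulAt_add_central_left hm0 hf123, mulAt_add_central_right hm0 hf123,
    mulAt_assoc hm0 _ _ b01, mulAt_assoc hm0 _ (g.expAd G01' (g.expAd G12' b23)),
    ← mulAt_assoc hm0 c013', H', mulAt_add_central_left hm0 he',
    mulAt_assoc hm0 c012', mulAt_assoc hm0 c023' _ (g.mulAt m0 c012' _),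
    ← mulAt_assoc hm0 _ c012', ← mulAt_expAd_of_twistedD_mul hm0 he012' Hc', mul_expAd] at h
  simp only [mulAt_assoc hm0] at h
  linear_combination (norm := abel) h

/-! #### Two-isomorphisms -/

/-- The defect of a two-isomorphism on a vertex: let both sides of `Ha` act on `l`. -/
lemma d_bigon_defect {l m e e' : g.V 1} {H H' f : g.V 0} {a : g.V (-1)}
    (hm : g.IsCentral (g.curv m)) (he : g.IsCentral e) (hf : g.IsCentral f)
    (HH : g.gaugeAct H l = m + e) (HH' : g.gaugeAct H' l = m + e')
    (Ha : g.mul (g.twistedD m a) H = H' + f) :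
    g.d 0 1 rfl f = e' - e := by
  have h := congrArg (fun X => g.gaugeAct X l) Ha
  simp only [gaugeAct_add_left hf, mul_gaugeAct, HH, HH', gaugeAct_add_right he,
    gaugeAct_twistedD hm] at h
  linear_combination (norm := abel) h

/-- The defect of the compatibility condition of a two-isomorphism on an edge: compare both sides as
two-morphisms out of `H0 G`. -/
lemma d_cylinder_defect {m0 m1 : g.V 1} {G G' H0 H1 H0' H1' e e' f0 f1 : g.V 0}
    {b b' a0 a1 f : g.V (-1)} (hm0 : g.IsCentral (g.curv m0)) (he : g.IsCentral e)
    (hf0 : g.IsCentral f0) (hf1 : g.IsCentral f1) (hf : g.IsCentral f)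
    (HG' : g.gaugeAct G' m1 = m0)
    (Hb : g.mul (g.twistedD m0 b) (g.mul H0 G) = g.mul G' H1 + e)
    (Hb' : g.mul (g.twistedD m0 b') (g.mul H0' G) = g.mul G' H1' + e')
    (Ha0 : g.mul (g.twistedD m0 a0) H0 = H0' + f0) (Ha1 : g.mul (g.twistedD m1 a1) H1 = H1' + f1)
    (H : g.mulAt m0 (g.expAd G' a1) b = g.mulAt m0 b' a0 + f) :
    -g.d (-1) 0 rfl f + (f1 - f0) = e' - e := by
  have h := congrArg (fun t => g.mul (g.twistedD m0 t) (g.mul H0 G)) H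
  simp only [twistedD_add, hf.twistedD, mul_add_left (hf.d _), twistedD_mulAt hm0] at h
  rw [g.mul_assoc, Hb, mul_add_right he, twistedD_expAd_mul isCentral_zero (HG'.trans
    (add_zero _).symm), Ha1, mul_add_right hf1, g.mul_assoc, ← g.mul_assoc _ H0, Ha0,
    mul_add_left hf0, mul_add_right hf0, Hb'] at h
  linear_combination (norm := abel) h

/-- The compatibility conditions of a two-isomorphism on the edges of a triangle. -/
lemma cylinder_defect {m0 m1 : g.V 1}
    {G01' G12' G02' H0 H0' f0 : g.V 0}
    {b01 b12 b02 b01' b12' b02' a0 a1 a2 c c' e e' f01 f12 f02 : g.V (-1)}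
    (hm0 : g.IsCentral (g.curv m0)) (hm1 : g.IsCentral (g.curv m1))
    (hf0 : g.IsCentral f0) (he : g.IsCentral e) (he' : g.IsCentral e') (hf01 : g.IsCentral f01)
    (hf12 : g.IsCentral f12) (hf02 : g.IsCentral f02) (HG' : g.gaugeAct G01' m1 = m0)
    (Hc' : g.mul (g.twistedD m0 c') (g.mul G01' G12') = G02')
    (Ha : g.mul (g.twistedD m0 a0) H0 = H0' + f0)
    (H01 : g.mulAt m0 (g.expAd G01' a1) b01 = g.mulAt m0 b01' a0 + f01)
    (H12 : g.mulAt m1 (g.expAd G12' a2) b12 = g.mulAt m1 b12' a1 + f12)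
    (H02 : g.mulAt m0 (g.expAd G02' a2) b02 = g.mulAt m0 b02' a0 + f02)
    (Hb : g.mulAt m0 b02 (g.expAd H0 c) =
      g.mulAt m0 (g.mulAt m0 c' (g.expAd G01' b12)) b01 + e)
    (Hb' : g.mulAt m0 b02' (g.expAd H0' c) =
      g.mulAt m0 (g.mulAt m0 c' (g.expAd G01' b12')) b01' + e') :
    f12 - f02 + f01 = e' - e := by
  have h := congrArg (fun t => g.mulAt m0 t (g.expAd H0 c)) H02
  have h12 := congrArg (fun t => g.expAd G01' t) H12
  simp only [expAd_add, hf12.expAd, expAd_mulAt_of_gauge hm1 isCentral_zero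
    (HG'.trans (add_zero _).symm)] at h12
  rw [mulAt_assoc hm0, Hb, mulAt_add_central_right hm0 he, mulAt_add_central_left hm0 hf02,
    mulAt_assoc hm0 b02', mulAt_expAd_of_twistedD_mul hm0 hf0 Ha, ← mulAt_assoc hm0 b02', Hb',
    mulAt_add_central_left hm0 he', mulAt_assoc hm0 c', ← mulAt_assoc hm0 _ c',
    ← mulAt_expAd_of_twistedD_mul hm0 isCentral_zero (Hc'.trans (add_zero _).symm), mul_expAd,
    mulAt_assoc hm0 c', ← mulAt_assoc hm0 _ _ b01, h12, mulAt_add_central_left hm0 hf12,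
    mulAt_add_central_right hm0 hf12, mulAt_assoc hm0 _ _ b01, H01,
    mulAt_add_central_right hm0 hf01, mulAt_add_central_right hm0 hf01] at h
  simp only [mulAt_assoc hm0] at h
  linear_combination (norm := abel) h

end DGLA

/-! ### Faces and the total complex -/

namespace CosimplicialDGLA

variable {k : Type u} [Field k]

/-- The components of degree less than `-1` of the cosimplicial DGLA vanish. -/
class IsBounded (g : CosimplicialDGLA.{u, v} k) : Prop where
  subsingleton : ∀ (n : ℕ) (p : ℤ), p < -1 → Subsingleton (g.Comp n p)

instance (g : CosimplicialDGLA.{u, v} k) [h : g.IsBounded] (n : ℕ) :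
    Subsingleton ((g.obj (.mk n)).V (-2)) := h.subsingleton n (-2) (by norm_num)

section Faces

variable (g : CosimplicialDGLA.{u, v} k) {p : ℤ}

lemma map_map {l m n : ℕ} {φ : SimplexCategory.mk l ⟶ SimplexCategory.mk m}
    {ψ : SimplexCategory.mk m ⟶ SimplexCategory.mk n}
    {χ : SimplexCategory.mk l ⟶ SimplexCategory.mk n} (h : φ ≫ ψ = χ) (x : g.Comp l p) :
    DGLA.Hom.f (g.map ψ) p (DGLA.Hom.f (g.map φ) p x) = DGLA.Hom.f (g.map χ) p x := by
  rw [← h, g.map_comp]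
  rfl

variable {m n : ℕ} (φ : SimplexCategory.mk m ⟶ SimplexCategory.mk n)

lemma map_at₁ {i : Fin (m + 1)} {i' : Fin (n + 1)} (hi : φ.toOrderHom i = i') (x : g.Comp 0 p) :
    DGLA.Hom.f (g.map φ) p (g.at₁ m i x) = g.at₁ n i' x := by
  refine g.map_map ?_ x
  subst hi
  rfl

lemma map_at₂ {i j : Fin (m + 1)} {i' j' : Fin (n + 1)} (hi : φ.toOrderHom i = i')
    (hj : φ.toOrderHom j = j') (h : i ≤ j) (h' : i' ≤ j') (x : g.Comp 1 p) :
    DGLA.Hom.f (g.map φ) p (g.at₂ m i j x h) = g.at₂ n i' j' x h' := by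
  refine g.map_map ?_ x
  subst hi hj
  ext a : 3
  fin_cases a <;> rfl

lemma map_at₃ {i j l : Fin (m + 1)} {i' j' l' : Fin (n + 1)} (hi : φ.toOrderHom i = i')
    (hj : φ.toOrderHom j = j') (hl : φ.toOrderHom l = l') (h₁ : i ≤ j) (h₂ : j ≤ l)
    (h₁' : i' ≤ j') (h₂' : j' ≤ l') (x : g.Comp 2 p) :
    DGLA.Hom.f (g.map φ) p (g.at₃ m i j l x h₁ h₂) = g.at₃ n i' j' l' x h₁' h₂' := by
  refine g.map_map ?_ x
  subst hi hj hl
  ext a : 3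
  fin_cases a <;> rfl

lemma coboundary_apply (m : ℕ) (x : g.Comp m p) : g.coboundary m p x =
    ∑ i : Fin (m + 2), ((-1 : ℤ) ^ (i : ℕ)) • DGLA.Hom.f (g.map (SimplexCategory.δ i)) p x := by
  simp only [coboundary, LinearMap.sum_apply, LinearMap.smul_apply]

lemma coboundary_zero (x : g.Comp 0 p) :
    g.coboundary 0 p x = g.at₁ 1 1 x - g.at₁ 1 0 x := by
  have h0 : SimplexCategory.δ (n := 0) 0 = SimplexCategory.const (.mk 0) (.mk 1) 1 := by
    ext a : 3
    fin_cases a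
    rfl
  have h1 : SimplexCategory.δ (n := 0) 1 = SimplexCategory.const (.mk 0) (.mk 1) 0 := by
    ext a : 3
    fin_cases a
    rfl
  refine (g.coboundary_apply 0 x).trans ((Fin.sum_univ_two _).trans ?_)
  rw [h0, h1]
  simp [sub_eq_add_neg, at₁]

lemma coboundary_one (x : g.Comp 1 p) :
    g.coboundary 1 p x = g.at₂ 2 1 2 x - g.at₂ 2 0 2 x + g.at₂ 2 0 1 x := by
  have h0 : SimplexCategory.δ (n := 1) 0 = SimplexCategory.mkOfLe 1 2 (by decide) := by
    ext a : 3
    fin_cases a <;> rfl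
  have h1 : SimplexCategory.δ (n := 1) 1 = SimplexCategory.mkOfLe 0 2 (by decide) := by
    ext a : 3
    fin_cases a <;> rfl
  have h2 : SimplexCategory.δ (n := 1) 2 = SimplexCategory.mkOfLe 0 1 (by decide) := by
    ext a : 3
    fin_cases a <;> rfl
  refine (g.coboundary_apply 1 x).trans ((Fin.sum_univ_three _).trans ?_)
  rw [h0, h1, h2]
  simp [sub_eq_add_neg, at₂]

lemma coboundary_two (x : g.Comp 2 p) :
    g.coboundary 2 p x =
      g.at₃ 3 1 2 3 x - g.at₃ 3 0 2 3 x + g.at₃ 3 0 1 3 x - g.at₃ 3 0 1 2 x := by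
  have h0 : SimplexCategory.δ (n := 2) 0 =
      SimplexCategory.mkOfLeComp 1 2 3 (by decide) (by decide) := by
    ext a : 3
    fin_cases a <;> rfl
  have h1 : SimplexCategory.δ (n := 2) 1 =
      SimplexCategory.mkOfLeComp 0 2 3 (by decide) (by decide) := by
    ext a : 3
    fin_cases a <;> rfl
  have h2 : SimplexCategory.δ (n := 2) 2 =
      SimplexCategory.mkOfLeComp 0 1 3 (by decide) (by decide) := by
    ext a : 3
    fin_cases a <;> rfl
  have h3 : SimplexCategory.δ (n := 2) 3 =
      SimplexCategory.mkOfLeComp 0 1 2 (by decide) (by decide) := by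
    ext a : 3
    fin_cases a <;> rfl
  refine (g.coboundary_apply 2 x).trans ((Fin.sum_univ_four _).trans ?_)
  rw [h0, h1, h2, h3]
  simp [sub_eq_add_neg, pow_succ, at₃]

lemma coboundary_three (x : g.Comp 3 p) :
    g.coboundary 3 p x = DGLA.Hom.f (g.map (SimplexCategory.δ 0)) p x -
      DGLA.Hom.f (g.map (SimplexCategory.δ 1)) p x + DGLA.Hom.f (g.map (SimplexCategory.δ 2)) p x -
      DGLA.Hom.f (g.map (SimplexCategory.δ 3)) p x + DGLA.Hom.f (g.map (SimplexCategory.δ 4)) p x := by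
  refine (g.coboundary_apply 3 x).trans ((Fin.sum_univ_five _).trans ?_)
  simp [sub_eq_add_neg, pow_succ]

lemma totalD_zero (x : g.Family) {p q : ℤ} (h : p + 1 = q) :
    g.totalD x 0 q = (g.obj (.mk 0)).d p q h (x 0 p) := by
  obtain rfl : p = q - 1 := by omega
  simp [totalD]

lemma totalD_succ (x : g.Family) (n : ℕ) {p q : ℤ} (h : p + 1 = q) :
    g.totalD x (n + 1) q = ((n + 1 : ℕ) : ℤ).negOnePow • (g.obj (.mk (n + 1))).d p q h (x (n + 1) p)
      + g.coboundary n q (x n q) := by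
  obtain rfl : p = q - 1 := by omega
  rfl

lemma totalD_one (x : g.Family) {p q : ℤ} (h : p + 1 = q) :
    g.totalD x 1 q = -(g.obj (.mk 1)).d p q h (x 1 p) + (g.at₁ 1 1 (x 0 q) - g.at₁ 1 0 (x 0 q)) := by
  rw [totalD_succ g x 0 h, coboundary_zero]
  simp

lemma totalD_two (x : g.Family) {p q : ℤ} (h : p + 1 = q) :
    g.totalD x 2 q = (g.obj (.mk 2)).d p q h (x 2 p) +
      (g.at₂ 2 1 2 (x 1 q) - g.at₂ 2 0 2 (x 1 q) + g.at₂ 2 0 1 (x 1 q)) := by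
  rw [totalD_succ g x 1 h, coboundary_one]
  have hs : ((1 + 1 : ℕ) : ℤ).negOnePow = 1 := rfl
  rw [hs, one_smul]

lemma totalD_three (x : g.Family) {p q : ℤ} (h : p + 1 = q) :
    g.totalD x 3 q = -(g.obj (.mk 3)).d p q h (x 3 p) +
      (g.at₃ 3 1 2 3 (x 2 q) - g.at₃ 3 0 2 3 (x 2 q) + g.at₃ 3 0 1 3 (x 2 q) -
        g.at₃ 3 0 1 2 (x 2 q)) := by
  rw [totalD_succ g x 2 h, coboundary_two]
  have hs : ((2 + 1 : ℕ) : ℤ).negOnePow = -1 := rfl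
  rw [hs, Units.neg_smul, one_smul]

/-- Families of the same total degree are equal if their components of degree at least `-1` are. -/
lemma ext_of_mem_totalX [hb : g.IsBounded] {m : ℤ} {x y : g.Family} (hx : x ∈ g.totalX m)
    (hy : y ∈ g.totalX m) (h : ∀ n : ℕ, (n : ℤ) ≤ m + 1 → x n (m - n) = y n (m - n)) : x = y := by
  funext n p
  by_cases hp : p < -1
  · have := hb.subsingleton n p hp
    exact Subsingleton.elim _ _
  by_cases hm : (n : ℤ) + p = m
  · obtain rfl : p = m - n := by omega
    exact h n (by omega)
  · rw [hx n p hm, hy n p hm]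

/-- An element of the total complex of degree `2`, given by its components. -/
def family₂ (x : g.Comp 0 2) (y : g.Comp 1 1) (z : g.Comp 2 0) (w : g.Comp 3 (-1)) : g.Family
  | 0, 2 => x
  | 1, 1 => y
  | 2, 0 => z
  | 3, Int.negSucc 0 => w
  | _, _ => 0

/-- An element of the total complex of degree `1`, given by its components. -/
def family₁ (x : g.Comp 0 1) (y : g.Comp 1 0) (z : g.Comp 2 (-1)) : g.Family
  | 0, 1 => x
  | 1, 0 => y
  | 2, Int.negSucc 0 => z
  | _, _ => 0

/-- An element of the total complex of degree `0`, given by its components. -/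
def family₀ (x : g.Comp 0 0) (y : g.Comp 1 (-1)) : g.Family
  | 0, 0 => x
  | 1, Int.negSucc 0 => y
  | _, _ => 0

/-- An element of the total complex of degree `-1`, given by its component. -/
def familyNeg (x : g.Comp 0 (-1)) : g.Family
  | 0, Int.negSucc 0 => x
  | _, _ => 0

variable {g}

lemma family₂_mem (x : g.Comp 0 2) (y : g.Comp 1 1) (z : g.Comp 2 0) (w : g.Comp 3 (-1)) :
    g.family₂ x y z w ∈ g.totalX 2 := by
  intro n p h
  unfold family₂
  split <;> first | rfl | exact absurd rfl h

lemma family₁_mem (x : g.Comp 0 1) (y : g.Comp 1 0) (z : g.Comp 2 (-1)) :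
    g.family₁ x y z ∈ g.totalX 1 := by
  intro n p h
  unfold family₁
  split <;> first | rfl | exact absurd rfl h

lemma family₀_mem (x : g.Comp 0 0) (y : g.Comp 1 (-1)) : g.family₀ x y ∈ g.totalX 0 := by
  intro n p h
  unfold family₀
  split <;> first | rfl | exact absurd rfl h

lemma familyNeg_mem (x : g.Comp 0 (-1)) : g.familyNeg x ∈ g.totalX (-1) := by
  intro n p h
  unfold familyNeg
  split <;> first | rfl | exact absurd rfl h

section Ext

variable [hb : g.IsBounded] {x y : g.Family}

lemma ext₃ (hx : x ∈ g.totalX 3) (hy : y ∈ g.totalX 3) (h0 : x 0 3 = y 0 3) (h1 : x 1 2 = y 1 2)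
    (h2 : x 2 1 = y 2 1) (h3 : x 3 0 = y 3 0) (h4 : x 4 (-1) = y 4 (-1)) : x = y := by
  refine g.ext_of_mem_totalX hx hy fun n hn => ?_
  have hn : n ≤ 4 := by omega
  interval_cases n
  exacts [h0, h1, h2, h3, h4]

lemma ext₂ (hx : x ∈ g.totalX 2) (hy : y ∈ g.totalX 2) (h0 : x 0 2 = y 0 2) (h1 : x 1 1 = y 1 1)
    (h2 : x 2 0 = y 2 0) (h3 : x 3 (-1) = y 3 (-1)) : x = y := by
  refine g.ext_of_mem_totalX hx hy fun n hn => ?_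
  have hn : n ≤ 3 := by omega
  interval_cases n
  exacts [h0, h1, h2, h3]

lemma ext₁ (hx : x ∈ g.totalX 1) (hy : y ∈ g.totalX 1) (h0 : x 0 1 = y 0 1) (h1 : x 1 0 = y 1 0)
    (h2 : x 2 (-1) = y 2 (-1)) : x = y := by
  refine g.ext_of_mem_totalX hx hy fun n hn => ?_
  have hn : n ≤ 2 := by omega
  interval_cases n
  exacts [h0, h1, h2]

lemma ext₀ (hx : x ∈ g.totalX 0) (hy : y ∈ g.totalX 0) (h0 : x 0 0 = y 0 0)
    (h1 : x 1 (-1) = y 1 (-1)) : x = y := by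
  refine g.ext_of_mem_totalX hx hy fun n hn => ?_
  have hn : n ≤ 1 := by omega
  interval_cases n
  exacts [h0, h1]

lemma extNeg (hx : x ∈ g.totalX (-1)) (hy : y ∈ g.totalX (-1)) (h0 : x 0 (-1) = y 0 (-1)) :
    x = y := by
  refine g.ext_of_mem_totalX hx hy fun n hn => ?_
  have hn : n ≤ 0 := by omega
  interval_cases n
  exact h0

lemma eq_zero_of_mem_totalX_lt {m : ℤ} (hm : m < -1) (hx : x ∈ g.totalX m) : x = 0 :=
  g.ext_of_mem_totalX hx (zero_mem _) fun n hn => by omega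

end Ext

end Faces

end CosimplicialDGLA

namespace CosimplicialDGLA

variable {k : Type u} [Field k] [CharZero k]

/-! ### Data without conditions and their defects -/

/-- A family all of whose components, and all of their images under the cosimplicial structure
maps, are central. -/
def IsCentralFamily {g : CosimplicialDGLA.{u, v} k} (x : g.Family) : Prop :=
  ∀ (m n : ℕ) (p : ℤ) (φ : SimplexCategory.mk m ⟶ SimplexCategory.mk n),
    (g.obj (.mk n)).IsCentral (DGLA.Hom.f (g.map φ) p (x m p))

lemma IsCentralFamily.isCentral {g : CosimplicialDGLA.{u, v} k} {x : g.Family}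
    (hx : IsCentralFamily x) (n : ℕ) (p : ℤ) : (g.obj (.mk n)).IsCentral (x n p) := by
  have h := hx n n p (𝟙 _)
  rw [g.map_id] at h
  exact h

variable (g : CosimplicialDGLA.{u, v} k)

/-- The data `(λ, G, c)` of a descent datum, without the conditions. -/
@[ext]
structure PreDatum where
  lam : g.Comp 0 1
  G : g.Comp 1 0
  c : g.Comp 2 (-1)

/-- The data `(H, b)` of an isomorphism of descent data, without the conditions. -/
@[ext]
structure PreIso where
  H : g.Comp 0 0
  b : g.Comp 1 (-1)

variable {g}

namespace PreDatum

/-- The defects of the four conditions in the definition of a descent datum, as an element of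
degree two of the total complex. -/
noncomputable def defect (A : PreDatum g) : g.Family :=
  g.family₂ ((g.obj (.mk 0)).curv A.lam)
    ((g.obj (.mk 1)).gaugeAct A.G (g.at₁ 1 1 A.lam) - g.at₁ 1 0 A.lam)
    ((g.obj (.mk 2)).mul ((g.obj (.mk 2)).twistedD (g.at₁ 2 0 A.lam) A.c)
      ((g.obj (.mk 2)).mul (g.at₂ 2 0 1 A.G) (g.at₂ 2 1 2 A.G)) - g.at₂ 2 0 2 A.G)
    ((g.obj (.mk 3)).mulAt (g.at₁ 3 0 A.lam) (g.at₃ 3 0 1 3 A.c)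
        ((g.obj (.mk 3)).expAd (g.at₂ 3 0 1 A.G) (g.at₃ 3 1 2 3 A.c)) -
      (g.obj (.mk 3)).mulAt (g.at₁ 3 0 A.lam) (g.at₃ 3 0 2 3 A.c) (g.at₃ 3 0 1 2 A.c))

lemma defect_mem (A : PreDatum g) : A.defect ∈ g.totalX 2 := family₂_mem _ _ _ _

/-- The sum of the data of a descent datum and an element of degree one of the total complex. -/
def add (A : PreDatum g) (u : g.Family) : PreDatum g :=
  ⟨A.lam + u 0 1, A.G + u 1 0, A.c + u 2 (-1)⟩

end PreDatum

namespace PreIso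

/-- The defects of the three conditions in the definition of an isomorphism, as an element of
degree one of the total complex. -/
noncomputable def defect (A A' : PreDatum g) (φ : PreIso g) : g.Family :=
  g.family₁ ((g.obj (.mk 0)).gaugeAct φ.H A.lam - A'.lam)
    ((g.obj (.mk 1)).mul ((g.obj (.mk 1)).twistedD (g.at₁ 1 0 A'.lam) φ.b)
      ((g.obj (.mk 1)).mul (g.at₁ 1 0 φ.H) A.G) - (g.obj (.mk 1)).mul A'.G (g.at₁ 1 1 φ.H))
    ((g.obj (.mk 2)).mulAt (g.at₁ 2 0 A'.lam) (g.at₂ 2 0 2 φ.b)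
        ((g.obj (.mk 2)).expAd (g.at₁ 2 0 φ.H) A.c) -
      (g.obj (.mk 2)).mulAt (g.at₁ 2 0 A'.lam)
        ((g.obj (.mk 2)).mulAt (g.at₁ 2 0 A'.lam) A'.c
          ((g.obj (.mk 2)).expAd (g.at₂ 2 0 1 A'.G) (g.at₂ 2 1 2 φ.b))) (g.at₂ 2 0 1 φ.b))

lemma defect_mem (A A' : PreDatum g) (φ : PreIso g) : defect A A' φ ∈ g.totalX 1 :=
  family₁_mem _ _ _

/-- The sum of the data of an isomorphism and an element of degree zero of the total complex. -/
def add (φ : PreIso g) (v : g.Family) : PreIso g := ⟨φ.H + v 0 0, φ.b + v 1 (-1)⟩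

end PreIso

/-- The defects of the two conditions in the definition of a two-isomorphism, as an element of
degree zero of the total complex. -/
noncomputable def twoIsoDefect (A' : PreDatum g) (φ ψ : PreIso g) (a : g.Comp 0 (-1)) : g.Family :=
  g.family₀
    ((g.obj (.mk 0)).mul ((g.obj (.mk 0)).twistedD A'.lam a) φ.H - ψ.H)
    ((g.obj (.mk 1)).mulAt (g.at₁ 1 0 A'.lam) ((g.obj (.mk 1)).expAd A'.G (g.at₁ 1 1 a)) φ.b -
      (g.obj (.mk 1)).mulAt (g.at₁ 1 0 A'.lam) ψ.b (g.at₁ 1 0 a))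

lemma twoIsoDefect_mem (A' : PreDatum g) (φ ψ : PreIso g) (a : g.Comp 0 (-1)) :
    twoIsoDefect A' φ ψ a ∈ g.totalX 0 := family₀_mem _ _

section Faces

variable {p q r : ℤ}

/-! #### Compatibility of iterated faces -/

section

variable {n : ℕ} {i j l : Fin (n + 1)}

lemma at₂_at₁_zero (h : i ≤ j) (x : g.Comp 0 p) :
    DGLA.Hom.f (g.map (SimplexCategory.mkOfLe i j h)) p (g.at₁ 1 0 x) = g.at₁ n i x :=
  g.map_at₁ _ rfl x

lemma at₂_at₁_one (h : i ≤ j) (x : g.Comp 0 p) :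
    DGLA.Hom.f (g.map (SimplexCategory.mkOfLe i j h)) p (g.at₁ 1 1 x) = g.at₁ n j x :=
  g.map_at₁ _ rfl x

lemma at₃_at₁_zero (h : i ≤ j) (h' : j ≤ l) (x : g.Comp 0 p) :
    DGLA.Hom.f (g.map (SimplexCategory.mkOfLeComp i j l h h')) p (g.at₁ 2 0 x) = g.at₁ n i x :=
  g.map_at₁ _ rfl x

lemma at₃_at₂_zero_one (h : i ≤ j) (h' : j ≤ l) (x : g.Comp 1 p) :
    DGLA.Hom.f (g.map (SimplexCategory.mkOfLeComp i j l h h')) p (g.at₂ 2 0 1 x) =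
      g.at₂ n i j x h := g.map_at₂ _ rfl rfl _ _ x

lemma at₃_at₂_one_two (h : i ≤ j) (h' : j ≤ l) (x : g.Comp 1 p) :
    DGLA.Hom.f (g.map (SimplexCategory.mkOfLeComp i j l h h')) p (g.at₂ 2 1 2 x) =
      g.at₂ n j l x h' := g.map_at₂ _ rfl rfl _ _ x

lemma at₃_at₂_zero_two (h : i ≤ j) (h' : j ≤ l) (x : g.Comp 1 p) :
    DGLA.Hom.f (g.map (SimplexCategory.mkOfLeComp i j l h h')) p (g.at₂ 2 0 2 x) =
      g.at₂ n i l x (h.trans h') := g.map_at₂ _ rfl rfl _ _ x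

end

variable [hg : ∀ n : ℕ, (g.obj (.mk n)).IsNilp]

/-! #### The defects on the faces of a simplex -/

namespace PreDatum

variable (A : PreDatum g) {n : ℕ}

lemma curv_at₁ (i : Fin (n + 1)) :
    (g.obj (.mk n)).curv (g.at₁ n i A.lam) = g.at₁ n i (A.defect 0 2) := by
  have hm := (g.map (SimplexCategory.const (.mk 0) (.mk n) i)).map_bracket
  have hd := (g.map (SimplexCategory.const (.mk 0) (.mk n) i)).map_d
  change _ = DGLA.Hom.f (g.map (SimplexCategory.const (.mk 0) (.mk n) i)) 2
    ((g.obj (.mk 0)).curv A.lam)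
  rw [DGLA.curv, DGLA.curv, map_add, map_smul, hm, hd]
  rfl

lemma gaugeAct_at₂ (i j : Fin (n + 1)) (h : i ≤ j) :
    (g.obj (.mk n)).gaugeAct (g.at₂ n i j A.G h) (g.at₁ n j A.lam) =
      g.at₁ n i A.lam + g.at₂ n i j (A.defect 1 1) h := by
  have h1 : (g.obj (.mk 1)).gaugeAct A.G (g.at₁ 1 1 A.lam) = g.at₁ 1 0 A.lam + A.defect 1 1 :=
    (add_sub_cancel _ _).symm
  have h2 := congrArg (DGLA.Hom.f (g.map (SimplexCategory.mkOfLe i j h)) 1) h1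
  rw [DGLA.map_gaugeAct, map_add, at₂_at₁_one, at₂_at₁_zero] at h2
  exact h2

lemma mul_at₃ (i j l : Fin (n + 1)) (h : i ≤ j) (h' : j ≤ l) :
    (g.obj (.mk n)).mul ((g.obj (.mk n)).twistedD (g.at₁ n i A.lam) (g.at₃ n i j l A.c h h'))
      ((g.obj (.mk n)).mul (g.at₂ n i j A.G h) (g.at₂ n j l A.G h')) =
      g.at₂ n i l A.G (h.trans h') + g.at₃ n i j l (A.defect 2 0) h h' := by
  have h1 : (g.obj (.mk 2)).mul ((g.obj (.mk 2)).twistedD (g.at₁ 2 0 A.lam) A.c)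
      ((g.obj (.mk 2)).mul (g.at₂ 2 0 1 A.G) (g.at₂ 2 1 2 A.G)) = g.at₂ 2 0 2 A.G + A.defect 2 0 :=
    (add_sub_cancel _ _).symm
  have h2 := congrArg (DGLA.Hom.f (g.map (SimplexCategory.mkOfLeComp i j l h h')) 0) h1
  rw [DGLA.map_mul, DGLA.map_mul, DGLA.map_twistedD, map_add, at₃_at₁_zero, at₃_at₂_zero_one,
    at₃_at₂_one_two, at₃_at₂_zero_two] at h2
  exact h2

/-- The cocycle condition on the face `φ`, up to the defect. The face is given by a morphism of the
simplex category, since there is no notation for the faces with four vertices. -/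
lemma mulAt_of_map (φ : SimplexCategory.mk 3 ⟶ SimplexCategory.mk n) {i j l m : Fin (n + 1)}
    (hi : φ.toOrderHom 0 = i) (hj : φ.toOrderHom 1 = j) (hl : φ.toOrderHom 2 = l)
    (hm : φ.toOrderHom 3 = m) (hij : i ≤ j) (hjl : j ≤ l) (hlm : l ≤ m) :
    (g.obj (.mk n)).mulAt (g.at₁ n i A.lam) (g.at₃ n i j m A.c hij (hjl.trans hlm))
        ((g.obj (.mk n)).expAd (g.at₂ n i j A.G hij) (g.at₃ n j l m A.c hjl hlm)) =
      (g.obj (.mk n)).mulAt (g.at₁ n i A.lam) (g.at₃ n i l m A.c (hij.trans hjl) hlm)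
        (g.at₃ n i j l A.c hij hjl) + DGLA.Hom.f (g.map φ) (-1) (A.defect 3 (-1)) := by
  have h1 : (g.obj (.mk 3)).mulAt (g.at₁ 3 0 A.lam) (g.at₃ 3 0 1 3 A.c)
        ((g.obj (.mk 3)).expAd (g.at₂ 3 0 1 A.G) (g.at₃ 3 1 2 3 A.c)) =
      (g.obj (.mk 3)).mulAt (g.at₁ 3 0 A.lam) (g.at₃ 3 0 2 3 A.c) (g.at₃ 3 0 1 2 A.c) +
        A.defect 3 (-1) := (add_sub_cancel _ _).symm
  have h2 := congrArg (DGLA.Hom.f (g.map φ) (-1)) h1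
  rw [DGLA.map_mulAt, map_add, DGLA.map_mulAt, DGLA.map_expAd, g.map_at₁ φ hi,
    g.map_at₃ φ hi hj hm _ _ hij (hjl.trans hlm), g.map_at₂ φ hi hj _ hij,
    g.map_at₃ φ hj hl hm _ _ hjl hlm, g.map_at₃ φ hi hl hm _ _ (hij.trans hjl) hlm,
    g.map_at₃ φ hi hj hl _ _ hij hjl] at h2
  exact h2

end PreDatum

namespace PreIso

variable (A A' : PreDatum g) (φ : PreIso g) {n : ℕ}

lemma gaugeAct_at₁ (i : Fin (n + 1)) :
    (g.obj (.mk n)).gaugeAct (g.at₁ n i φ.H) (g.at₁ n i A.lam) =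
      g.at₁ n i A'.lam + g.at₁ n i (defect A A' φ 0 1) := by
  have h1 : (g.obj (.mk 0)).gaugeAct φ.H A.lam = A'.lam + defect A A' φ 0 1 :=
    (add_sub_cancel _ _).symm
  have h2 := congrArg (DGLA.Hom.f (g.map (SimplexCategory.const (.mk 0) (.mk n) i)) 1) h1
  rw [DGLA.map_gaugeAct, map_add] at h2
  exact h2

lemma mul_at₂ (i j : Fin (n + 1)) (h : i ≤ j) :
    (g.obj (.mk n)).mul ((g.obj (.mk n)).twistedD (g.at₁ n i A'.lam) (g.at₂ n i j φ.b h))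
      ((g.obj (.mk n)).mul (g.at₁ n i φ.H) (g.at₂ n i j A.G h)) =
      (g.obj (.mk n)).mul (g.at₂ n i j A'.G h) (g.at₁ n j φ.H) +
        g.at₂ n i j (defect A A' φ 1 0) h := by
  have h1 : (g.obj (.mk 1)).mul ((g.obj (.mk 1)).twistedD (g.at₁ 1 0 A'.lam) φ.b)
      ((g.obj (.mk 1)).mul (g.at₁ 1 0 φ.H) A.G) =
      (g.obj (.mk 1)).mul A'.G (g.at₁ 1 1 φ.H) + defect A A' φ 1 0 :=
    (add_sub_cancel _ _).symm
  have h2 := congrArg (DGLA.Hom.f (g.map (SimplexCategory.mkOfLe i j h)) 0) h1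
  rw [DGLA.map_mul, DGLA.map_mul, DGLA.map_twistedD, map_add, DGLA.map_mul, at₂_at₁_zero,
    at₂_at₁_zero, at₂_at₁_one] at h2
  exact h2

lemma mulAt_at₃ (i j l : Fin (n + 1)) (h : i ≤ j) (h' : j ≤ l) :
    (g.obj (.mk n)).mulAt (g.at₁ n i A'.lam) (g.at₂ n i l φ.b (h.trans h'))
        ((g.obj (.mk n)).expAd (g.at₁ n i φ.H) (g.at₃ n i j l A.c h h')) =
      (g.obj (.mk n)).mulAt (g.at₁ n i A'.lam)
        ((g.obj (.mk n)).mulAt (g.at₁ n i A'.lam) (g.at₃ n i j l A'.c h h')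
          ((g.obj (.mk n)).expAd (g.at₂ n i j A'.G h) (g.at₂ n j l φ.b h'))) (g.at₂ n i j φ.b h) +
        g.at₃ n i j l (defect A A' φ 2 (-1)) h h' := by
  have h1 : (g.obj (.mk 2)).mulAt (g.at₁ 2 0 A'.lam) (g.at₂ 2 0 2 φ.b)
        ((g.obj (.mk 2)).expAd (g.at₁ 2 0 φ.H) A.c) =
      (g.obj (.mk 2)).mulAt (g.at₁ 2 0 A'.lam)
        ((g.obj (.mk 2)).mulAt (g.at₁ 2 0 A'.lam) A'.c
          ((g.obj (.mk 2)).expAd (g.at₂ 2 0 1 A'.G) (g.at₂ 2 1 2 φ.b))) (g.at₂ 2 0 1 φ.b) +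
        defect A A' φ 2 (-1) := (add_sub_cancel _ _).symm
  have h2 := congrArg (DGLA.Hom.f (g.map (SimplexCategory.mkOfLeComp i j l h h')) (-1)) h1
  rw [DGLA.map_mulAt, map_add, DGLA.map_mulAt, DGLA.map_mulAt, DGLA.map_expAd, DGLA.map_expAd,
    at₃_at₁_zero, at₃_at₁_zero, at₃_at₂_zero_one, at₃_at₂_one_two, at₃_at₂_zero_two,
    at₃_at₂_zero_one] at h2
  exact h2

end PreIso

lemma mul_at₁_twoIsoDefect (A' : PreDatum g) (φ ψ : PreIso g) (a : g.Comp 0 (-1)) {n : ℕ}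
    (i : Fin (n + 1)) :
    (g.obj (.mk n)).mul ((g.obj (.mk n)).twistedD (g.at₁ n i A'.lam) (g.at₁ n i a))
      (g.at₁ n i φ.H) = g.at₁ n i ψ.H + g.at₁ n i (twoIsoDefect A' φ ψ a 0 0) := by
  have h1 : (g.obj (.mk 0)).mul ((g.obj (.mk 0)).twistedD A'.lam a) φ.H =
      ψ.H + twoIsoDefect A' φ ψ a 0 0 := (add_sub_cancel _ _).symm
  have h2 := congrArg (DGLA.Hom.f (g.map (SimplexCategory.const (.mk 0) (.mk n) i)) 0) h1
  rw [DGLA.map_mul, map_add, DGLA.map_twistedD] at h2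
  exact h2

lemma mulAt_at₂_twoIsoDefect (A' : PreDatum g) (φ ψ : PreIso g) (a : g.Comp 0 (-1)) {n : ℕ}
    (i j : Fin (n + 1)) (h : i ≤ j) :
    (g.obj (.mk n)).mulAt (g.at₁ n i A'.lam)
        ((g.obj (.mk n)).expAd (g.at₂ n i j A'.G h) (g.at₁ n j a)) (g.at₂ n i j φ.b h) =
      (g.obj (.mk n)).mulAt (g.at₁ n i A'.lam) (g.at₂ n i j ψ.b h) (g.at₁ n i a) +
        g.at₂ n i j (twoIsoDefect A' φ ψ a 1 (-1)) h := by
  have h1 : (g.obj (.mk 1)).mulAt (g.at₁ 1 0 A'.lam)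
        ((g.obj (.mk 1)).expAd A'.G (g.at₁ 1 1 a)) φ.b =
      (g.obj (.mk 1)).mulAt (g.at₁ 1 0 A'.lam) ψ.b (g.at₁ 1 0 a) +
        twoIsoDefect A' φ ψ a 1 (-1) := (add_sub_cancel _ _).symm
  have h2 := congrArg (DGLA.Hom.f (g.map (SimplexCategory.mkOfLe i j h)) (-1)) h1
  rw [DGLA.map_mulAt, map_add, DGLA.map_mulAt, DGLA.map_expAd, at₂_at₁_zero, at₂_at₁_zero,
    at₂_at₁_one] at h2
  exact h2

end Faces

end CosimplicialDGLA

namespace CosimplicialDGLA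

variable {k : Type u} [Field k] [CharZero k] {g : CosimplicialDGLA.{u, v} k}
  [hg : ∀ n : ℕ, (g.obj (.mk n)).IsNilp] [hb : g.IsBounded]

lemma totalD_neg_one (g : CosimplicialDGLA.{u, v} k) [g.IsBounded] (x : g.Family) (n : ℕ) :
    g.totalD x (n + 1) (-1) = g.coboundary n (-1) (x n (-1)) := by
  rw [totalD_succ g x n (p := -2) (q := -1) rfl, Subsingleton.elim (x (n + 1) (-2)) 0, map_zero,
    smul_zero, zero_add]

/-! ### The defects satisfy the equations of the total complex -/

lemma PreDatum.isCentral_curv_at₁ {A : PreDatum g} (hA : IsCentralFamily A.defect) {n : ℕ}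
    (i : Fin (n + 1)) : (g.obj (.mk n)).IsCentral ((g.obj (.mk n)).curv (g.at₁ n i A.lam)) := by
  rw [A.curv_at₁]
  exact hA _ _ _ _

/-- If the defect of the data of a descent datum is central, it is a cocycle of degree two. -/
theorem PreDatum.totalD_defect {A : PreDatum g} (hA : IsCentralFamily A.defect) :
    g.totalD A.defect = 0 := by
  refine ext₃ (g.totalD_mem (m := 2) rfl _ A.defect_mem) (zero_mem _) ?_ ?_ ?_ ?_ ?_
  · rw [g.totalD_zero _ (p := 2) (q := 3) rfl]
    exact DGLA.d_curv_eq_zero (hA.isCentral 0 2)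
  · rw [g.totalD_one _ (p := 1) (q := 2) rfl, DGLA.d_gauge_defect (PreDatum.isCentral_curv_at₁ hA 1)
      (hA.isCentral 1 1) (add_sub_cancel _ _).symm, A.curv_at₁, A.curv_at₁]
    exact neg_add_cancel _
  · have h : (g.obj (.mk 2)).d 0 1 rfl (A.defect 2 0) = g.at₂ 2 0 2 (A.defect 1 1) -
        g.at₂ 2 0 1 (A.defect 1 1) - g.at₂ 2 1 2 (A.defect 1 1) :=
      DGLA.d_triangle_defect (PreDatum.isCentral_curv_at₁ hA 0)
        (hA _ _ _ _) (hA _ _ _ _) (hA.isCentral 2 0) (A.gaugeAct_at₂ 0 1 _) (A.gaugeAct_at₂ 1 2 _)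
        (A.gaugeAct_at₂ 0 2 _) (add_sub_cancel _ _).symm
    rw [g.totalD_two _ (p := 0) (q := 1) rfl, h]
    change _ = (0 : g.Comp 2 1)
    abel
  · rw [g.totalD_three _ (p := -1) (q := 0) rfl, DGLA.d_tetrahedron_defect
      (PreDatum.isCentral_curv_at₁ hA 0) (hA _ _ _ _) (hA _ _ _ _) (hA _ _ _ _)
      (hA.isCentral 3 (-1)) (A.gaugeAct_at₂ 0 1 _) (A.mul_at₃ 0 1 2 _ _) (A.mul_at₃ 0 1 3 _ _)
      (A.mul_at₃ 0 2 3 _ _) (A.mul_at₃ 1 2 3 _ _) (add_sub_cancel _ _).symm]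
    exact neg_add_cancel _
  · refine (g.totalD_neg_one _ 3).trans ?_
    rw [g.coboundary_three]
    exact DGLA.pentagon_defect (PreDatum.isCentral_curv_at₁ hA 0)
      (PreDatum.isCentral_curv_at₁ hA 1) (hA _ _ _ _) (hA _ _ _ _) (hA _ _ _ _) (hA _ _ _ _)
      (hA _ _ _ _) (hA _ _ _ _) (hA _ _ _ _) (A.gaugeAct_at₂ 0 1 (by decide))
      (A.mul_at₃ 0 1 2 (by decide) (by decide))
      (A.mulAt_of_map (SimplexCategory.δ 4) (i := 0) (j := 1) (l := 2) (m := 3) rfl rfl rfl rfl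
        (by decide) (by decide) (by decide))
      (A.mulAt_of_map (SimplexCategory.δ 3) (i := 0) (j := 1) (l := 2) (m := 4) rfl rfl rfl rfl
        (by decide) (by decide) (by decide))
      (A.mulAt_of_map (SimplexCategory.δ 2) (i := 0) (j := 1) (l := 3) (m := 4) rfl rfl rfl rfl
        (by decide) (by decide) (by decide))
      (A.mulAt_of_map (SimplexCategory.δ 1) (i := 0) (j := 2) (l := 3) (m := 4) rfl rfl rfl rfl
        (by decide) (by decide) (by decide))
      (A.mulAt_of_map (SimplexCategory.δ 0) (i := 1) (j := 2) (l := 3) (m := 4) rfl rfl rfl rfl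
        (by decide) (by decide) (by decide))

/-- If the defects are central, the defect of an isomorphism is a primitive of the difference of the
defects of its source and of its target. -/
theorem PreIso.totalD_defect {A A' : PreDatum g} {φ : PreIso g} (hA : IsCentralFamily A.defect)
    (hA' : IsCentralFamily A'.defect) (hφ : IsCentralFamily (defect A A' φ)) :
    g.totalD (defect A A' φ) = A.defect - A'.defect := by
  refine ext₂ (g.totalD_mem (m := 1) rfl _ (defect_mem A A' φ))
    (sub_mem A.defect_mem A'.defect_mem) ?_ ?_ ?_ ?_
  · rw [g.totalD_zero _ (p := 1) (q := 2) rfl]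
    exact DGLA.d_gauge_defect (hA.isCentral 0 2) (hφ.isCentral 0 1) (add_sub_cancel _ _).symm
  · rw [g.totalD_one _ (p := 0) (q := 1) rfl]
    exact DGLA.d_square_defect (PreDatum.isCentral_curv_at₁ hA' 0) (hA.isCentral 1 1)
      (hφ _ _ _ _) (hφ _ _ _ _) (hφ.isCentral 1 0) (add_sub_cancel _ _).symm
      (add_sub_cancel _ _).symm (gaugeAct_at₁ A A' φ 0) (gaugeAct_at₁ A A' φ 1)
      (add_sub_cancel _ _).symm
  · rw [g.totalD_two _ (p := -1) (q := 0) rfl]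
    exact DGLA.d_prism_defect (PreDatum.isCentral_curv_at₁ hA' 0) (hφ _ _ _ _)
      (hA' _ _ _ _) (hφ _ _ _ _) (hφ _ _ _ _) (hA.isCentral 2 0) (hA'.isCentral 2 0)
      (hφ.isCentral 2 (-1)) (gaugeAct_at₁ A A' φ 0) (A'.gaugeAct_at₂ 0 1 (by decide))
      (mul_at₂ A A' φ 0 1 (by decide)) (mul_at₂ A A' φ 1 2 (by decide))
      (mul_at₂ A A' φ 0 2 (by decide)) (add_sub_cancel _ _).symm (add_sub_cancel _ _).symm
      (add_sub_cancel _ _).symm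
  · refine (g.totalD_neg_one _ 2).trans ?_
    rw [g.coboundary_two]
    exact DGLA.prism_defect (PreDatum.isCentral_curv_at₁ hA 0) (PreDatum.isCentral_curv_at₁ hA' 0)
      (PreDatum.isCentral_curv_at₁ hA' 1) (hφ _ _ _ _) (hA' _ _ _ _) (hφ _ _ _ _) (hA' _ _ _ _)
      (hφ _ _ _ _) (hφ _ _ _ _) (hφ _ _ _ _) (hφ _ _ _ _) (hA.isCentral 3 (-1))
      (hA'.isCentral 3 (-1)) (gaugeAct_at₁ A A' φ 0) (A'.gaugeAct_at₂ 0 1 (by decide))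
      (mul_at₂ A A' φ 0 1 (by decide)) (A'.mul_at₃ 0 1 2 (by decide) (by decide))
      (mulAt_at₃ A A' φ 0 1 2 (by decide) (by decide))
      (mulAt_at₃ A A' φ 0 1 3 (by decide) (by decide))
      (mulAt_at₃ A A' φ 0 2 3 (by decide) (by decide))
      (mulAt_at₃ A A' φ 1 2 3 (by decide) (by decide))
      (add_sub_cancel _ _).symm (add_sub_cancel _ _).symm

/-- If the defects are central, the defect of a two-isomorphism is a primitive of the difference of
the defects of the two isomorphisms. -/
theorem totalD_twoIsoDefect {A A' : PreDatum g} {φ ψ : PreIso g} {a : g.Comp 0 (-1)}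
    (hA' : A'.defect = 0) (hφ : IsCentralFamily (PreIso.defect A A' φ))
    (hψ : IsCentralFamily (PreIso.defect A A' ψ)) (ha : IsCentralFamily (twoIsoDefect A' φ ψ a)) :
    g.totalD (twoIsoDefect A' φ ψ a) = PreIso.defect A A' ψ - PreIso.defect A A' φ := by
  have hA'' : IsCentralFamily A'.defect := fun m n p χ => by
    rw [hA', Pi.zero_apply, Pi.zero_apply, map_zero]
    exact DGLA.isCentral_zero
  have hz : ∀ n p, A'.defect n p = 0 := fun n p => by rw [hA']; rfl
  refine ext₁ (g.totalD_mem (m := 0) rfl _ (twoIsoDefect_mem A' φ ψ a))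
    (sub_mem (PreIso.defect_mem A A' ψ) (PreIso.defect_mem A A' φ)) ?_ ?_ ?_
  · rw [g.totalD_zero _ (p := 0) (q := 1) rfl]
    exact DGLA.d_bigon_defect (hA''.isCentral 0 2) (hφ.isCentral 0 1) (ha.isCentral 0 0)
      (add_sub_cancel _ _).symm (add_sub_cancel _ _).symm (add_sub_cancel _ _).symm
  · rw [g.totalD_one _ (p := -1) (q := 0) rfl]
    exact DGLA.d_cylinder_defect (PreDatum.isCentral_curv_at₁ hA'' 0) (hφ.isCentral 1 0)
      (ha _ _ _ _) (ha _ _ _ _) (ha.isCentral 1 (-1)) (sub_eq_zero.1 (hz 1 1))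
      (add_sub_cancel _ _).symm (add_sub_cancel _ _).symm (mul_at₁_twoIsoDefect A' φ ψ a 0)
      (mul_at₁_twoIsoDefect A' φ ψ a 1) (add_sub_cancel _ _).symm
  · refine (g.totalD_neg_one _ 1).trans ?_
    rw [g.coboundary_one]
    have h01 := A'.gaugeAct_at₂ (n := 2) 0 1 (by decide)
    rw [hz, at₂, at₂, map_zero, add_zero] at h01
    exact DGLA.cylinder_defect (PreDatum.isCentral_curv_at₁ hA'' 0)
      (PreDatum.isCentral_curv_at₁ hA'' 1) (ha _ _ _ _) (hφ.isCentral 2 (-1)) (hψ.isCentral 2 (-1))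
      (ha _ _ _ _) (ha _ _ _ _) (ha _ _ _ _) h01 (sub_eq_zero.1 (hz 2 0))
      (mul_at₁_twoIsoDefect A' φ ψ a 0) (mulAt_at₂_twoIsoDefect A' φ ψ a 0 1 (by decide))
      (mulAt_at₂_twoIsoDefect A' φ ψ a 1 2 (by decide))
      (mulAt_at₂_twoIsoDefect A' φ ψ a 0 2 (by decide)) (add_sub_cancel _ _).symm
      (add_sub_cancel _ _).symm

end CosimplicialDGLA

namespace CosimplicialDGLA

variable {k : Type u} [Field k] [CharZero k] {g : CosimplicialDGLA.{u, v} k}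

/-! ### The effect of central modifications on the defects -/

section

variable {p : ℤ} {n : ℕ}

lemma at₁_add (i : Fin (n + 1)) (x y : g.Comp 0 p) :
    g.at₁ n i (x + y) = g.at₁ n i x + g.at₁ n i y := map_add _ _ _

lemma at₂_add (i j : Fin (n + 1)) (h : i ≤ j) (x y : g.Comp 1 p) :
    g.at₂ n i j (x + y) h = g.at₂ n i j x h + g.at₂ n i j y h := map_add _ _ _

lemma at₃_add (i j l : Fin (n + 1)) (h : i ≤ j) (h' : j ≤ l) (x y : g.Comp 2 p) :
    g.at₃ n i j l (x + y) h h' = g.at₃ n i j l x h h' + g.at₃ n i j l y h h' := map_add _ _ _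

variable {x : g.Family} (hx : IsCentralFamily x)

include hx

lemma IsCentralFamily.at₁ (i : Fin (n + 1)) :
    (g.obj (.mk n)).IsCentral (g.at₁ n i (x 0 p)) := hx _ _ _ _

lemma IsCentralFamily.at₂ (i j : Fin (n + 1)) (h : i ≤ j) :
    (g.obj (.mk n)).IsCentral (g.at₂ n i j (x 1 p) h) := hx _ _ _ _

lemma IsCentralFamily.at₃ (i j l : Fin (n + 1)) (h : i ≤ j) (h' : j ≤ l) :
    (g.obj (.mk n)).IsCentral (g.at₃ n i j l (x 2 p) h h') := hx _ _ _ _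

end

variable [hg : ∀ n : ℕ, (g.obj (.mk n)).IsNilp] [hb : g.IsBounded]

/-- A central modification changes the defect by a coboundary. -/
theorem PreDatum.defect_add {A : PreDatum g} (hA : IsCentralFamily A.defect) {x : g.Family}
    (hx : IsCentralFamily x) (hx₁ : x ∈ g.totalX 1) :
    (A.add x).defect = A.defect + g.totalD x := by
  refine ext₂ (A.add x).defect_mem (add_mem A.defect_mem (g.totalD_mem (m := 1) rfl _ hx₁)) ?_ ?_ ?_
    ?_
  · rw [Pi.add_apply, Pi.add_apply, g.totalD_zero _ (p := 1) (q := 2) rfl]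
    exact DGLA.curv_add (hx.isCentral 0 1)
  · rw [Pi.add_apply, Pi.add_apply, g.totalD_one _ (p := 0) (q := 1) rfl]
    change (g.obj (.mk 1)).gaugeAct (A.G + x 1 0) (g.at₁ 1 1 (A.lam + x 0 1)) -
      g.at₁ 1 0 (A.lam + x 0 1) = (g.obj (.mk 1)).gaugeAct A.G (g.at₁ 1 1 A.lam) -
        g.at₁ 1 0 A.lam + _
    rw [at₁_add, at₁_add, DGLA.gaugeAct_add_left (hx.isCentral 1 0),
      DGLA.gaugeAct_add_right (hx.at₁ 1)]
    abel
  · rw [Pi.add_apply, Pi.add_apply, g.totalD_two _ (p := -1) (q := 0) rfl]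
    change (g.obj (.mk 2)).mul ((g.obj (.mk 2)).twistedD (g.at₁ 2 0 (A.lam + x 0 1))
      (A.c + x 2 (-1))) ((g.obj (.mk 2)).mul (g.at₂ 2 0 1 (A.G + x 1 0))
      (g.at₂ 2 1 2 (A.G + x 1 0))) - g.at₂ 2 0 2 (A.G + x 1 0) =
      (g.obj (.mk 2)).mul ((g.obj (.mk 2)).twistedD (g.at₁ 2 0 A.lam) A.c)
      ((g.obj (.mk 2)).mul (g.at₂ 2 0 1 A.G) (g.at₂ 2 1 2 A.G)) - g.at₂ 2 0 2 A.G + _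
    rw [at₁_add, at₂_add, at₂_add, at₂_add, DGLA.twistedD_add_left (hx.at₁ 0), DGLA.twistedD_add,
      (hx.isCentral 2 (-1)).twistedD, DGLA.mul_add_left ((hx.isCentral 2 (-1)).d _),
      DGLA.mul_add_left (hx.at₂ 0 1 _), DGLA.mul_add_right (hx.at₂ 1 2 _),
      DGLA.mul_add_right (hx.at₂ 0 1 _), DGLA.mul_add_right (hx.at₂ 1 2 _)]
    abel
  · rw [Pi.add_apply, Pi.add_apply, g.totalD_neg_one _ 2, g.coboundary_two]
    change (g.obj (.mk 3)).mulAt (g.at₁ 3 0 (A.lam + x 0 1)) (g.at₃ 3 0 1 3 (A.c + x 2 (-1)))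
        ((g.obj (.mk 3)).expAd (g.at₂ 3 0 1 (A.G + x 1 0)) (g.at₃ 3 1 2 3 (A.c + x 2 (-1)))) -
      (g.obj (.mk 3)).mulAt (g.at₁ 3 0 (A.lam + x 0 1)) (g.at₃ 3 0 2 3 (A.c + x 2 (-1)))
        (g.at₃ 3 0 1 2 (A.c + x 2 (-1))) =
      (g.obj (.mk 3)).mulAt (g.at₁ 3 0 A.lam) (g.at₃ 3 0 1 3 A.c)
        ((g.obj (.mk 3)).expAd (g.at₂ 3 0 1 A.G) (g.at₃ 3 1 2 3 A.c)) -
      (g.obj (.mk 3)).mulAt (g.at₁ 3 0 A.lam) (g.at₃ 3 0 2 3 A.c) (g.at₃ 3 0 1 2 A.c) + _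
    have hl := PreDatum.isCentral_curv_at₁ hA (n := 3) 0
    rw [at₁_add, at₂_add, at₃_add, at₃_add, at₃_add, at₃_add, DGLA.mulAt_add_left (hx.at₁ 0),
      DGLA.mulAt_add_left (hx.at₁ 0), DGLA.expAd_add_left (hx.at₂ 0 1 _), DGLA.expAd_add,
      (hx.at₃ 1 2 3 _ _).expAd, DGLA.mulAt_add_central_right hl (hx.at₃ 1 2 3 _ _),
      DGLA.mulAt_add_central_left hl (hx.at₃ 0 1 3 _ _),
      DGLA.mulAt_add_central_left hl (hx.at₃ 0 2 3 _ _),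
      DGLA.mulAt_add_central_right hl (hx.at₃ 0 1 2 _ _)]
    abel

theorem PreIso.defect_add {A A' : PreDatum g} (φ : PreIso g)
    (hA' : IsCentralFamily A'.defect) {x x' y : g.Family} (hx : IsCentralFamily x)
    (hx' : IsCentralFamily x') (hy : IsCentralFamily y) (hx₁ : x ∈ g.totalX 1)
    (hx₁' : x' ∈ g.totalX 1) (hy₀ : y ∈ g.totalX 0) :
    defect (A.add x) (A'.add x') (φ.add y) = defect A A' φ + x - x' - g.totalD y := by
  refine ext₁ (defect_mem _ _ _) (sub_mem (sub_mem (add_mem (defect_mem _ _ _) hx₁) hx₁')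
    (g.totalD_mem (m := 0) rfl _ hy₀)) ?_ ?_ ?_
  · simp only [Pi.add_apply, Pi.sub_apply]
    rw [g.totalD_zero _ (p := 0) (q := 1) rfl]
    change (g.obj (.mk 0)).gaugeAct (φ.H + y 0 0) (A.lam + x 0 1) - (A'.lam + x' 0 1) =
      (g.obj (.mk 0)).gaugeAct φ.H A.lam - A'.lam + _ - _ - _
    rw [DGLA.gaugeAct_add_left (hy.isCentral 0 0), DGLA.gaugeAct_add_right (hx.isCentral 0 1)]
    abel
  · simp only [Pi.add_apply, Pi.sub_apply]
    rw [g.totalD_one _ (p := -1) (q := 0) rfl]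
    change (g.obj (.mk 1)).mul ((g.obj (.mk 1)).twistedD (g.at₁ 1 0 (A'.lam + x' 0 1))
        (φ.b + y 1 (-1))) ((g.obj (.mk 1)).mul (g.at₁ 1 0 (φ.H + y 0 0)) (A.G + x 1 0)) -
        (g.obj (.mk 1)).mul (A'.G + x' 1 0) (g.at₁ 1 1 (φ.H + y 0 0)) =
      (g.obj (.mk 1)).mul ((g.obj (.mk 1)).twistedD (g.at₁ 1 0 A'.lam) φ.b)
      ((g.obj (.mk 1)).mul (g.at₁ 1 0 φ.H) A.G) - (g.obj (.mk 1)).mul A'.G (g.at₁ 1 1 φ.H) + _ - _ -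
        _
    rw [at₁_add, at₁_add, at₁_add, DGLA.twistedD_add_left (hx'.at₁ 0), DGLA.twistedD_add,
      (hy.isCentral 1 (-1)).twistedD, DGLA.mul_add_left ((hy.isCentral 1 (-1)).d _),
      DGLA.mul_add_left (hy.at₁ 0), DGLA.mul_add_right (hx.isCentral 1 0),
      DGLA.mul_add_right (hy.at₁ 0), DGLA.mul_add_right (hx.isCentral 1 0),
      DGLA.mul_add_left (hx'.isCentral 1 0), DGLA.mul_add_right (hy.at₁ 1)]
    abel
  · simp only [Pi.add_apply, Pi.sub_apply]
    rw [g.totalD_neg_one _ 1, g.coboundary_one]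
    change (g.obj (.mk 2)).mulAt (g.at₁ 2 0 (A'.lam + x' 0 1)) (g.at₂ 2 0 2 (φ.b + y 1 (-1)))
        ((g.obj (.mk 2)).expAd (g.at₁ 2 0 (φ.H + y 0 0)) (A.c + x 2 (-1))) -
      (g.obj (.mk 2)).mulAt (g.at₁ 2 0 (A'.lam + x' 0 1))
        ((g.obj (.mk 2)).mulAt (g.at₁ 2 0 (A'.lam + x' 0 1)) (A'.c + x' 2 (-1))
          ((g.obj (.mk 2)).expAd (g.at₂ 2 0 1 (A'.G + x' 1 0)) (g.at₂ 2 1 2 (φ.b + y 1 (-1)))))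
        (g.at₂ 2 0 1 (φ.b + y 1 (-1))) =
      (g.obj (.mk 2)).mulAt (g.at₁ 2 0 A'.lam) (g.at₂ 2 0 2 φ.b)
        ((g.obj (.mk 2)).expAd (g.at₁ 2 0 φ.H) A.c) -
      (g.obj (.mk 2)).mulAt (g.at₁ 2 0 A'.lam)
        ((g.obj (.mk 2)).mulAt (g.at₁ 2 0 A'.lam) A'.c
          ((g.obj (.mk 2)).expAd (g.at₂ 2 0 1 A'.G) (g.at₂ 2 1 2 φ.b))) (g.at₂ 2 0 1 φ.b) + _ - _ -
        _
    have hl := PreDatum.isCentral_curv_at₁ hA' (n := 2) 0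
    rw [at₁_add, at₁_add, at₂_add, at₂_add, at₂_add, at₂_add, DGLA.mulAt_add_left (hx'.at₁ 0),
      DGLA.mulAt_add_left (hx'.at₁ 0), DGLA.mulAt_add_left (hx'.at₁ 0),
      DGLA.expAd_add_left (hy.at₁ 0), DGLA.expAd_add, (hx.isCentral 2 (-1)).expAd,
      DGLA.expAd_add_left (hx'.at₂ 0 1 _), DGLA.expAd_add, (hy.at₂ 1 2 _).expAd,
      DGLA.mulAt_add_central_right hl (hx.isCentral 2 (-1)),
      DGLA.mulAt_add_central_left hl (hy.at₂ 0 2 _),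
      DGLA.mulAt_add_central_right hl (hy.at₂ 1 2 _),
      DGLA.mulAt_add_central_left hl (hx'.isCentral 2 (-1)),
      DGLA.mulAt_add_central_right hl (hy.at₂ 0 1 _),
      DGLA.mulAt_add_central_left hl (hy.at₂ 1 2 _),
      DGLA.mulAt_add_central_left hl (hx'.isCentral 2 (-1))]
    abel

theorem twoIsoDefect_add {A' : PreDatum g} (hA' : IsCentralFamily A'.defect) (φ ψ : PreIso g)
    (a : g.Comp 0 (-1)) {x y z : g.Family} (hx : IsCentralFamily x) (hy : IsCentralFamily y)
    (hz : IsCentralFamily z) (hx₀ : x ∈ g.totalX 0) (hy₀ : y ∈ g.totalX 0)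
    (hz₁ : z ∈ g.totalX (-1)) :
    twoIsoDefect A' (φ.add x) (ψ.add y) (a + z 0 (-1)) =
      twoIsoDefect A' φ ψ a + x - y + g.totalD z := by
  refine ext₀ (twoIsoDefect_mem _ _ _ _) (add_mem (sub_mem (add_mem (twoIsoDefect_mem _ _ _ _) hx₀)
    hy₀) (g.totalD_mem (m := -1) rfl _ hz₁)) ?_ ?_
  · simp only [Pi.add_apply, Pi.sub_apply]
    rw [g.totalD_zero _ (p := -1) (q := 0) rfl]
    change (g.obj (.mk 0)).mul ((g.obj (.mk 0)).twistedD A'.lam (a + z 0 (-1))) (φ.H + x 0 0) -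
        (ψ.H + y 0 0) = (g.obj (.mk 0)).mul ((g.obj (.mk 0)).twistedD A'.lam a) φ.H - ψ.H +
          _ - _ + _
    rw [DGLA.twistedD_add, (hz.isCentral 0 (-1)).twistedD,
      DGLA.mul_add_left ((hz.isCentral 0 (-1)).d _), DGLA.mul_add_right (hx.isCentral 0 0)]
    abel
  · simp only [Pi.add_apply, Pi.sub_apply]
    rw [g.totalD_neg_one _ 0, g.coboundary_zero]
    change (g.obj (.mk 1)).mulAt (g.at₁ 1 0 A'.lam)
        ((g.obj (.mk 1)).expAd A'.G (g.at₁ 1 1 (a + z 0 (-1)))) (φ.b + x 1 (-1)) -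
        (g.obj (.mk 1)).mulAt (g.at₁ 1 0 A'.lam) (ψ.b + y 1 (-1)) (g.at₁ 1 0 (a + z 0 (-1))) =
      (g.obj (.mk 1)).mulAt (g.at₁ 1 0 A'.lam) ((g.obj (.mk 1)).expAd A'.G (g.at₁ 1 1 a)) φ.b -
        (g.obj (.mk 1)).mulAt (g.at₁ 1 0 A'.lam) ψ.b (g.at₁ 1 0 a) + _ - _ + _
    have hl := PreDatum.isCentral_curv_at₁ hA' (n := 1) 0
    rw [at₁_add, at₁_add, DGLA.expAd_add, (hz.at₁ 1).expAd,
      DGLA.mulAt_add_central_right hl (hx.isCentral 1 (-1)),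
      DGLA.mulAt_add_central_left hl (hz.at₁ 1), DGLA.mulAt_add_central_right hl (hz.at₁ 0),
      DGLA.mulAt_add_central_left hl (hy.isCentral 1 (-1))]
    abel

end CosimplicialDGLA

namespace CosimplicialDGLA

variable {k : Type u} [Field k] [CharZero k] {g g' : CosimplicialDGLA.{u, v} k}

/-! ### Data with vanishing defects -/

/-- The image of the data of a descent datum under a morphism. -/
def PreDatum.map (f : g ⟶ g') (A : PreDatum g) : PreDatum g' :=
  ⟨app f 0 1 A.lam, app f 1 0 A.G, app f 2 (-1) A.c⟩

/-- The image of the data of an isomorphism under a morphism. -/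
def PreIso.map (f : g ⟶ g') (φ : PreIso g) : PreIso g' := ⟨app f 0 0 φ.H, app f 1 (-1) φ.b⟩

lemma PreDatum.map_add (f : g ⟶ g') (A : PreDatum g) (x : g.Family) :
    (A.add x).map f = (A.map f).add (familyMap f x) := by
  ext <;> exact _root_.map_add _ _ _

lemma PreIso.map_add (f : g ⟶ g') (φ : PreIso g) (x : g.Family) :
    (φ.add x).map f = (φ.map f).add (familyMap f x) := by
  ext <;> exact _root_.map_add _ _ _

lemma PreDatum.add_zero (A : PreDatum g) : A.add 0 = A := by
  ext <;> exact _root_.add_zero _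

lemma PreIso.add_zero (φ : PreIso g) : φ.add 0 = φ := by
  ext <;> exact _root_.add_zero _

/-- The data of a descent datum. -/
def DescentDatum.toPre (A : DescentDatum g) : PreDatum g := ⟨A.lam, A.G, A.c⟩

/-- The data of an isomorphism. -/
def DescentDatum.Iso.toPre {A A' : DescentDatum g} (φ : A.Iso A') : PreIso g := ⟨φ.H, φ.b⟩

section Nilp

variable [hg : ∀ n : ℕ, (g.obj (.mk n)).IsNilp]

/-- The descent datum given by data without defects. -/
def PreDatum.toDatum (A : PreDatum g) (h : A.defect = 0) : DescentDatum g where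
  lam := A.lam
  G := A.G
  c := A.c
  maurerCartan := congrFun (congrFun h 0) 2
  gauge := sub_eq_zero.1 (congrFun (congrFun h 1) 1)
  twoMorphism := (sub_eq_zero.1 (congrFun (congrFun h 2) 0)).symm
  cocycle := (sub_eq_zero.1 (congrFun (congrFun h 3) (-1))).symm

lemma DescentDatum.defect_toPre [g.IsBounded] (A : DescentDatum g) : A.toPre.defect = 0 :=
  ext₂ A.toPre.defect_mem (zero_mem _) A.maurerCartan (sub_eq_zero.2 A.gauge)
    (sub_eq_zero.2 A.twoMorphism.symm) (sub_eq_zero.2 A.cocycle.symm)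

lemma PreDatum.defect_map (f : g ⟶ g') (A : PreDatum g) :
    familyMap f A.defect = (A.map f).defect := by
  have hc : ∀ (n : ℕ) (x : (g.obj (.mk n)).V 1),
      app f n 2 ((g.obj (.mk n)).curv x) = (g'.obj (.mk n)).curv (app f n 1 x) := by
    intro n x
    have hm := (NatTrans.app f (.mk n)).map_bracket 1 1 2 rfl x x
    have hd := (NatTrans.app f (.mk n)).map_d 1 2 rfl x
    rw [DGLA.curv, DGLA.curv, _root_.map_add, map_smul]
    exact congrArg₂ _ hd (congrArg _ hm)
  have ht : ∀ (n : ℕ) (x : (g.obj (.mk n)).V 1) (t : (g.obj (.mk n)).V (-1)),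
      app f n 0 ((g.obj (.mk n)).twistedD x t) =
        (g'.obj (.mk n)).twistedD (app f n 1 x) (app f n (-1) t) :=
    fun n x t => DGLA.map_twistedD (NatTrans.app f (.mk n)) x t
  have hga : ∀ (n : ℕ) (X : (g.obj (.mk n)).V 0) (x : (g.obj (.mk n)).V 1),
      app f n 1 ((g.obj (.mk n)).gaugeAct X x) =
        (g'.obj (.mk n)).gaugeAct (app f n 0 X) (app f n 1 x) :=
    fun n X x => DGLA.map_gaugeAct (NatTrans.app f (.mk n)) X x
  funext n p
  change app f n p (A.defect n p) = _
  unfold defect family₂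
  split
  · exact hc 0 _
  · rw [map_sub, hga, app_at₁, app_at₁]
    rfl
  · rw [map_sub, DescentDatum.app_mul, ht, DescentDatum.app_mul, app_at₁, app_at₂, app_at₂, app_at₂]
    rfl
  · refine (map_sub (app f 3 (-1)) _ _).trans ?_
    rw [DescentDatum.app_mulAt, DescentDatum.app_mulAt, DescentDatum.app_expAd, app_at₁, app_at₂,
      app_at₃, app_at₃, app_at₃, app_at₃]
    rfl
  · exact map_zero _

lemma PreIso.defect_map (f : g ⟶ g') (A A' : PreDatum g) (φ : PreIso g) :
    familyMap f (defect A A' φ) = defect (A.map f) (A'.map f) (φ.map f) := by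
  have ht : ∀ (n : ℕ) (x : (g.obj (.mk n)).V 1) (t : (g.obj (.mk n)).V (-1)),
      app f n 0 ((g.obj (.mk n)).twistedD x t) =
        (g'.obj (.mk n)).twistedD (app f n 1 x) (app f n (-1) t) :=
    fun n x t => DGLA.map_twistedD (NatTrans.app f (.mk n)) x t
  funext n p
  change app f n p (defect A A' φ n p) = _
  unfold defect family₁
  split
  · refine (map_sub _ _ _).trans (congrArg (· - _) ?_)
    exact DGLA.map_gaugeAct (NatTrans.app f (.mk 0)) φ.H A.lam
  · rw [map_sub, DescentDatum.app_mul, ht, DescentDatum.app_mul, DescentDatum.app_mul, app_at₁,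
      app_at₁, app_at₁]
    rfl
  · refine (map_sub (app f 2 (-1)) _ _).trans ?_
    rw [DescentDatum.app_mulAt, DescentDatum.app_mulAt, DescentDatum.app_mulAt,
      DescentDatum.app_expAd, DescentDatum.app_expAd, app_at₁, app_at₁, app_at₂, app_at₂, app_at₂,
      app_at₂]
    rfl
  · exact map_zero _

lemma twoIsoDefect_map (f : g ⟶ g') (A' : PreDatum g) (φ ψ : PreIso g) (a : g.Comp 0 (-1)) :
    familyMap f (twoIsoDefect A' φ ψ a) =
      twoIsoDefect (A'.map f) (φ.map f) (ψ.map f) (app f 0 (-1) a) := by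
  funext n p
  change app f n p (twoIsoDefect A' φ ψ a n p) = _
  unfold twoIsoDefect family₀
  split
  · rw [map_sub, DescentDatum.app_mul]
    refine congrArg (fun z => (g'.obj (.mk 0)).mul z _ - _) ?_
    exact DGLA.map_twistedD (NatTrans.app f (.mk 0)) _ _
  · refine (map_sub (app f 1 (-1)) _ _).trans ?_
    rw [DescentDatum.app_mulAt, DescentDatum.app_mulAt, DescentDatum.app_expAd, app_at₁, app_at₁,
      app_at₁]
    rfl
  · exact map_zero _

variable [hb : g.IsBounded]

lemma DescentDatum.isCentral_curv (A : DescentDatum g) (n : ℕ) (i : Fin (n + 1)) :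
    (g.obj (.mk n)).IsCentral ((g.obj (.mk n)).curv (g.at₁ n i A.lam)) := by
  have h : (g.obj (.mk n)).curv (g.at₁ n i A.lam) = 0 := by
    refine (A.toPre.curv_at₁ i).trans ?_
    rw [A.defect_toPre]
    exact map_zero _
  rw [h]
  exact DGLA.isCentral_zero

variable {A A' : DescentDatum g}

/-- The isomorphism given by data without defects. -/
def PreIso.toIso (φ : PreIso g) (h : defect A.toPre A'.toPre φ = 0) : A.Iso A' where
  H := φ.H
  b := φ.b
  gauge := sub_eq_zero.1 (congrFun (congrFun h 0) 1)
  twoMorphism := (sub_eq_zero.1 (congrFun (congrFun h 1) 0)).symm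
  compat := by
    have h2 := sub_eq_zero.1 (congrFun (congrFun h 2) (-1))
    have hl := A'.isCentral_curv 2 0
    rw [DGLA.mulAt_assoc hl]
    exact (DGLA.neg_mulAt_cancel_left hl _ _).symm.trans
      (congrArg ((g.obj (.mk 2)).mulAt _ (-A'.c))
        ((DGLA.mulAt_assoc hl _ _ _).symm.trans h2.symm))

lemma DescentDatum.Iso.defect_toPre (φ : A.Iso A') :
    PreIso.defect A.toPre A'.toPre φ.toPre = 0 := by
  refine ext₁ (PreIso.defect_mem _ _ _) (zero_mem _) (sub_eq_zero.2 φ.gauge)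
    (sub_eq_zero.2 φ.twoMorphism.symm) (sub_eq_zero.2 ?_)
  have hl := A'.isCentral_curv 2 0
  have h := congrArg ((g.obj (.mk 2)).mulAt (g.at₁ 2 0 A'.lam) A'.c) φ.compat
  rw [← DGLA.mulAt_assoc hl, DGLA.mulAt_assoc hl (-A'.c), DGLA.mulAt_neg_cancel_left hl] at h
  exact h.symm

/-- The two-isomorphism given by an element without defects. -/
def toTwoIso {φ ψ : A.Iso A'} (a : g.Comp 0 (-1))
    (h : twoIsoDefect A'.toPre φ.toPre ψ.toPre a = 0) : DescentDatum.TwoIso φ ψ where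
  a := a
  twoMorphism := (sub_eq_zero.1 (congrFun (congrFun h 0) 0)).symm
  compat := (sub_eq_zero.1 (congrFun (congrFun h 1) (-1))).symm

lemma DescentDatum.TwoIso.defect {φ ψ : A.Iso A'} (a : TwoIso φ ψ) :
    twoIsoDefect A'.toPre φ.toPre ψ.toPre a.a = 0 :=
  ext₀ (twoIsoDefect_mem _ _ _ _) (zero_mem _) (sub_eq_zero.2 a.twoMorphism.symm)
    (sub_eq_zero.2 a.compat.symm)

end Nilp

end CosimplicialDGLA

namespace CosimplicialDGLA

variable {k : Type u} [Field k] [CharZero k]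

/-! ### Lifting equivalences along central extensions -/

/-- A surjective morphism with central kernel. -/
structure IsCentralExtension {g gbar : CosimplicialDGLA.{u, v} k} (π : g ⟶ gbar) : Prop where
  surjective : ∀ n p, Function.Surjective (app π n p)
  central : ∀ (n : ℕ) (p : ℤ) (x : g.Comp n p), app π n p x = 0 → (g.obj (.mk n)).IsCentral x

lemma IsCentralExtension.isCentralFamily {g gbar : CosimplicialDGLA.{u, v} k} {π : g ⟶ gbar}
    (hπ : IsCentralExtension π) {x : g.Family} (hx : familyMap π x = 0) : IsCentralFamily x := by
  intro m n p φ
  refine hπ.central n p _ ?_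
  have h : app π m p (x m p) = 0 := congrFun (congrFun hx m) p
  rw [app_map, h, map_zero]

/-- The induced functor on two-groupoids of descent data is an equivalence: it is surjective on
equivalence classes of objects and of one-morphisms, and bijective on two-morphisms. -/
structure IsDescentEquivalence {g₁ g₂ : CosimplicialDGLA.{u, v} k}
    [∀ n : ℕ, (g₁.obj (.mk n)).IsNilp] (f : g₁ ⟶ g₂) : Prop where
  essSurj : ∀ B : DescentDatum g₂, ∃ A : DescentDatum g₁, Nonempty (DescentDatum.Iso (A.map f) B)
  full : ∀ (A A' : DescentDatum g₁) (φ : DescentDatum.Iso (A.map f) (A'.map f)),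
    ∃ ψ : DescentDatum.Iso A A', Nonempty (DescentDatum.TwoIso (ψ.map f) φ)
  bijective : ∀ (A A' : DescentDatum g₁) (φ ψ : DescentDatum.Iso A A'),
    Function.Bijective fun a : DescentDatum.TwoIso φ ψ => a.map f

/-- The cone of the map induced by `f` on the kernels of `π₁` and `π₂` is acyclic in
degree `m`. -/
def IsRelAcyclic {g₁ g₂ gbar₁ gbar₂ : CosimplicialDGLA.{u, v} k} (f : g₁ ⟶ g₂) (π₁ : g₁ ⟶ gbar₁)
    (π₂ : g₂ ⟶ gbar₂) (m : ℤ) : Prop :=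
  ∀ x ∈ g₁.totalX (m + 1), ∀ y ∈ g₂.totalX m, familyMap π₁ x = 0 → familyMap π₂ y = 0 →
    g₁.totalD x = 0 → g₂.totalD y = familyMap f x →
    ∃ s ∈ g₁.totalX m, ∃ t ∈ g₂.totalX (m - 1), familyMap π₁ s = 0 ∧ familyMap π₂ t = 0 ∧
      g₁.totalD s = x ∧ y = familyMap f s + g₂.totalD t

section Lift

variable {g₁ g₂ gbar₁ gbar₂ : CosimplicialDGLA.{u, v} k} {f : g₁ ⟶ g₂} {fbar : gbar₁ ⟶ gbar₂}
  {π₁ : g₁ ⟶ gbar₁} {π₂ : g₂ ⟶ gbar₂}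
  [h₁ : ∀ n : ℕ, (g₁.obj (.mk n)).IsNilp] [h₂ : ∀ n : ℕ, (g₂.obj (.mk n)).IsNilp]
  [hbar₁ : ∀ n : ℕ, (gbar₁.obj (.mk n)).IsNilp] [hbar₂ : ∀ n : ℕ, (gbar₂.obj (.mk n)).IsNilp]
  [g₁.IsBounded] [g₂.IsBounded] [gbar₁.IsBounded] [gbar₂.IsBounded]

lemma app_comm (hf : f ≫ π₂ = π₁ ≫ fbar) (n : ℕ) (p : ℤ) (x : g₁.Comp n p) :
    app π₂ n p (app f n p x) = app fbar n p (app π₁ n p x) :=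
  congrArg (fun a : g₁ ⟶ gbar₂ => app a n p x) hf

lemma PreDatum.map_comm (hf : f ≫ π₂ = π₁ ≫ fbar) (A : PreDatum g₁) :
    (A.map f).map π₂ = (A.map π₁).map fbar := by
  ext <;> exact app_comm hf _ _ _

lemma PreIso.map_comm (hf : f ≫ π₂ = π₁ ≫ fbar) (φ : PreIso g₁) :
    (φ.map f).map π₂ = (φ.map π₁).map fbar := by
  ext <;> exact app_comm hf _ _ _

variable (hf : f ≫ π₂ = π₁ ≫ fbar) (hπ₁ : IsCentralExtension π₁) (hπ₂ : IsCentralExtension π₂)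
  (hfbar : IsDescentEquivalence fbar)

include hf hπ₁ hπ₂ hfbar

/-- Lift a descent datum and an isomorphism from the quotients. The defects of the lifts form a cocycle
in the cone of `f` on the kernels, and a primitive of it corrects the lifts. -/
lemma exists_iso_map (hac : IsRelAcyclic f π₁ π₂ 1) (B : DescentDatum g₂) :
    ∃ A : DescentDatum g₁, Nonempty (DescentDatum.Iso (A.map f) B) := by
  obtain ⟨Abar, ⟨φbar⟩⟩ := hfbar.essSurj (B.map π₂)
  obtain ⟨lam, hlam⟩ := hπ₁.surjective _ _ Abar.lam
  obtain ⟨G, hG⟩ := hπ₁.surjective _ _ Abar.G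
  obtain ⟨c, hc⟩ := hπ₁.surjective _ _ Abar.c
  obtain ⟨H, hH⟩ := hπ₂.surjective _ _ φbar.H
  obtain ⟨b, hb⟩ := hπ₂.surjective _ _ φbar.b
  set A : PreDatum g₁ := ⟨lam, G, c⟩
  set φ : PreIso g₂ := ⟨H, b⟩
  have hA : A.map π₁ = Abar.toPre := PreDatum.ext hlam hG hc
  have hφ : φ.map π₂ = φbar.toPre := PreIso.ext hH hb
  have h1 : familyMap π₁ A.defect = 0 := by rw [A.defect_map, hA, Abar.defect_toPre]
  have h2 : familyMap π₂ (PreIso.defect (A.map f) B.toPre φ) = 0 := by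
    rw [PreIso.defect_map, PreDatum.map_comm hf, hA, hφ]
    exact φbar.defect_toPre
  have hA' : IsCentralFamily A.defect := hπ₁.isCentralFamily h1
  have h3 : familyMap π₂ (A.map f).defect = 0 := by
    rw [PreDatum.defect_map, PreDatum.map_comm hf, hA]
    exact (Abar.map fbar).defect_toPre
  have hB : IsCentralFamily B.toPre.defect :=
    hπ₂.isCentralFamily (by rw [B.defect_toPre, map_zero])
  obtain ⟨s, hs, t, ht, hs0, ht0, hs', ht'⟩ := hac A.defect A.defect_mem _ (PreIso.defect_mem _ _ φ)
    h1 h2 (PreDatum.totalD_defect hA') (by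
      rw [PreIso.totalD_defect (hπ₂.isCentralFamily h3) hB (hπ₂.isCentralFamily h2),
        B.defect_toPre, sub_zero, A.defect_map])
  have hsn : familyMap π₁ (-s) = 0 := by rw [map_neg, hs0, neg_zero]
  have h4 : (A.add (-s)).defect = 0 := by
    rw [PreDatum.defect_add hA' (hπ₁.isCentralFamily hsn) (neg_mem hs), map_neg, hs', add_neg_cancel]
  have hfs : familyMap π₂ (familyMap f (-s)) = 0 := by
    funext n p
    have h : app π₁ n p ((-s) n p) = 0 := congrFun (congrFun hsn n) p
    exact (app_comm hf n p _).trans (by rw [h, map_zero]; rfl)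
  have h5 := PreIso.defect_add (A := A.map f) φ hB (hπ₂.isCentralFamily hfs)
    (x' := 0) (hπ₂.isCentralFamily (map_zero _)) (hπ₂.isCentralFamily ht0)
    (familyMap_mem f 1 _ (neg_mem hs)) (zero_mem _) ht
  refine ⟨(A.add (-s)).toDatum h4, ⟨PreIso.toIso (φ.add t) ?_⟩⟩
  rw [PreDatum.add_zero, ← PreDatum.map_add, ht', map_neg, sub_zero] at h5
  refine Eq.trans h5 ?_
  abel

/-- Lift an isomorphism and a two-isomorphism from the quotients, and correct them by a primitive of
the cocycle formed by their defects. -/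
lemma exists_twoIso_map (hac : IsRelAcyclic f π₁ π₂ 0) (A A' : DescentDatum g₁)
    (φ : DescentDatum.Iso (A.map f) (A'.map f)) :
    ∃ ψ : DescentDatum.Iso A A', Nonempty (DescentDatum.TwoIso (ψ.map f) φ) := by
  have hAc : ∀ A : DescentDatum g₁, ((A.map f).map π₂).toPre = ((A.map π₁).map fbar).toPre :=
    fun A => PreDatum.map_comm hf A.toPre
  -- the image of `φ` in the quotient, as an isomorphism between images of data of the quotient
  obtain ⟨φbar, hφbar⟩ : ∃ φbar : DescentDatum.Iso ((A.map π₁).map fbar) ((A'.map π₁).map fbar),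
      φbar.toPre = φ.toPre.map π₂ :=
    ⟨PreIso.toIso (φ.toPre.map π₂) (by rw [← hAc, ← hAc]; exact (φ.map π₂).defect_toPre), rfl⟩
  obtain ⟨ψbar, ⟨abar⟩⟩ := hfbar.full _ _ φbar
  obtain ⟨H, hH⟩ := hπ₁.surjective _ _ ψbar.H
  obtain ⟨b, hb⟩ := hπ₁.surjective _ _ ψbar.b
  obtain ⟨a, ha⟩ := hπ₂.surjective _ _ abar.a
  set ψ : PreIso g₁ := ⟨H, b⟩
  have hψ : ψ.map π₁ = ψbar.toPre := PreIso.ext hH hb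
  have h1 : familyMap π₁ (PreIso.defect A.toPre A'.toPre ψ) = 0 := by
    rw [PreIso.defect_map, hψ]
    exact ψbar.defect_toPre
  have h2 : familyMap π₂ (twoIsoDefect (A'.map f).toPre (ψ.map f) φ.toPre a) = 0 := by
    rw [twoIsoDefect_map, PreIso.map_comm hf, hψ, ← hφbar, ha]
    have := abar.defect
    rwa [← hAc] at this
  have h3 : familyMap f (PreIso.defect A.toPre A'.toPre ψ) =
      PreIso.defect (A.map f).toPre (A'.map f).toPre (ψ.map f) := PreIso.defect_map _ _ _ _
  have h4 : familyMap π₂ (PreIso.defect (A.map f).toPre (A'.map f).toPre (ψ.map f)) = 0 := by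
    rw [← h3]
    funext n p
    have h := congrFun (congrFun h1 n) p
    exact (app_comm hf n p _).trans ((congrArg _ h).trans (map_zero _))
  have h5 := totalD_twoIsoDefect (A := (A.map f).toPre) (A'.map f).defect_toPre
    (hπ₂.isCentralFamily h4) (ψ := φ.toPre) (hπ₂.isCentralFamily (by
      rw [φ.defect_toPre, map_zero])) (hπ₂.isCentralFamily h2)
  have hA : ∀ A : DescentDatum g₁, IsCentralFamily A.toPre.defect := fun A =>
    hπ₁.isCentralFamily (by rw [A.defect_toPre, map_zero])
  have hψ₁ := hπ₁.isCentralFamily h1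
  obtain ⟨s, hs, t, ht, hs0, ht0, hs', ht'⟩ := hac (-PreIso.defect A.toPre A'.toPre ψ)
    (neg_mem (PreIso.defect_mem _ _ _)) _ (twoIsoDefect_mem _ _ _ _)
    (by rw [map_neg, h1, neg_zero]) h2
    (by rw [map_neg, PreIso.totalD_defect (hA A) (hA A') hψ₁, A.defect_toPre, A'.defect_toPre,
      sub_zero, neg_zero])
    (by rw [h5, φ.defect_toPre, zero_sub, map_neg, h3])
  have hsn : familyMap π₁ (-s) = 0 := by rw [map_neg, hs0, neg_zero]
  have htn : familyMap π₂ (-t) = 0 := by rw [map_neg, ht0, neg_zero]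
  have h6 : PreIso.defect A.toPre A'.toPre (ψ.add (-s)) = 0 := by
    have h := PreIso.defect_add (A := A.toPre) ψ (hA A') (x := 0) (x' := 0) (y := -s)
      (hπ₁.isCentralFamily (map_zero _)) (hπ₁.isCentralFamily (map_zero _))
      (hπ₁.isCentralFamily hsn) (zero_mem _) (zero_mem _) (neg_mem hs)
    rw [PreDatum.add_zero, PreDatum.add_zero] at h
    rw [h, map_neg, hs']
    abel
  have hfs : familyMap π₂ (familyMap f (-s)) = 0 := by
    funext n p
    have h : app π₁ n p ((-s) n p) = 0 := congrFun (congrFun hsn n) p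
    exact (app_comm hf n p _).trans (by rw [h, map_zero]; rfl)
  have h7 := twoIsoDefect_add (A' := (A'.map f).toPre)
    (hπ₂.isCentralFamily (by rw [(A'.map f).defect_toPre, map_zero])) (ψ.map f) φ.toPre a
    (hπ₂.isCentralFamily hfs) (y := 0) (hπ₂.isCentralFamily (map_zero _))
    (hπ₂.isCentralFamily htn) (familyMap_mem f 0 _ (neg_mem hs)) (zero_mem _) (neg_mem ht)
  refine ⟨PreIso.toIso (ψ.add (-s)) h6, ⟨toTwoIso (a + (-t) 0 (-1)) ?_⟩⟩
  rw [PreIso.add_zero, ← PreIso.map_add, ht'] at h7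
  refine h7.trans ?_
  rw [map_neg, map_neg]
  abel

omit hπ₂ in
/-- The difference of two-isomorphisms with the same image is a cocycle in the kernel, of the lowest
degree, whose image under `f` vanishes. -/
lemma twoIso_map_injective (hac : IsRelAcyclic f π₁ π₂ (-2)) {A A' : DescentDatum g₁}
    (φ ψ : DescentDatum.Iso A A') :
    Function.Injective fun a : DescentDatum.TwoIso φ ψ => a.map f := by
  intro a a' h
  have h0 : app f 0 (-1) a.a = app f 0 (-1) a'.a := congrArg DescentDatum.TwoIso.a h
  have hbar : a.map π₁ = a'.map π₁ :=
    (hfbar.bijective _ _ (φ.map π₁) (ψ.map π₁)).1 (DescentDatum.TwoIso.ext (by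
      change app fbar 0 (-1) (app π₁ 0 (-1) a.a) = app fbar 0 (-1) (app π₁ 0 (-1) a'.a)
      rw [← app_comm hf, ← app_comm hf, h0]))
  have hbar' : app π₁ 0 (-1) a.a = app π₁ 0 (-1) a'.a := congrArg DescentDatum.TwoIso.a hbar
  set x : g₁.Family := g₁.familyNeg (a.a - a'.a)
  have hx : x ∈ g₁.totalX (-1) := familyNeg_mem _
  have hxv : x 0 (-1) = a.a - a'.a := rfl
  have hx0 : familyMap π₁ x = 0 := extNeg (familyMap_mem _ _ _ hx) (zero_mem _) (by
    change app π₁ 0 (-1) (x 0 (-1)) = 0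
    rw [hxv, map_sub, hbar', sub_self])
  have hfx : familyMap f x = 0 := extNeg (familyMap_mem _ _ _ hx) (zero_mem _) (by
    change app f 0 (-1) (x 0 (-1)) = 0
    rw [hxv, map_sub, h0, sub_self])
  have hc0 : IsCentralFamily (0 : g₁.Family) := hπ₁.isCentralFamily (map_zero _)
  have hD := twoIsoDefect_add (by rw [A'.defect_toPre]; exact hc0) φ.toPre ψ.toPre a'.a hc0 hc0
    (hπ₁.isCentralFamily hx0) (zero_mem _) (zero_mem _) hx
  rw [PreIso.add_zero, PreIso.add_zero, hxv, add_sub_cancel, a.defect, a'.defect, add_zero,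
    sub_zero, zero_add] at hD
  obtain ⟨s, hs, -, -, -, -, hs', -⟩ := hac x hx 0 (zero_mem _) hx0 (map_zero _) hD.symm
    (by rw [map_zero, hfx])
  rw [eq_zero_of_mem_totalX_lt (by norm_num) hs, map_zero] at hs'
  refine DescentDatum.TwoIso.ext (sub_eq_zero.1 ?_)
  rw [← hxv, ← hs']
  rfl

/-- For a lift `α` of the preimage in the quotient, the defect of `α` and the difference of its image
from the given two-isomorphism form a cocycle in the cone of `f` on the kernels. -/
lemma twoIso_map_surjective (hac : IsRelAcyclic f π₁ π₂ (-1)) {A A' : DescentDatum g₁}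
    (φ ψ : DescentDatum.Iso A A') :
    Function.Surjective fun a : DescentDatum.TwoIso φ ψ => a.map f := by
  intro a
  have hc : ∀ B : DescentDatum g₁, ((B.map f).map π₂).toPre = ((B.map π₁).map fbar).toPre :=
    fun B => PreDatum.map_comm hf B.toPre
  have hc' : ∀ χ : DescentDatum.Iso A A', ((χ.map f).map π₂).toPre = ((χ.map π₁).map fbar).toPre :=
    fun χ => PreIso.map_comm hf χ.toPre
  obtain ⟨abar, habar⟩ : ∃ abar : DescentDatum.TwoIso ((φ.map π₁).map fbar) ((ψ.map π₁).map fbar),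
      abar.a = app π₂ 0 (-1) a.a :=
    ⟨toTwoIso (app π₂ 0 (-1) a.a) (by
      rw [← hc, ← hc', ← hc']
      exact (a.map π₂).defect), rfl⟩
  obtain ⟨αbar, hαbar⟩ := (hfbar.bijective _ _ (φ.map π₁) (ψ.map π₁)).2 abar
  obtain ⟨α, hα⟩ := hπ₁.surjective _ _ αbar.a
  have h0 : app π₂ 0 (-1) (app f 0 (-1) α) = app π₂ 0 (-1) a.a := by
    rw [app_comm hf, hα, ← habar, ← hαbar]
    rfl
  set y : g₂.Family := g₂.familyNeg (app f 0 (-1) α - a.a)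
  have hy : y ∈ g₂.totalX (-1) := familyNeg_mem _
  have hyv : y 0 (-1) = app f 0 (-1) α - a.a := rfl
  have hy0 : familyMap π₂ y = 0 := extNeg (familyMap_mem _ _ _ hy) (zero_mem _) (by
    change app π₂ 0 (-1) (y 0 (-1)) = 0
    rw [hyv, map_sub, h0, sub_self])
  have hx0 : familyMap π₁ (twoIsoDefect A'.toPre φ.toPre ψ.toPre α) = 0 := by
    rw [twoIsoDefect_map, hα]
    exact αbar.defect
  have hc0 : IsCentralFamily (0 : g₁.Family) := hπ₁.isCentralFamily (map_zero _)
  have hc0' : IsCentralFamily (0 : g₂.Family) := hπ₂.isCentralFamily (map_zero _)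
  have hD := twoIsoDefect_add (by rw [(A'.map f).defect_toPre]; exact hc0') (φ.map f).toPre
    (ψ.map f).toPre a.a hc0' hc0' (hπ₂.isCentralFamily hy0) (zero_mem _) (zero_mem _) hy
  rw [PreIso.add_zero, PreIso.add_zero, hyv, add_sub_cancel, a.defect, add_zero,
    sub_zero, zero_add] at hD
  obtain ⟨s, hs, t, ht, hs0, -, hs', ht'⟩ := hac _ (twoIsoDefect_mem A'.toPre φ.toPre ψ.toPre α) y
    hy hx0 hy0 (by
      rw [totalD_twoIsoDefect A'.defect_toPre (by rw [φ.defect_toPre]; exact hc0)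
        (by rw [ψ.defect_toPre]; exact hc0) (hπ₁.isCentralFamily hx0), φ.defect_toPre,
        ψ.defect_toPre, sub_zero])
    (by rw [← hD, twoIsoDefect_map]; rfl)
  rw [eq_zero_of_mem_totalX_lt (by norm_num) ht, map_zero, add_zero] at ht'
  have hE := twoIsoDefect_add (by rw [A'.defect_toPre]; exact hc0) φ.toPre ψ.toPre α hc0 hc0
    (z := -s) (hπ₁.isCentralFamily (by rw [map_neg, hs0, neg_zero])) (zero_mem _) (zero_mem _)
    (neg_mem hs)
  rw [PreIso.add_zero, PreIso.add_zero, map_neg, hs', add_zero, sub_zero, add_neg_cancel] at hE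
  refine ⟨toTwoIso _ hE, DescentDatum.TwoIso.ext ?_⟩
  have h1 : app f 0 (-1) (s 0 (-1)) = app f 0 (-1) α - a.a := by
    rw [← hyv, ht']
    rfl
  change app f 0 (-1) (α + -s 0 (-1)) = a.a
  rw [map_add, map_neg, h1]
  abel

/-- A morphism which is an equivalence modulo central ideals, and relatively acyclic on these
ideals, is an equivalence. -/
theorem IsDescentEquivalence.of_isCentralExtension (hac : ∀ m, IsRelAcyclic f π₁ π₂ m) :
    IsDescentEquivalence f where
  essSurj := exists_iso_map hf hπ₁ hπ₂ hfbar (hac 1)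
  full := exists_twoIso_map hf hπ₁ hπ₂ hfbar (hac 0)
  bijective _ _ φ ψ := ⟨twoIso_map_injective hf hπ₁ hfbar (hac (-2)) φ ψ,
    twoIso_map_surjective hf hπ₁ hπ₂ hfbar (hac (-1)) φ ψ⟩

end Lift

end CosimplicialDGLA

/-! ### Composition of isomorphisms and of two-isomorphisms -/

namespace DGLA

/-- The compatibility condition for the inverse of an isomorphism. -/
lemma inverse_defect {k : Type u} [Field k] [CharZero k] {g : DGLA.{u, v} k} [g.IsNilp]
    [Subsingleton (g.V (-2))] {l m : g.V 1} {G G' H0 H1 : g.V 0} {b01 b02 b12 c c' : g.V (-1)}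
    (hm : g.IsCentral (g.curv m)) (hH : g.gaugeAct (-H0) m = l + 0)
    (H01 : g.mul (g.twistedD m b01) (g.mul H0 G) = g.mul G' H1 + 0)
    (h : g.mulAt m b02 (g.expAd H0 c) = g.mulAt m (g.mulAt m c' (g.expAd G' b12)) b01) :
    g.mulAt l (g.expAd (-H0) (-b02)) (g.expAd (-H0) c') =
      g.mulAt l (g.mulAt l c (g.expAd G (g.expAd (-H1) (-b12)))) (g.expAd (-H0) (-b01)) := by
  have hX : ∀ {x : g.V (-1)}, x = g.expAd (-H0) (g.expAd H0 x) :=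
    fun {x} => (g.neg_expAd_expAd H0 x).symm
  have hY : g.expAd H1 (g.expAd (-H1) (-b12)) = -b12 := by
    rw [← mul_expAd, mul_neg_self, zero_expAd]
  have h6 := mulAt_expAd_of_twistedD_mul hm isCentral_zero H01 (g.expAd (-H1) (-b12))
  rw [mul_expAd, mul_expAd, hY] at h6
  rw [hX (x := c), hX (x := g.expAd G _), ← expAd_mulAt_of_gauge hm isCentral_zero hH,
    ← expAd_mulAt_of_gauge hm isCentral_zero hH, ← expAd_mulAt_of_gauge hm isCentral_zero hH]
  congr 1
  apply mulAt_left_cancel hm (a := b02)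
  rw [mulAt_neg_cancel_left hm, ← mulAt_assoc hm, ← mulAt_assoc hm, h, mulAt_assoc hm _ b01, h6,
    ← mulAt_assoc hm, mulAt_assoc hm c', expAd_neg, mulAt_neg_self hm, mulAt_zero hm,
    mulAt_assoc hm, mulAt_neg_self hm, mulAt_zero hm]

end DGLA

namespace CosimplicialDGLA

variable {k : Type u} [Field k] [CharZero k] {g : CosimplicialDGLA.{u, v} k}
  [hg : ∀ n : ℕ, (g.obj (.mk n)).IsNilp] [hb : g.IsBounded]

namespace DescentDatum

section Faces

variable {p : ℤ} {n : ℕ}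

lemma at₁_mul (i : Fin (n + 1)) (X Y : g.Comp 0 0) : g.at₁ n i ((g.obj (.mk 0)).mul X Y) =
    (g.obj (.mk n)).mul (g.at₁ n i X) (g.at₁ n i Y) := DGLA.map_mul _ X Y

lemma at₁_mulAt (i : Fin (n + 1)) (l : g.Comp 0 1) (s t : g.Comp 0 (-1)) :
    g.at₁ n i ((g.obj (.mk 0)).mulAt l s t) =
      (g.obj (.mk n)).mulAt (g.at₁ n i l) (g.at₁ n i s) (g.at₁ n i t) := DGLA.map_mulAt _ l s t

lemma at₁_neg (i : Fin (n + 1)) (x : g.Comp 0 p) : g.at₁ n i (-x) = -g.at₁ n i x := map_neg _ _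

lemma at₁_zero (i : Fin (n + 1)) : g.at₁ n i (0 : g.Comp 0 p) = 0 := map_zero _

lemma at₂_neg (i j : Fin (n + 1)) (h : i ≤ j) (x : g.Comp 1 p) :
    g.at₂ n i j (-x) h = -g.at₂ n i j x h := map_neg _ _

lemma at₂_zero (i j : Fin (n + 1)) (h : i ≤ j) : g.at₂ n i j (0 : g.Comp 1 p) h = 0 := map_zero _

lemma at₂_mulAt_at₁ (i j : Fin (n + 1)) (h : i ≤ j) (l : g.Comp 0 1) (s t : g.Comp 1 (-1)) :
    g.at₂ n i j ((g.obj (.mk 1)).mulAt (g.at₁ 1 0 l) s t) h =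
      (g.obj (.mk n)).mulAt (g.at₁ n i l) (g.at₂ n i j s h) (g.at₂ n i j t h) := by
  refine (DGLA.map_mulAt _ _ s t).trans ?_
  rw [at₂_at₁_zero]
  rfl

lemma at₂_expAd_at₁ (i j : Fin (n + 1)) (h : i ≤ j) (X : g.Comp 0 0) (t : g.Comp 1 p) :
    g.at₂ n i j ((g.obj (.mk 1)).expAd (g.at₁ 1 0 X) t) h =
      (g.obj (.mk n)).expAd (g.at₁ n i X) (g.at₂ n i j t h) := by
  refine (DGLA.map_expAd _ _ t).trans ?_
  rw [at₂_at₁_zero]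
  rfl

end Faces

variable {A A' A'' : DescentDatum g} {n : ℕ}

lemma gaugeAct_at₂ (A : DescentDatum g) (i j : Fin (n + 1)) (h : i ≤ j) :
    (g.obj (.mk n)).gaugeAct (g.at₂ n i j A.G h) (g.at₁ n j A.lam) = g.at₁ n i A.lam + 0 := by
  refine (A.toPre.gaugeAct_at₂ i j h).trans ?_
  rw [A.defect_toPre]
  exact congrArg _ (at₂_zero i j h)

namespace Iso

lemma gaugeAct_at₁ (φ : A.Iso A') (i : Fin (n + 1)) :
    (g.obj (.mk n)).gaugeAct (g.at₁ n i φ.H) (g.at₁ n i A.lam) = g.at₁ n i A'.lam + 0 := by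
  refine (PreIso.gaugeAct_at₁ A.toPre A'.toPre φ.toPre i).trans ?_
  rw [φ.defect_toPre]
  exact congrArg _ (at₁_zero i)

lemma mul_at₂ (φ : A.Iso A') (i j : Fin (n + 1)) (h : i ≤ j) :
    (g.obj (.mk n)).mul ((g.obj (.mk n)).twistedD (g.at₁ n i A'.lam) (g.at₂ n i j φ.b h))
      ((g.obj (.mk n)).mul (g.at₁ n i φ.H) (g.at₂ n i j A.G h)) =
      (g.obj (.mk n)).mul (g.at₂ n i j A'.G h) (g.at₁ n j φ.H) + 0 := by
  refine (PreIso.mul_at₂ A.toPre A'.toPre φ.toPre i j h).trans ?_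
  rw [φ.defect_toPre]
  exact congrArg _ (at₂_zero i j h)

lemma mulAt_eq (φ : A.Iso A') :
    (g.obj (.mk 2)).mulAt (g.at₁ 2 0 A'.lam) (g.at₂ 2 0 2 φ.b)
        ((g.obj (.mk 2)).expAd (g.at₁ 2 0 φ.H) A.c) =
      (g.obj (.mk 2)).mulAt (g.at₁ 2 0 A'.lam)
        ((g.obj (.mk 2)).mulAt (g.at₁ 2 0 A'.lam) A'.c
          ((g.obj (.mk 2)).expAd (g.at₂ 2 0 1 A'.G) (g.at₂ 2 1 2 φ.b))) (g.at₂ 2 0 1 φ.b) := by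
  have h := congrFun (congrFun φ.defect_toPre 2) (-1)
  exact sub_eq_zero.1 h

/-- The identity isomorphism. -/
def refl (A : DescentDatum g) : A.Iso A :=
  PreIso.toIso ⟨0, 0⟩ (by
    refine ext₁ (PreIso.defect_mem _ _ _) (zero_mem _) (sub_eq_zero.2 ?_) (sub_eq_zero.2 ?_)
      (sub_eq_zero.2 ?_)
    · exact DGLA.zero_gaugeAct _ _
    · have h0 : (g.obj (.mk 1)).twistedD (g.at₁ 1 0 A.lam) 0 = 0 := by simp [DGLA.twistedD]
      rw [at₁_zero, at₁_zero, DGLA.zero_mul, DGLA.mul_zero]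
      exact (congrArg (fun X => (g.obj (.mk 1)).mul X A.G) h0).trans (DGLA.zero_mul _ _)
    · have hl := A.isCentral_curv 2 0
      have h0 : (g.obj (.mk 2)).expAd (g.at₂ 2 0 1 A.G) (0 : g.Comp 2 (-1)) = 0 := by
        rw [DGLA.expAd_eq, map_zero]
      rw [at₁_zero, at₂_zero, at₂_zero, at₂_zero, DGLA.zero_expAd]
      refine (DGLA.zero_mulAt hl _).trans ?_
      refine Eq.trans ?_ (congrArg (fun z => (g.obj (.mk 2)).mulAt (g.at₁ 2 0 A.lam)
        ((g.obj (.mk 2)).mulAt (g.at₁ 2 0 A.lam) A.c z) 0) h0).symm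
      rw [DGLA.mulAt_zero hl, DGLA.mulAt_zero hl]
      rfl)

/-- The composition of isomorphisms `(H', b') (H, b) = (H' H, b' H'₀(b))`. -/
noncomputable def trans (φ : A.Iso A') (ψ : A'.Iso A'') : A.Iso A'' :=
  PreIso.toIso ⟨(g.obj (.mk 0)).mul ψ.H φ.H, (g.obj (.mk 1)).mulAt (g.at₁ 1 0 A''.lam) ψ.b
      ((g.obj (.mk 1)).expAd (g.at₁ 1 0 ψ.H) φ.b)⟩ (by
    refine ext₁ (PreIso.defect_mem _ _ _) (zero_mem _) (sub_eq_zero.2 ?_) (sub_eq_zero.2 ?_)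
      (sub_eq_zero.2 ?_)
    · refine (DGLA.mul_gaugeAct _ ψ.H φ.H A.lam).trans ?_
      exact (congrArg ((g.obj (.mk 0)).gaugeAct ψ.H) φ.gauge).trans ψ.gauge
    · have hl := A''.isCentral_curv 1 0
      have h1 := φ.twoMorphism
      have h2 := ψ.twoMorphism
      have h3 := ψ.gaugeAct_at₁ (n := 1) 0
      unfold DGLA.IsTwoMorphism at h1 h2
      change (g.obj (.mk 1)).mul ((g.obj (.mk 1)).twistedD (g.at₁ 1 0 A''.lam)
        ((g.obj (.mk 1)).mulAt (g.at₁ 1 0 A''.lam) ψ.b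
          ((g.obj (.mk 1)).expAd (g.at₁ 1 0 ψ.H) φ.b)))
        ((g.obj (.mk 1)).mul (g.at₁ 1 0 ((g.obj (.mk 0)).mul ψ.H φ.H)) A.G) =
        (g.obj (.mk 1)).mul A''.G (g.at₁ 1 1 ((g.obj (.mk 0)).mul ψ.H φ.H))
      rw [at₁_mul, at₁_mul, DGLA.twistedD_mulAt hl, DGLA.mul_assoc, DGLA.mul_assoc,
        DGLA.twistedD_expAd_mul DGLA.isCentral_zero h3, ← h1, ← DGLA.mul_assoc _ (g.at₁ 1 0 ψ.H),
        ← DGLA.mul_assoc, ← h2, DGLA.mul_assoc]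
    · have hl := A''.isCentral_curv 2 0
      have hl' := A'.isCentral_curv 2 0
      have hl1 := A''.isCentral_curv 2 1
      have h1 := φ.mulAt_eq
      have h2 := ψ.mulAt_eq
      have h3 := ψ.gaugeAct_at₁ (n := 2) 0
      have h4 := A''.gaugeAct_at₂ (n := 2) 0 1 (by decide)
      have h5 := ψ.mul_at₂ (n := 2) 0 1 (by decide)
      have h6 := congrArg ((g.obj (.mk 2)).expAd (g.at₁ 2 0 ψ.H)) h1
      rw [DGLA.expAd_mulAt_of_gauge hl' DGLA.isCentral_zero h3,
        DGLA.expAd_mulAt_of_gauge hl' DGLA.isCentral_zero h3,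
        DGLA.expAd_mulAt_of_gauge hl' DGLA.isCentral_zero h3] at h6
      change (g.obj (.mk 2)).mulAt (g.at₁ 2 0 A''.lam) (g.at₂ 2 0 2 (
          (g.obj (.mk 1)).mulAt (g.at₁ 1 0 A''.lam) ψ.b
          ((g.obj (.mk 1)).expAd (g.at₁ 1 0 ψ.H) φ.b)))
        ((g.obj (.mk 2)).expAd (g.at₁ 2 0 ((g.obj (.mk 0)).mul ψ.H φ.H)) A.c) =
        (g.obj (.mk 2)).mulAt (g.at₁ 2 0 A''.lam)
        ((g.obj (.mk 2)).mulAt (g.at₁ 2 0 A''.lam) A''.c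
          ((g.obj (.mk 2)).expAd (g.at₂ 2 0 1 A''.G) (g.at₂ 2 1 2
            ((g.obj (.mk 1)).mulAt (g.at₁ 1 0 A''.lam) ψ.b
            ((g.obj (.mk 1)).expAd (g.at₁ 1 0 ψ.H) φ.b)))))
        (g.at₂ 2 0 1 ((g.obj (.mk 1)).mulAt (g.at₁ 1 0 A''.lam) ψ.b
          ((g.obj (.mk 1)).expAd (g.at₁ 1 0 ψ.H) φ.b)))
      simp only [at₂_mulAt_at₁, at₂_expAd_at₁]
      rw [at₁_mul, DGLA.mul_expAd, DGLA.mulAt_assoc hl, h6, ← DGLA.mulAt_assoc hl,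
        ← DGLA.mulAt_assoc hl, h2, DGLA.mulAt_assoc hl _ (g.at₂ 2 0 1 ψ.b), ← DGLA.mul_expAd,
        DGLA.mulAt_expAd_of_twistedD_mul hl DGLA.isCentral_zero h5, DGLA.mul_expAd,
        DGLA.expAd_mulAt_of_gauge hl1 DGLA.isCentral_zero h4]
      simp only [DGLA.mulAt_assoc hl])

/-- The inverse `(H⁻¹, H₀⁻¹(b⁻¹))` of an isomorphism. -/
noncomputable def symm (φ : A.Iso A') : A'.Iso A :=
  PreIso.toIso ⟨-φ.H, (g.obj (.mk 1)).expAd (g.at₁ 1 0 (-φ.H)) (-φ.b)⟩ (by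
    have hH : ∀ (n : ℕ) (i : Fin (n + 1)), (g.obj (.mk n)).gaugeAct (-g.at₁ n i φ.H)
        (g.at₁ n i A'.lam) = g.at₁ n i A.lam + 0 := by
      intro n i
      rw [← add_zero (g.at₁ n i A'.lam), ← φ.gaugeAct_at₁ i, ← DGLA.mul_gaugeAct,
        DGLA.neg_mul_self, DGLA.zero_gaugeAct, add_zero]
    refine ext₁ (PreIso.defect_mem _ _ _) (zero_mem _) (sub_eq_zero.2 ?_) (sub_eq_zero.2 ?_)
      (sub_eq_zero.2 ?_)
    · change (g.obj (.mk 0)).gaugeAct (-φ.H) A'.lam = A.lam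
      rw [← φ.gauge, ← DGLA.mul_gaugeAct, DGLA.neg_mul_self, DGLA.zero_gaugeAct]
    · have h1 := φ.twoMorphism
      unfold DGLA.IsTwoMorphism at h1
      change (g.obj (.mk 1)).mul ((g.obj (.mk 1)).twistedD (g.at₁ 1 0 A.lam)
        ((g.obj (.mk 1)).expAd (g.at₁ 1 0 (-φ.H)) (-φ.b)))
        ((g.obj (.mk 1)).mul (g.at₁ 1 0 (-φ.H)) A'.G) =
        (g.obj (.mk 1)).mul A.G (g.at₁ 1 1 (-φ.H))
      have h2 := hH 1 0
      rw [at₁_neg, at₁_neg, DGLA.twistedD_expAd_mul DGLA.isCentral_zero h2, DGLA.twistedD_neg]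
      have h3 : (g.obj (.mk 1)).mul A'.G ((g.obj (.mk 1)).mul (g.at₁ 1 1 φ.H)
          (-g.at₁ 1 1 φ.H)) = A'.G := by rw [DGLA.mul_neg_self, DGLA.mul_zero]
      rw [← h3, ← DGLA.mul_assoc _ A'.G, h1, DGLA.mul_assoc, DGLA.neg_mul_cancel_left,
        DGLA.mul_assoc, DGLA.neg_mul_cancel_left]
    · have hl := A.isCentral_curv 2 0
      have hl' := A'.isCentral_curv 2 0
      have h := DGLA.inverse_defect hl' (hH 2 0) (φ.mul_at₂ (n := 2) 0 1 (by decide)) φ.mulAt_eq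
      have hb : ∀ (i j : Fin 3) (h : i ≤ j),
          g.at₂ 2 i j ((g.obj (.mk 1)).expAd (-g.at₁ 1 0 φ.H) (-φ.b)) h =
            (g.obj (.mk 2)).expAd (-g.at₁ 2 i φ.H) (-g.at₂ 2 i j φ.b h) := fun i j h => by
        rw [← at₁_neg, at₂_expAd_at₁, at₁_neg, at₂_neg]
      simp only [at₁_neg, hb]
      exact h)

end Iso

namespace TwoIso

variable {φ ψ χ : A.Iso A'}

/-- The identity two-isomorphism. -/
def refl (φ : A.Iso A') : TwoIso φ φ where
  a := 0
  twoMorphism := by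
    have h0 : (g.obj (.mk 0)).twistedD A'.lam 0 = 0 := by simp [DGLA.twistedD]
    rw [DGLA.IsTwoMorphism, h0, DGLA.zero_mul]
  compat := by
    have hl := A'.isCentral_curv 1 0
    have h0 : (g.obj (.mk 1)).expAd A'.G (0 : g.Comp 1 (-1)) = 0 := by
      rw [DGLA.expAd_eq, map_zero]
    rw [at₁_zero, at₁_zero, h0, DGLA.mulAt_zero hl, DGLA.zero_mulAt hl]

lemma isCentral_curv_lam (A : DescentDatum g) : (g.obj (.mk 0)).IsCentral
    ((g.obj (.mk 0)).curv A.lam) := by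
  have h : (g.obj (.mk 0)).curv A.lam = 0 := A.maurerCartan
  rw [h]
  exact DGLA.isCentral_zero

/-- The composition of two-isomorphisms. -/
noncomputable def trans (a : TwoIso φ ψ) (b : TwoIso ψ χ) : TwoIso φ χ where
  a := (g.obj (.mk 0)).mulAt A'.lam b.a a.a
  twoMorphism := by
    have h1 := a.twoMorphism
    have h2 := b.twoMorphism
    unfold DGLA.IsTwoMorphism at *
    rw [DGLA.twistedD_mulAt (isCentral_curv_lam A'), DGLA.mul_assoc, ← h1, ← h2]
  compat := by
    have hl := A'.isCentral_curv 1 0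
    have hl1 := A'.isCentral_curv 1 1
    have hG : (g.obj (.mk 1)).gaugeAct A'.G (g.at₁ 1 1 A'.lam) = g.at₁ 1 0 A'.lam + 0 :=
      Eq.trans A'.gauge (add_zero _).symm
    rw [at₁_mulAt, at₁_mulAt, DGLA.expAd_mulAt_of_gauge hl1 DGLA.isCentral_zero hG,
      ← DGLA.mulAt_assoc hl, b.compat, DGLA.mulAt_assoc hl, a.compat, ← DGLA.mulAt_assoc hl]

/-- The inverse of a two-isomorphism. -/
def symm (a : TwoIso φ ψ) : TwoIso ψ φ where
  a := -a.a
  twoMorphism := by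
    have h1 := a.twoMorphism
    unfold DGLA.IsTwoMorphism at *
    rw [h1, DGLA.twistedD_neg, DGLA.neg_mul_cancel_left]
  compat := by
    have hl := A'.isCentral_curv 1 0
    have h := congrArg (fun t => (g.obj (.mk 1)).mulAt (g.at₁ 1 0 A'.lam) t (-g.at₁ 1 0 a.a))
      a.compat
    simp only [DGLA.mulAt_assoc hl, DGLA.mulAt_neg_self hl, DGLA.mulAt_zero hl] at h
    rw [at₁_neg, at₁_neg, DGLA.expAd_neg, h, DGLA.neg_mulAt_cancel_left hl]

end TwoIso

lemma equivalence_isomorphic (g : CosimplicialDGLA.{u, v} k)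
    [∀ n : ℕ, (g.obj (.mk n)).IsNilp] [g.IsBounded] :
    _root_.Equivalence (Isomorphic (g := g)) :=
  ⟨fun A => ⟨Iso.refl A⟩, fun ⟨φ⟩ => ⟨φ.symm⟩, fun ⟨φ⟩ ⟨ψ⟩ => ⟨φ.trans ψ⟩⟩

lemma equivalence_twoIsomorphic (A A' : DescentDatum g) :
    _root_.Equivalence (TwoIsomorphic (A := A) (A' := A')) :=
  ⟨fun φ => ⟨TwoIso.refl φ⟩, fun ⟨a⟩ => ⟨a.symm⟩, fun ⟨a⟩ ⟨b⟩ => ⟨a.trans b⟩⟩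

end DescentDatum

end CosimplicialDGLA

/-! ### Quasi-isomorphisms of complexes of vector spaces, elementwise -/

namespace CategoryTheory.ShortComplex

variable {R : Type u} [Ring R] {S T : ShortComplex (ModuleCat.{v} R)} (φ : S ⟶ T) [QuasiIso φ]

lemma bijective_homologyMap_moduleCat :
    Function.Bijective (leftHomologyMapData φ S.moduleCatLeftHomologyData
      T.moduleCatLeftHomologyData).φH.hom := by
  have := (leftHomologyMapData φ S.moduleCatLeftHomologyData
    T.moduleCatLeftHomologyData).quasiIso_iff.1 inferInstance
  exact ConcreteCategory.bijective_of_isIso (leftHomologyMapData φ S.moduleCatLeftHomologyData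
    T.moduleCatLeftHomologyData).φH

/-- Injectivity on homology. -/
lemma exists_of_quasiIso_of_eq {x : S.X₂} (hx : S.g x = 0) {y : T.X₁} (h : φ.τ₂ x = T.f y) :
    ∃ z, S.f z = x := by
  set γ := leftHomologyMapData φ S.moduleCatLeftHomologyData T.moduleCatLeftHomologyData
  let x' : S.moduleCatLeftHomologyData.K := (⟨x, hx⟩ : LinearMap.ker S.g.hom)
  have hK : γ.φK x' = T.moduleCatToCycles y := by
    have h1 := ConcreteCategory.congr_hom γ.commi x'
    exact Subtype.ext (h1.trans h)
  have h0 : γ.φH (S.moduleCatLeftHomologyData.π x') = 0 := by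
    have h1 := ConcreteCategory.congr_hom γ.commπ x'
    refine h1.trans ?_
    change (LinearMap.range T.moduleCatToCycles).mkQ (γ.φK x') = 0
    rw [hK]
    simp
  have h2 : S.moduleCatLeftHomologyData.π x' = 0 :=
    (bijective_homologyMap_moduleCat φ).1 (h0.trans (map_zero γ.φH.hom).symm)
  have h3 : (LinearMap.range S.moduleCatToCycles).mkQ (⟨x, hx⟩ : LinearMap.ker S.g.hom) = 0 := h2
  rw [Submodule.mkQ_apply, Submodule.Quotient.mk_eq_zero] at h3
  obtain ⟨z, hz⟩ := h3
  exact ⟨z, congrArg Subtype.val hz⟩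

/-- Surjectivity on homology. -/
lemma exists_of_quasiIso {y : T.X₂} (hy : T.g y = 0) :
    ∃ x, S.g x = 0 ∧ ∃ z, y = φ.τ₂ x + T.f z := by
  set γ := leftHomologyMapData φ S.moduleCatLeftHomologyData T.moduleCatLeftHomologyData
  let y' : T.moduleCatLeftHomologyData.K := (⟨y, hy⟩ : LinearMap.ker T.g.hom)
  obtain ⟨c, hc⟩ := (bijective_homologyMap_moduleCat φ).2 (T.moduleCatLeftHomologyData.π y')
  obtain ⟨x', rfl⟩ := Submodule.mkQ_surjective (LinearMap.range S.moduleCatToCycles) c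
  have h1 := (ConcreteCategory.congr_hom γ.commπ x').symm.trans hc
  let z' : LinearMap.ker T.g.hom := γ.φK x'
  have h2 : z' - (⟨y, hy⟩ : LinearMap.ker T.g.hom) ∈ LinearMap.range T.moduleCatToCycles :=
    (Submodule.Quotient.eq (LinearMap.range T.moduleCatToCycles)).1 h1
  obtain ⟨z, hz⟩ := h2
  refine ⟨(x' : LinearMap.ker S.g.hom).1, (x' : LinearMap.ker S.g.hom).2, -z, ?_⟩
  have h3 := ConcreteCategory.congr_hom γ.commi x'
  have h4 : T.f z = φ.τ₂ (x' : LinearMap.ker S.g.hom).1 - y :=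
    (congrArg Subtype.val hz).trans (congrArg (· - y) h3)
  rw [map_neg, h4]
  abel

end CategoryTheory.ShortComplex

namespace CosimplicialDGLA

variable {k : Type u} [Field k] {L₁ L₂ : CosimplicialDGLA.{u, v} k} (f : L₁ ⟶ L₂)

/-- The cone of `f` is acyclic in degree `m`: its cocycles of degree `m` are the pairs of `x` of degree
`m + 1` and `y` of degree `m` with `D x = 0` and `D y = f x`. -/
def IsAcyclic (m : ℤ) : Prop :=
  ∀ x ∈ L₁.totalX (m + 1), ∀ y ∈ L₂.totalX m, L₁.totalD x = 0 → L₂.totalD y = familyMap f x →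
    ∃ s ∈ L₁.totalX m, ∃ t ∈ L₂.totalX (m - 1), L₁.totalD s = x ∧ y = familyMap f s + L₂.totalD t

lemma total_d_apply (g : CosimplicialDGLA.{u, v} k) {m m' : ℤ} (h : m + 1 = m') (x : g.totalX m) :
    (g.total.d m m' x : g.totalX m').1 = g.totalD x.1 := by
  simp only [total, dif_pos h]
  rfl

theorem isAcyclic_of_quasiIso (hf : QuasiIso (totalMap f)) (m : ℤ) : IsAcyclic f m := by
  intro x hx y hy hDx hDy
  have key : ∀ i j l : ℤ, i + 1 = j → j + 1 = l → ShortComplex.QuasiIso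
      ((HomologicalComplex.shortComplexFunctor' (ModuleCat.{v} k) (ComplexShape.up ℤ) i j l).map
        (totalMap f)) := fun i j l hi hl => (quasiIsoAt_iff' (totalMap f) i j l
          ((ComplexShape.up ℤ).prev_eq' hi) ((ComplexShape.up ℤ).next_eq' hl)).1 (hf.quasiIsoAt j)
  have hd₁ : ∀ {i j : ℤ} (h : i + 1 = j) (z : L₁.totalX i),
    (L₁.total.d i j z : L₁.totalX j).1 = L₁.totalD z.1 := fun h z => L₁.total_d_apply h z
  have hd₂ : ∀ {i j : ℤ} (h : i + 1 = j) (z : L₂.totalX i),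
    (L₂.total.d i j z : L₂.totalX j).1 = L₂.totalD z.1 := fun h z => L₂.total_d_apply h z
  have := key m (m + 1) (m + 2) rfl (by ring)
  obtain ⟨⟨s₀, hs₀⟩, h₀⟩ := ShortComplex.exists_of_quasiIso_of_eq
    ((HomologicalComplex.shortComplexFunctor' (ModuleCat.{v} k) (ComplexShape.up ℤ) m (m + 1)
      (m + 2)).map (totalMap f)) (x := (⟨x, hx⟩ : L₁.totalX (m + 1)))
      (Subtype.ext ((hd₁ (by ring) ⟨x, hx⟩).trans hDx))
      (y := (⟨y, hy⟩ : L₂.totalX m)) (Subtype.ext (hDy.symm.trans (hd₂ rfl ⟨y, hy⟩).symm))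
  have h₁ : L₁.totalD s₀ = x := (hd₁ rfl ⟨s₀, hs₀⟩).symm.trans (congrArg Subtype.val h₀)
  have := key (m - 1) m (m + 1) (by ring) rfl
  have hz : y - familyMap f s₀ ∈ L₂.totalX m := sub_mem hy (familyMap_mem f m _ hs₀)
  obtain ⟨⟨s₁, hs₁⟩, h₂, ⟨t, ht⟩, h₃⟩ := ShortComplex.exists_of_quasiIso
    ((HomologicalComplex.shortComplexFunctor' (ModuleCat.{v} k) (ComplexShape.up ℤ) (m - 1) m
      (m + 1)).map (totalMap f)) (y := (⟨y - familyMap f s₀, hz⟩ : L₂.totalX m))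
      (Subtype.ext ((hd₂ rfl ⟨_, hz⟩).trans (by
        rw [map_sub, hDy, ← familyMap_totalD, h₁, sub_self]
        rfl)))
  have h₂' : L₁.totalD s₁ = 0 := (hd₁ rfl ⟨s₁, hs₁⟩).symm.trans (congrArg Subtype.val h₂)
  have h₃' : y - familyMap f s₀ = familyMap f s₁ + L₂.totalD t :=
    (congrArg Subtype.val h₃).trans
      (congrArg (familyMap f s₁ + ·) (hd₂ (by ring) ⟨t, ht⟩))
  refine ⟨s₀ + s₁, add_mem hs₀ hs₁, t, ht, by rw [map_add, h₁, h₂', add_zero], ?_⟩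
  rw [map_add, add_assoc, ← h₃']
  abel

end CosimplicialDGLA

namespace CosimplicialDGLA

variable {k : Type u} [Field k]

/-! ### Extension of coefficients -/

/-- Linear maps commuting with the internal differentials and the cosimplicial structure maps
commute with the total differential. -/
lemma totalD_comm {g : CosimplicialDGLA.{u, v} k} {g' : CosimplicialDGLA.{u, w} k}
    (c : ∀ n p, g.Comp n p →ₗ[k] g'.Comp n p)
    (hd : ∀ n p q h x, c n q ((g.obj (.mk n)).d p q h x) = (g'.obj (.mk n)).d p q h (c n p x))
    (hm : ∀ (m n : ℕ) (φ : SimplexCategory.mk m ⟶ SimplexCategory.mk n) p (x : g.Comp m p),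
      c n p (DGLA.Hom.f (g.map φ) p x) = DGLA.Hom.f (g'.map φ) p (c m p x)) (x : g.Family) :
    (fun n p => c n p (g.totalD x n p) : g'.Family) = g'.totalD fun n p => c n p (x n p) := by
  have hc : ∀ n p (y : g.Comp n p),
      c (n + 1) p (g.coboundary n p y) = g'.coboundary n p (c n p y) := fun n p y => by
    simp only [coboundary, LinearMap.sum_apply, LinearMap.smul_apply, map_sum, map_zsmul, hm]
  funext n p
  rcases n with _ | n
  · rw [g.totalD_zero x (p := p - 1) (by omega), g'.totalD_zero _ (p := p - 1) (by omega), hd]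
  · rw [g.totalD_succ x n (p := p - 1) (by omega), g'.totalD_succ _ n (p := p - 1) (by omega),
      map_add, hc, Units.smul_def, map_zsmul, hd]
    rfl

lemma sum_family_apply {g : CosimplicialDGLA.{u, v} k} {ι : Type*} (S : Finset ι)
    (x : ι → g.Family) (n : ℕ) (p : ℤ) : (∑ i ∈ S, x i) n p = ∑ i ∈ S, x i n p := by
  rw [Finset.sum_apply, Finset.sum_apply]

section Coordinates

variable {N : Type w} [AddCommGroup N] [Module k N] {ι : Type*} (b : Module.Basis ι k N)
  {V : Type v} [AddCommGroup V] [Module k V]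

/-- The coordinate of index `i` of an element of `V ⊗ N`, for a basis of `N`. -/
noncomputable def tensorCoord (V : Type v) [AddCommGroup V] [Module k V] (i : ι) :
    V ⊗[k] N →ₗ[k] V :=
  (TensorProduct.rid k V).toLinearMap ∘ₗ (b.coord i).lTensor V

lemma tensorCoord_tmul (i : ι) (x : V) (a : N) :
    tensorCoord b V i (x ⊗ₜ a) = b.coord i a • x := by
  simp [tensorCoord]

lemma tensorCoord_rTensor {W : Type v} [AddCommGroup W] [Module k W] (φ : V →ₗ[k] W) (i : ι)
    (z : V ⊗[k] N) : tensorCoord b W i (φ.rTensor N z) = φ (tensorCoord b V i z) := by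
  induction z using TensorProduct.induction_on with
  | zero => simp
  | tmul x a => rw [LinearMap.rTensor_tmul, tensorCoord_tmul, tensorCoord_tmul, map_smul]
  | add x y hx hy => simp only [map_add, hx, hy]

lemma exists_eq_sum_tensorCoord (z : V ⊗[k] N) : ∃ S : Finset ι, ∀ S' : Finset ι, S ⊆ S' →
    z = ∑ i ∈ S', tensorCoord b V i z ⊗ₜ b i := by
  classical
  induction z using TensorProduct.induction_on with
  | zero => exact ⟨∅, fun S' _ => by simp⟩
  | tmul x a =>
    refine ⟨(b.repr a).support, fun S' hS' => ?_⟩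
    have h : a = ∑ i ∈ S', b.coord i a • b i := by
      conv_lhs => rw [← b.linearCombination_repr a, Finsupp.linearCombination_apply]
      exact Finsupp.sum_of_support_subset _ hS' _ (by simp)
    simp only [tensorCoord_tmul, TensorProduct.smul_tmul]
    rw [← TensorProduct.tmul_sum, ← h]
  | add x y hx hy =>
    obtain ⟨S, hS⟩ := hx
    obtain ⟨S', hS'⟩ := hy
    refine ⟨S ∪ S', fun T hT => ?_⟩
    simp only [map_add, TensorProduct.add_tmul, Finset.sum_add_distrib]
    rw [← hS T (Finset.union_subset_left hT), ← hS' T (Finset.union_subset_right hT)]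

end Coordinates

section Acyclic

variable (N : Type w) [NonUnitalCommRing N] [Module k N] [IsScalarTower k N N]
  [SMulCommClass k N N]

instance (L : CosimplicialDGLA.{u, v} k) [hL : L.IsBounded] :
    IsBounded (L ⋙ DGLA.tensorFunctor N) where
  subsingleton n p hp := by
    have := hL.subsingleton n p hp
    refine subsingleton_of_forall_eq (0 : L.Comp n p ⊗[k] N) fun z => ?_
    induction z using TensorProduct.induction_on with
    | zero => rfl
    | tmul x a => rw [Subsingleton.elim x 0, TensorProduct.zero_tmul]
    | add x y hx hy => rw [hx, hy, add_zero]

lemma exists_family_eq_sum {ι : Type*} (b : Module.Basis ι k N) (L : CosimplicialDGLA.{u, v} k)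
    [hL : L.IsBounded] {m : ℤ} {z : Family (L ⋙ DGLA.tensorFunctor N)}
    (hz : z ∈ totalX (L ⋙ DGLA.tensorFunctor N) m) :
    ∃ S : Finset ι, ∀ S' : Finset ι, S ⊆ S' → ∀ n p,
      z n p = ∑ i ∈ S', tensorCoord b (L.Comp n p) i (z n p) ⊗ₜ b i := by
  classical
  choose S hS using fun n p => exists_eq_sum_tensorCoord b (V := L.Comp n p) (z n p)
  refine ⟨(Finset.range (m + 2).toNat).biUnion fun n => S n (m - n), fun S' hS' n p => ?_⟩
  by_cases h : z n p = 0
  · refine h.trans (Finset.sum_eq_zero fun i _ => ?_).symm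
    exact (congrArg (fun c => c ⊗ₜ[k] b i)
      ((congrArg (tensorCoord b (L.Comp n p) i) h).trans (map_zero _))).trans
        (TensorProduct.zero_tmul _ _)
  have h1 : (n : ℤ) + p = m := by
    by_contra h'
    exact h (hz n p h')
  have h2 : -1 ≤ p := by
    by_contra h'
    have := IsBounded.subsingleton (g := L ⋙ DGLA.tensorFunctor N) n p (by omega)
    exact h (Subsingleton.elim _ _)
  obtain rfl : p = m - n := by omega
  refine hS n _ S' (Finset.Subset.trans ?_ hS')
  exact Finset.subset_biUnion_of_mem (fun n : ℕ => S n (m - n)) (Finset.mem_range.2 (by omega))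

/-- Acyclicity of the cone is preserved by tensoring with a vector space: choose a basis and
argue on coordinates, finitely many of which are nonzero. -/
theorem IsAcyclic.tensor {L₁ L₂ : CosimplicialDGLA.{u, v} k} [L₁.IsBounded] [L₂.IsBounded]
    {f : L₁ ⟶ L₂} {m : ℤ} (hf : IsAcyclic f m) :
    IsAcyclic (Functor.whiskerRight f (DGLA.tensorFunctor N)) m := by
  classical
  intro x hx y hy hDx hDy
  let b := Module.Basis.ofVectorSpace k N
  obtain ⟨S₁, hS₁⟩ := exists_family_eq_sum N b L₁ hx
  obtain ⟨S₂, hS₂⟩ := exists_family_eq_sum N b L₂ hy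
  have hS₁ := hS₁ (S₁ ∪ S₂) Finset.subset_union_left
  have hS₂ := hS₂ (S₁ ∪ S₂) Finset.subset_union_right
  -- coordinates of families
  let c (L : CosimplicialDGLA.{u, v} k) (i) (z : Family (L ⋙ DGLA.tensorFunctor N)) :
    L.Family := fun n p => tensorCoord b (L.Comp n p) i (z n p)
  let e (L : CosimplicialDGLA.{u, v} k) (i) (z : L.Family) :
    Family (L ⋙ DGLA.tensorFunctor N) := fun n p => z n p ⊗ₜ[k] b i
  have hc (L : CosimplicialDGLA.{u, v} k) (i) (z) :
      c L i (totalD (L ⋙ DGLA.tensorFunctor N) z) = L.totalD (c L i z) :=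
    totalD_comm (g := L ⋙ DGLA.tensorFunctor N) (g' := L)
      (fun n p => tensorCoord b (L.Comp n p) i)
      (fun n p q h x => tensorCoord_rTensor b ((L.obj (.mk n)).d p q h) i x)
      (fun m n φ p x => tensorCoord_rTensor b (DGLA.Hom.f (L.map φ) p) i x) z
  have he (L : CosimplicialDGLA.{u, v} k) (i) (z) :
      e L i (L.totalD z) = totalD (L ⋙ DGLA.tensorFunctor N) (e L i z) :=
    totalD_comm (g := L) (g' := L ⋙ DGLA.tensorFunctor N)
      (fun n p => (TensorProduct.mk k (L.Comp n p) N).flip (b i))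
      (fun n p q h x => rfl) (fun m n φ p x => rfl) z
  have hsol (i) : ∃ s ∈ L₁.totalX m, ∃ t ∈ L₂.totalX (m - 1),
      L₁.totalD s = c L₁ i x ∧ c L₂ i y = familyMap f s + L₂.totalD t := by
    refine hf (c L₁ i x) (fun n p h => ?_) (c L₂ i y) (fun n p h => ?_) ?_ ?_
    · exact (congrArg (tensorCoord b (L₁.Comp n p) i) (hx n p h)).trans (map_zero _)
    · exact (congrArg (tensorCoord b (L₂.Comp n p) i) (hy n p h)).trans (map_zero _)
    · rw [← hc, hDx]
      funext n p
      exact map_zero (tensorCoord b (L₁.Comp n p) i)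
    · rw [← hc, hDy]
      funext n p
      exact tensorCoord_rTensor b (app f n p) i (x n p)
  choose s hs t ht hst hst' using hsol
  refine ⟨∑ i ∈ S₁ ∪ S₂, e L₁ i (s i), sum_mem fun i _ n p h => ?_,
    ∑ i ∈ S₁ ∪ S₂, e L₂ i (t i), sum_mem fun i _ n p h => ?_, ?_, ?_⟩
  · change s i n p ⊗ₜ[k] b i = 0
    rw [hs i n p h, TensorProduct.zero_tmul]
  · change t i n p ⊗ₜ[k] b i = 0
    rw [ht i n p h, TensorProduct.zero_tmul]
  · rw [map_sum]
    funext n p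
    rw [sum_family_apply]
    refine Eq.trans (Finset.sum_congr rfl fun i _ => ?_) (hS₁ n p).symm
    rw [← he, hst]
  · rw [map_sum, map_sum, ← Finset.sum_add_distrib]
    funext n p
    rw [sum_family_apply]
    refine (hS₂ n p).trans (Finset.sum_congr rfl fun i _ => ?_)
    rw [← he]
    refine (congrArg (fun z : L₂.Family => z n p ⊗ₜ[k] b i) (hst' i)).trans ?_
    exact TensorProduct.add_tmul _ _ _

end Acyclic

end CosimplicialDGLA

/-! ### Change of the coefficient algebra -/

section TensorMap

variable {k : Type u} [Field k]
  {N N' N'' : Type w} [NonUnitalCommRing N] [Module k N] [IsScalarTower k N N] [SMulCommClass k N N]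
  [NonUnitalCommRing N'] [Module k N'] [IsScalarTower k N' N'] [SMulCommClass k N' N']
  [NonUnitalCommRing N''] [Module k N''] [IsScalarTower k N'' N''] [SMulCommClass k N'' N'']

lemma DGLA.lTensor_tensorBracket (φ : N →ₙₐ[k] N') (g : DGLA.{u, v} k) (p q r : ℤ) (h : p + q = r)
    (x : g.V p ⊗[k] N) (y : g.V q ⊗[k] N) :
    (φ : N →ₗ[k] N').lTensor (g.V r) (tensorBracket N g p q r h x y) =
      tensorBracket N' g p q r h ((φ : N →ₗ[k] N').lTensor (g.V p) x)
        ((φ : N →ₗ[k] N').lTensor (g.V q) y) := by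
  induction x using TensorProduct.induction_on with
  | zero => simp only [map_zero, LinearMap.zero_apply]
  | add x x' hx hx' => simp only [map_add, LinearMap.add_apply, hx, hx']
  | tmul x a =>
    induction y using TensorProduct.induction_on with
    | zero => simp only [map_zero]
    | add y y' hy hy' => simp only [map_add, hy, hy']
    | tmul y b =>
      simp only [tensorBracket_tmul, LinearMap.lTensor_tmul]
      exact congrArg (fun c => g.bracket p q r h x y ⊗ₜ[k] c) (_root_.map_mul φ a b)

/-- The morphism `g ⊗ N → g ⊗ N'` induced by a homomorphism `N → N'`, natural in `g`. -/
noncomputable def DGLA.tensorMap (φ : N →ₙₐ[k] N') :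
    DGLA.tensorFunctor.{u, v, w} (k := k) N ⟶ DGLA.tensorFunctor N' where
  app g :=
    { f := fun p => (φ : N →ₗ[k] N').lTensor (g.V p)
      map_d := fun p q h x =>
        LinearMap.congr_fun ((LinearMap.lTensor_comp_rTensor (f := g.d p q h)
          (g := (φ : N →ₗ[k] N'))).trans (LinearMap.rTensor_comp_lTensor ..).symm) x
      map_bracket := fun p q r h => lTensor_tensorBracket φ g p q r h }
  naturality g g' a := by
    apply DGLA.Hom.ext
    funext p
    exact (LinearMap.lTensor_comp_rTensor (f := DGLA.Hom.f a p)
      (g := (φ : N →ₗ[k] N'))).trans (LinearMap.rTensor_comp_lTensor ..).symm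

namespace CosimplicialDGLA

/-- The morphism `L ⊗ N → L ⊗ N'` induced by a homomorphism `N → N'`. -/
noncomputable abbrev tensorMap (L : CosimplicialDGLA.{u, v} k) (φ : N →ₙₐ[k] N') :
    L ⋙ DGLA.tensorFunctor N ⟶ L ⋙ DGLA.tensorFunctor N' :=
  Functor.whiskerLeft L (DGLA.tensorMap φ)

lemma whiskerRight_tensorMap {L₁ L₂ : CosimplicialDGLA.{u, v} k} (f : L₁ ⟶ L₂)
    (φ : N →ₙₐ[k] N') :
    Functor.whiskerRight f (DGLA.tensorFunctor N) ≫ tensorMap L₂ φ =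
      tensorMap L₁ φ ≫ Functor.whiskerRight f (DGLA.tensorFunctor N') := by
  ext n : 2
  exact (DGLA.tensorMap φ).naturality (f.app n)

variable {i : N →ₙₐ[k] N'} {q : N' →ₙₐ[k] N''}

lemma app_tensorMap_injective (L : CosimplicialDGLA.{u, v} k) (hi : Function.Injective i) (n : ℕ)
    (p : ℤ) : Function.Injective (app (tensorMap L i) n p) :=
  Module.Flat.lTensor_preserves_injective_linearMap (i : N →ₗ[k] N') hi

lemma app_tensorMap_exact (L : CosimplicialDGLA.{u, v} k) (hiq : Function.Exact i q)
    (hq : Function.Surjective q) (n : ℕ) (p : ℤ) :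
    Function.Exact (app (tensorMap L i) n p) (app (tensorMap L q) n p) :=
  lTensor_exact (L.Comp n p) (f := (i : N →ₗ[k] N')) (g := (q : N' →ₗ[k] N'')) hiq hq

/-- A square-zero extension `N'` of `N''` by an ideal `N` that annihilates `N'` yields a central
extension of cosimplicial DGLAs. -/
lemma isCentralExtension_tensorMap (L : CosimplicialDGLA.{u, v} k) (hiq : Function.Exact i q)
    (hq : Function.Surjective q) (hi : ∀ a b, i a * b = 0) :
    IsCentralExtension (tensorMap L q) where
  surjective n p := LinearMap.lTensor_surjective (L.Comp n p) (g := (q : N' →ₗ[k] N'')) hq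
  central n p x hx r s h y := by
    obtain ⟨z, rfl⟩ := (app_tensorMap_exact L hiq hq n p x).1 hx
    clear hx
    induction z using TensorProduct.induction_on with
    | zero => exact LinearMap.congr_fun ((congrArg _ (map_zero _)).trans (map_zero _)) y
    | add z z' hz hz' =>
      refine (LinearMap.congr_fun ((congrArg _ (map_add _ _ _)).trans (map_add _ _ _)) y).trans ?_
      exact (congrArg₂ (· + ·) hz hz').trans (add_zero _)
    | tmul z a =>
      induction y using TensorProduct.induction_on with
      | zero => exact map_zero _
      | add y y' hy hy' =>
        refine (map_add _ _ _).trans ?_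
        exact (congrArg₂ (· + ·) hy hy').trans (add_zero _)
      | tmul y b =>
        refine (congrArg (fun c => (L.obj (.mk n)).bracket p r s h z y ⊗ₜ[k] c) (hi a b)).trans ?_
        exact TensorProduct.tmul_zero _ _

end CosimplicialDGLA

end TensorMap

namespace CosimplicialDGLA

/-! ### Induction on the order of nilpotency -/

section Kernel

variable {k : Type u} [Field k] {g g' gbar : CosimplicialDGLA.{u, v} k} {ι : g' ⟶ g} {π : g ⟶ gbar}

lemma familyMap_injective (hι : ∀ n p, Function.Injective (app ι n p)) :
    Function.Injective (familyMap ι) := fun x y h => by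
  funext n p
  exact hι n p (congrFun (congrFun h n) p)

lemma familyMap_comp (x : g'.Family) : familyMap (ι ≫ π) x = familyMap π (familyMap ι x) := rfl

lemma familyMap_eq_zero (hex : ∀ n p, Function.Exact (app ι n p) (app π n p)) (x : g'.Family) :
    familyMap π (familyMap ι x) = 0 := by
  funext n p
  exact (hex n p).apply_apply_eq_zero _

lemma exists_familyMap_eq (hι : ∀ n p, Function.Injective (app ι n p))
    (hex : ∀ n p, Function.Exact (app ι n p) (app π n p)) {m : ℤ} {x : g.Family}
    (hx : x ∈ g.totalX m) (hπx : familyMap π x = 0) : ∃ x' ∈ g'.totalX m, familyMap ι x' = x := by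
  choose y hy using fun n p => (hex n p (x n p)).1 (congrFun (congrFun hπx n) p)
  exact ⟨y, fun n p h => hι n p (by rw [hy, hx n p h, map_zero]),
    funext fun n => funext fun p => hy n p⟩

/-- Acyclicity relative to the projections `π₁` and `π₂` is acyclicity on their kernels. -/
lemma IsAcyclic.isRelAcyclic {g₁ g₂ g₁' g₂' gbar₁ gbar₂ : CosimplicialDGLA.{u, v} k} {f : g₁ ⟶ g₂}
    {f' : g₁' ⟶ g₂'} {ι₁ : g₁' ⟶ g₁} {ι₂ : g₂' ⟶ g₂} {π₁ : g₁ ⟶ gbar₁} {π₂ : g₂ ⟶ gbar₂} {m : ℤ}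
    (hf' : IsAcyclic f' m) (hf : f' ≫ ι₂ = ι₁ ≫ f)
    (hι₁ : ∀ n p, Function.Injective (app ι₁ n p)) (hι₂ : ∀ n p, Function.Injective (app ι₂ n p))
    (hex₁ : ∀ n p, Function.Exact (app ι₁ n p) (app π₁ n p))
    (hex₂ : ∀ n p, Function.Exact (app ι₂ n p) (app π₂ n p)) : IsRelAcyclic f π₁ π₂ m := by
  have hf (z : g₁'.Family) : familyMap ι₂ (familyMap f' z) = familyMap f (familyMap ι₁ z) := by
    rw [← familyMap_comp, hf, familyMap_comp]
  intro x hx y hy hπx hπy hDx hDy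
  obtain ⟨x, hx', rfl⟩ := exists_familyMap_eq hι₁ hex₁ hx hπx
  obtain ⟨y, hy', rfl⟩ := exists_familyMap_eq hι₂ hex₂ hy hπy
  obtain ⟨s, hs, t, ht, hsx, hst⟩ := hf' x hx' y hy'
    (familyMap_injective hι₁ (by rw [familyMap_totalD, hDx, map_zero]))
    (familyMap_injective hι₂ (by rw [familyMap_totalD, hDy, hf]))
  refine ⟨familyMap ι₁ s, familyMap_mem _ _ _ hs, familyMap ι₂ t, familyMap_mem _ _ _ ht,
    familyMap_eq_zero hex₁ s, familyMap_eq_zero hex₂ t, ?_, ?_⟩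
  · rw [← familyMap_totalD, hsx]
  · rw [hst, map_add, hf, familyMap_totalD]

end Kernel

section Induction

variable {k : Type u} [Field k] [CharZero k]

/-- Between cosimplicial DGLAs that vanish every morphism is an equivalence. -/
lemma IsDescentEquivalence.of_subsingleton {g₁ g₂ : CosimplicialDGLA.{u, v} k}
    [∀ n : ℕ, (g₁.obj (.mk n)).IsNilp] (f : g₁ ⟶ g₂)
    [h₁ : ∀ (n : ℕ) (p : ℤ), Subsingleton ((g₁.obj (.mk n)).V p)]
    [h₂ : ∀ (n : ℕ) (p : ℤ), Subsingleton ((g₂.obj (.mk n)).V p)] : IsDescentEquivalence f where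
  essSurj _ :=
    ⟨⟨0, 0, 0, (h₁ _ _).elim _ _, (h₁ _ _).elim _ _, (h₁ _ _).elim _ _, (h₁ _ _).elim _ _⟩,
      ⟨⟨0, 0, (h₂ _ _).elim _ _, (h₂ _ _).elim _ _, (h₂ _ _).elim _ _⟩⟩⟩
  full _ _ _ :=
    ⟨⟨0, 0, (h₁ _ _).elim _ _, (h₁ _ _).elim _ _, (h₁ _ _).elim _ _⟩,
      ⟨⟨0, (h₂ _ _).elim _ _, (h₂ _ _).elim _ _⟩⟩⟩
  bijective _ _ _ _ :=
    ⟨fun _ _ _ => DescentDatum.TwoIso.ext ((h₁ _ _).elim _ _),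
      fun _ => ⟨⟨0, (h₁ _ _).elim _ _, (h₁ _ _).elim _ _⟩,
        DescentDatum.TwoIso.ext ((h₂ _ _).elim _ _)⟩⟩

variable {L₁ L₂ : CosimplicialDGLA.{u, v} k} [L₁.IsBounded] [L₂.IsBounded] {f : L₁ ⟶ L₂}

/-- Induction on the order of nilpotency: `I` is an extension of its image in `A / I ^ (n + 1)` by
`I ^ (n + 1)`, which annihilates `I` if `I ^ (n + 2) = 0`. -/
theorem IsDescentEquivalence.tensor_of_pow_eq_bot (hf : ∀ m, IsAcyclic f m) (n : ℕ) :
    ∀ {A : Type w} [CommRing A] [Algebra k A] (I : Ideal A) (_ : I ^ (n + 1) = ⊥)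
      [∀ n : ℕ, ((L₁ ⋙ DGLA.tensorFunctor I).obj (.mk n)).IsNilp],
      IsDescentEquivalence (Functor.whiskerRight f (DGLA.tensorFunctor I)) := by
  induction n with
  | zero =>
    intro A _ _ I hI _
    have hI : Subsingleton I := by
      rw [zero_add, pow_one] at hI
      rw [hI]
      infer_instance
    have (L : CosimplicialDGLA.{u, v} k) (n : ℕ) (p : ℤ) :
        Subsingleton (((L ⋙ DGLA.tensorFunctor I).obj (.mk n)).V p) := by
      refine subsingleton_of_forall_eq (0 : L.Comp n p ⊗[k] I) fun z => ?_
      induction z using TensorProduct.induction_on with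
      | zero => rfl
      | tmul x a => rw [Subsingleton.elim a 0, TensorProduct.tmul_zero]
      | add x y hx hy => rw [hx, hy, add_zero]
    exact of_subsingleton _
  | succ n ih =>
    intro A _ _ I hI _
    let J := I ^ (n + 1)
    have hJI : J ≤ I := Ideal.pow_le_self n.succ_ne_zero
    let Ibar : Ideal (A ⧸ J) := I.map (Ideal.Quotient.mk J)
    have hbar : Ibar ^ (n + 1) = ⊥ := by
      rw [← Ideal.map_pow]
      exact Ideal.map_quotient_self J
    let i : J →ₙₐ[k] I :=
      { toFun := fun a => ⟨a, hJI a.2⟩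
        map_smul' := fun c a => rfl
        map_zero' := rfl
        map_add' := fun a b => rfl
        map_mul' := fun a b => rfl }
    let q : I →ₙₐ[k] Ibar :=
      { toFun := fun a => ⟨Ideal.Quotient.mk J a, Ideal.mem_map_of_mem _ a.2⟩
        map_smul' := fun c a => rfl
        map_zero' := rfl
        map_add' := fun a b => rfl
        map_mul' := fun a b => rfl }
    have hi : Function.Injective i := fun a b h => Subtype.ext (congrArg (fun c : I => (c : A)) h)
    have hq : Function.Surjective q := by
      rintro ⟨b, hb⟩
      obtain ⟨a, ha, rfl⟩ := (Ideal.mem_map_iff_of_surjective _ Ideal.Quotient.mk_surjective).1 hb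
      exact ⟨⟨a, ha⟩, rfl⟩
    have hiq : Function.Exact i q := fun a => by
      refine ⟨fun h => ?_, ?_⟩
      · exact ⟨⟨a, Ideal.Quotient.eq_zero_iff_mem.1 (congrArg Subtype.val h)⟩, rfl⟩
      · rintro ⟨a, rfl⟩
        exact Subtype.ext (Ideal.Quotient.eq_zero_iff_mem.2 a.2)
    have hmul (a : J) (b : I) : i a * b = 0 := by
      have h : (a : A) * b ∈ I ^ (n + 1) * I := Ideal.mul_mem_mul a.2 b.2
      rw [← pow_succ, hI] at h
      exact Subtype.ext h
    have h₂ (m : ℕ) : ((L₂ ⋙ DGLA.tensorFunctor I).obj (.mk m)).IsNilp :=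
      DGLA.isNilp_tensor I _ ⟨_, hI⟩
    have hbar₁ (m : ℕ) : ((L₁ ⋙ DGLA.tensorFunctor Ibar).obj (.mk m)).IsNilp :=
      DGLA.isNilp_tensor Ibar _ ⟨_, hbar⟩
    have hbar₂ (m : ℕ) : ((L₂ ⋙ DGLA.tensorFunctor Ibar).obj (.mk m)).IsNilp :=
      DGLA.isNilp_tensor Ibar _ ⟨_, hbar⟩
    exact of_isCentralExtension (whiskerRight_tensorMap f q)
      (isCentralExtension_tensorMap L₁ hiq hq hmul) (isCentralExtension_tensorMap L₂ hiq hq hmul)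
      (ih Ibar hbar) fun m => ((hf m).tensor J).isRelAcyclic (whiskerRight_tensorMap f i)
        (app_tensorMap_injective L₁ hi) (app_tensorMap_injective L₂ hi)
        (app_tensorMap_exact L₁ hiq hq) (app_tensorMap_exact L₂ hiq hq)

end Induction

end CosimplicialDGLA

namespace CosimplicialDGLA

/-! ### The map on equivalence classes -/

section Classes

variable {k : Type u} [Field k] [CharZero k] {g₁ g₂ : CosimplicialDGLA.{u, v} k}
  [∀ n : ℕ, (g₁.obj (.mk n)).IsNilp] [∀ n : ℕ, (g₂.obj (.mk n)).IsNilp]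
  [g₁.IsBounded] [g₂.IsBounded] {f : g₁ ⟶ g₂}

lemma IsDescentEquivalence.bijective_isoClasses (hf : IsDescentEquivalence f) :
    Function.Bijective (DescentDatum.IsoClasses.map f) := by
  refine ⟨?_, ?_⟩
  · rintro ⟨A⟩ ⟨A'⟩ h
    obtain ⟨φ⟩ := (DescentDatum.equivalence_isomorphic g₂).eqvGen_iff.1 (Quot.eqvGen_exact h)
    obtain ⟨ψ, -⟩ := hf.full A A' φ
    exact Quot.sound ⟨ψ⟩
  · rintro ⟨B⟩
    obtain ⟨A, hA⟩ := hf.essSurj B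
    exact ⟨Quot.mk _ A, Quot.sound hA⟩

lemma IsDescentEquivalence.bijective_isoModTwoIso (hf : IsDescentEquivalence f)
    (A A' : DescentDatum g₁) :
    Function.Bijective (DescentDatum.IsoModTwoIso.map f A A') := by
  refine ⟨?_, ?_⟩
  · rintro ⟨φ⟩ ⟨ψ⟩ h
    obtain ⟨b⟩ := (DescentDatum.equivalence_twoIsomorphic (A.map f) (A'.map f)).eqvGen_iff.1
      (Quot.eqvGen_exact h)
    obtain ⟨a, -⟩ := (hf.bijective A A' φ ψ).2 b
    exact Quot.sound ⟨a⟩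
  · rintro ⟨φ⟩
    obtain ⟨ψ, hψ⟩ := hf.full A A' φ
    exact ⟨Quot.mk _ ψ, Quot.sound hψ⟩

end Classes

end CosimplicialDGLA

theorem mainTheorem8 {k : Type u} [Field k] [CharZero k]
    {𝔞 : Type w} [CommRing 𝔞] [Algebra k 𝔞] [IsLocalRing 𝔞] [IsArtinianRing 𝔞]
    (L₁ L₂ : CosimplicialDGLA.{u, v} k)
    (h₁ : ∀ (n : ℕ) (p : ℤ), p < -1 → Subsingleton (L₁.Comp n p))
    (h₂ : ∀ (n : ℕ) (p : ℤ), p < -1 → Subsingleton (L₂.Comp n p))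
    (f : L₁ ⟶ L₂) :
    -- isomorphism and two-isomorphism are equivalence relations
    (∀ L : CosimplicialDGLA.{u, v} k,
      (∀ (n : ℕ) (p : ℤ), p < -1 → Subsingleton (L.Comp n p)) →
        _root_.Equivalence (CosimplicialDGLA.DescentDatum.Isomorphic
          (g := CosimplicialDGLA.tensorMax 𝔞 L)) ∧
        ∀ A A' : CosimplicialDGLA.DescentDatum (CosimplicialDGLA.tensorMax 𝔞 L),
          _root_.Equivalence (CosimplicialDGLA.DescentDatum.TwoIsomorphic (A := A) (A' := A'))) ∧
    -- a) the map on descent data respects isomorphism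
    (∀ A A' : CosimplicialDGLA.DescentDatum (CosimplicialDGLA.tensorMax 𝔞 L₁),
      A.Isomorphic A' →
        (A.map (CosimplicialDGLA.tensorMaxMap 𝔞 f)).Isomorphic
          (A'.map (CosimplicialDGLA.tensorMaxMap 𝔞 f))) ∧
    (QuasiIso (CosimplicialDGLA.totalMap f) →
      -- b)
      Function.Bijective (CosimplicialDGLA.DescentDatum.IsoClasses.map
        (CosimplicialDGLA.tensorMaxMap 𝔞 f)) ∧
      -- c)
      (∀ A A' : CosimplicialDGLA.DescentDatum (CosimplicialDGLA.tensorMax 𝔞 L₁),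
        Function.Bijective (CosimplicialDGLA.DescentDatum.IsoModTwoIso.map
          (CosimplicialDGLA.tensorMaxMap 𝔞 f) A A')) ∧
      -- d)
      (∀ (A A' : CosimplicialDGLA.DescentDatum (CosimplicialDGLA.tensorMax 𝔞 L₁))
        (φ ψ : CosimplicialDGLA.DescentDatum.Iso A A'),
        Function.Bijective (fun a : CosimplicialDGLA.DescentDatum.TwoIso φ ψ =>
          a.map (CosimplicialDGLA.tensorMaxMap 𝔞 f)))) := by
  have hnil : IsNilpotent (IsLocalRing.maximalIdeal 𝔞) := by
    rw [← IsLocalRing.jacobson_eq_maximalIdeal (⊥ : Ideal 𝔞) bot_ne_top]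
    exact IsArtinianRing.isNilpotent_jacobson_bot
  have hbdd (L : CosimplicialDGLA.{u, v} k)
      (h : ∀ (n : ℕ) (p : ℤ), p < -1 → Subsingleton (L.Comp n p)) :
      (CosimplicialDGLA.tensorMax 𝔞 L).IsBounded := by
    have : L.IsBounded := ⟨h⟩
    exact inferInstanceAs (CosimplicialDGLA.IsBounded
      (L ⋙ DGLA.tensorFunctor (IsLocalRing.maximalIdeal 𝔞)))
  refine ⟨fun L h => ?_, fun A A' ⟨φ⟩ => ⟨φ.map _⟩, fun hf => ?_⟩
  · have := hbdd L h
    exact ⟨CosimplicialDGLA.DescentDatum.equivalence_isomorphic _,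
      CosimplicialDGLA.DescentDatum.equivalence_twoIsomorphic⟩
  · have : L₁.IsBounded := ⟨h₁⟩
    have : L₂.IsBounded := ⟨h₂⟩
    have := hbdd L₁ h₁
    have := hbdd L₂ h₂
    obtain ⟨n, hn⟩ := hnil
    have hn : IsLocalRing.maximalIdeal 𝔞 ^ (n + 1) = ⊥ := by
      rw [pow_succ, hn, zero_mul, Ideal.zero_eq_bot]
    have (m : ℕ) :
        ((L₁ ⋙ DGLA.tensorFunctor (IsLocalRing.maximalIdeal 𝔞)).obj (.mk m)).IsNilp :=
      CosimplicialDGLA.isNilp_tensorMax 𝔞 L₁ m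
    have key : CosimplicialDGLA.IsDescentEquivalence (CosimplicialDGLA.tensorMaxMap 𝔞 f) :=
      CosimplicialDGLA.IsDescentEquivalence.tensor_of_pow_eq_bot
        (CosimplicialDGLA.isAcyclic_of_quasiIso f hf) n (IsLocalRing.maximalIdeal 𝔞) hn
    exact ⟨key.bijective_isoClasses, key.bijective_isoModTwoIso, key.bijective⟩
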